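/- Setting. Let $\mathbb G$ be a second countable locally compact group, $\mu$ a Borel probability measure on $\mathbb G$, $\Omega=\mathbb G^{\mathbb N^*}$ with $\mathbb P=\mu^{\otimes\mathbb N^*}$ and coordinate maps $g_1,g_2,\dots$, and let $\mathscr A_p$ ($p\ge 0$) be the $\sigma$-algebra spanned by $g_1,\dots,g_p$. Let $\mathbb X$ be a second countable locally compact space with a continuous action of $\mathbb G$ and a $\mu$-stationary Borel probability measure $\nu$. Let $\sigma:\mathbb G\times\mathbb X\to\mathbb R$ be a continuous cocycle, $\sigma(g_2g_1,x)=\sigma(g_2,g_1x)+\sigma(g_1,x)$. Assume that $\int_{\mathbb G} e^{\alpha_0\sup_{x}|\sigma(g,x)|}\,\mu(dg)<\infty$ for some $\alpha_0>0$ and that $\int_{\mathbb G}\sigma(g,x)\,\mu(dg)=0$ for every $x\in\mathbb X$. Put $S^x_n=\sigma(g_n\cdots g_1,x)$ and $T(\omega,x)=((g_2,g_3,\dots),g_1x)$. Assume the strong approximation property: on some enlargement of $(\Omega,\mathbb P)$ (with probability again denoted by $\mathbb P$) there are a standard Wiener process $(B_t)_{t\ge0}$ and a constant $\mathbf v>0$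 such that for every $\varepsilon\in(0,\frac14)$ there is $c_\varepsilon>0$ with $$\mathbb P\Big(\sup_{0\le t\le1}\big|S^x_{[nt]}-\mathbf vB_{nt}\big|>n^{1/2-\varepsilon}\Big)\le c_\varepsilon n^{-\varepsilon}\qquad\text{for all }x\in\mathbb X,\ n\ge1.$$ For a sequence $\mathfrak f=(f_n)_{n\ge0}$ of measurable functions on $\Omega\times\mathbb X$ and $\alpha,\beta>0$ let $$C_\alpha(\mathfrak f)=\sup_{n}\int_{\mathbb X}\int_\Omega e^{\alpha|f_n(\omega,x)|}\,\mathbb P(d\omega)\,\nu(dx),$$ $$D_{\alpha,\beta}(\mathfrak f)=\sup_{n}\sup_{p\ge0}e^{\beta p}\Big(\int_{\mathbb X}\int_\Omega e^{\alpha|f_n(\omega,x)-\mathbb E(f_n(\cdot,x)|\mathscr A_p)(\omega)|}\,\mathbb P(d\omega)\,\nu(dx)-1\Big),$$ and for $\theta\in L^\infty(\Omega,\mathbb P)$ let $N_\beta(\theta)=\sup_{p\ge0}e^{\beta p}\,\mathbb E|\theta-\mathbb E(\theta|\mathscr A_p)|$. For $x\in\mathbb X$ and $t\in\mathbb R$ let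 $$\tau^{\mathfrak f}_{x,t}=\min\{k\ge1:\ t+S^x_k+f_k(T^k(\omega,x))-f_0(\omega,x)<0\}\in\mathbb N^*\cup\{\infty\},$$ $$U^{\mathfrak f,\theta}_n(t)=\int_{\mathbb X}\mathbb E\big((t+S^x_n+f_n(T^n(\omega,x))-f_0(\omega,x))\,\theta(\omega);\ \tau^{\mathfrak f}_{x,t}>n\big)\,\nu(dx).$$ Fix $\alpha>0$, $\beta>0$ and $B\ge1$. Call $\mathfrak f$ admissible if $C_\alpha(\mathfrak f)\le B$ and $D_{\alpha,\beta}(\mathfrak f)\le B$, and call $\theta\in L^\infty(\Omega,\mathbb P)$ admissible if $\theta\ge0$, $\|\theta\|_\infty\le B$ and $N_\beta(\theta)\le B$. Theorem A.1. For all admissible $\mathfrak f$ and $\theta$ there is an increasing (that is, non-decreasing) function $U^{\mathfrak f,\theta}:\mathbb R\to\mathbb R_+$, unique up to its values on a countable set, such that $\int_{\mathbb R}U^{\mathfrak f,\theta}_n(t)\psi(t)\,dt\to\int_{\mathbb R}U^{\mathfrak f,\theta}(t)\psi(t)\,dt$ for every continuous compactly supported $\psi:\mathbb R\to\mathbb R$.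 Moreover, for every continuous compactly supported $\varphi:\mathbb R\to\mathbb R$, uniformly over all admissible $\mathfrak f$ and $\theta$, $$\lim_{n\to\infty}\frac{\mathbf v\sqrt{2\pi n}}{2}\int_{\mathbb X}\int_{\mathbb R}\varphi(t)\,\mathbb E\big(\theta(\omega);\ \tau^{\mathfrak f}_{x,t}>n\big)\,dt\,\nu(dx)=\int_{\mathbb R}\varphi(t)\,U^{\mathfrak f,\theta}(t)\,dt .$$ -/

import Mathlib

open MeasureTheory ProbabilityTheory Filter Topology
open scoped ENNReal NNReal

namespace PerturbedWalk

section Path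

variable {G : Type*} [Group G] [MeasurableSpace G]

/-- The law `μ^{⊗ ℕ*}` on the space `Ω` of sequences `ω = (g₁, g₂, …)`.
Sequences are indexed from `0`, so that `ω i` is `g_{i+1}`. -/
noncomputable def pathLaw (μ : Measure G) : Measure (ℕ → G) :=
  Measure.infinitePi (fun _ : ℕ => μ)

/-- The product `g_n ⋯ g₁`. -/
def leftProd (ω : ℕ → G) : ℕ → G
  | 0 => 1
  | n + 1 => ω n * leftProd ω n

/-- The σ-algebra `𝒜_p` on `Ω` spanned by the coordinates `g₁, …, g_p`. -/
@[reducible] def coordAlgebra (G : Type*) [MeasurableSpace G] (p : ℕ) : MeasurableSpace (ℕ → G) :=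
  MeasurableSpace.comap (fun (ω : ℕ → G) (i : Fin p) => ω i) MeasurableSpace.pi

theorem coordAlgebra_le (G : Type*) [MeasurableSpace G] (p : ℕ) :
    coordAlgebra G p ≤ MeasurableSpace.pi :=
  Measurable.comap_le (measurable_pi_lambda _ fun i => measurable_pi_apply (i : ℕ))

/-- `N_β(θ) = sup_{p ≥ 0} e^{βp} 𝔼 |θ - 𝔼(θ | 𝒜_p)|`. -/
noncomputable def twistRate (μ : Measure G) (β : ℝ) (θ : (ℕ → G) → ℝ) : ℝ≥0∞ :=
  ⨆ p : ℕ, ENNReal.ofReal (Real.exp (β * p)) *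
    ∫⁻ ω, ENNReal.ofReal |θ ω - (pathLaw μ)[θ | coordAlgebra G p] ω| ∂(pathLaw μ)

end Path

section Walk

variable {G X : Type*} [Group G] [MulAction G X]

/-- The cocycle relation `σ(g₂ g₁, x) = σ(g₂, g₁ x) + σ(g₁, x)`. -/
def IsCocycle (σ : G → X → ℝ) : Prop :=
  ∀ (g₁ g₂ : G) (x : X), σ (g₂ * g₁) x = σ g₂ (g₁ • x) + σ g₁ x

/-- The random walk `S_n^x = σ(g_n ⋯ g₁, x)`. -/
def walk (σ : G → X → ℝ) (x : X) (n : ℕ) (ω : ℕ → G) : ℝ :=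
  σ (leftProd ω n) x

/-- The shift `T((g₁, g₂, …), x) = ((g₂, g₃, …), g₁ x)` on `Ω × X`. -/
def shift (z : (ℕ → G) × X) : (ℕ → G) × X :=
  (fun i => z.1 (i + 1), z.1 0 • z.2)

/-- The perturbed walk started at `t`: `t + S_n^x + f_n ∘ T^n(ω, x) - f_0(ω, x)`. -/
def perturbedWalk (σ : G → X → ℝ) (f : ℕ → (ℕ → G) × X → ℝ) (x : X) (t : ℝ) (n : ℕ)
    (ω : ℕ → G) : ℝ :=
  t + walk σ x n ω + f n (shift^[n] (ω, x)) - f 0 (ω, x)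

/-- The exit time `τ_{x,t}^f`: the first `k ≥ 1` at which the perturbed walk started at `t` is
negative, and `⊤` if there is none. -/
noncomputable def exitTime (σ : G → X → ℝ) (f : ℕ → (ℕ → G) × X → ℝ) (x : X) (t : ℝ)
    (ω : ℕ → G) : ℕ∞ :=
  sInf {m : ℕ∞ | ∃ k : ℕ, 1 ≤ k ∧ perturbedWalk σ f x t k ω < 0 ∧ m = k}

/-- The event `{τ_{x,t}^f > n}`. -/
def survival (σ : G → X → ℝ) (f : ℕ → (ℕ → G) × X → ℝ) (x : X) (t : ℝ) (n : ℕ) :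
    Set (ℕ → G) :=
  {ω | (n : ℕ∞) < exitTime σ f x t ω}

variable [MeasurableSpace G] [MeasurableSpace X]

/-- `ν` is `μ`-stationary: `μ * ν = ν`. -/
def IsStationary (μ : Measure G) (ν : Measure X) : Prop :=
  Measure.map (fun p : G × X => p.1 • p.2) (μ.prod ν) = ν

/-- `σ` has an exponential moment: `∫ exp (α sup_x |σ(g, x)|) μ(dg) < ∞` for some `α > 0`. -/
def HasExpMoment (μ : Measure G) (σ : G → X → ℝ) : Prop :=
  ∃ α : ℝ, 0 < α ∧ ∫⁻ g, ⨆ x : X, ENNReal.ofReal (Real.exp (α * |σ g x|)) ∂μ < ∞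

/-- `σ` is centered in the strong sense: `∫ σ(g, x) μ(dg) = 0` for every `x`. -/
def IsCentered (μ : Measure G) (σ : G → X → ℝ) : Prop :=
  ∀ x : X, ∫ g, σ g x ∂μ = 0

/-- The strong approximation property on an enlargement `π : Ω' → Ω` of the probability space
`(Ω, μ^{⊗ ℕ*})`, with the standard Wiener process `W` on `(Ω', P')` and the constant `v`: for every
`ε ∈ (0, 1/4)` there is `c > 0` such that for all `x` and all `n ≥ 1`,
`P' (sup_{0 ≤ t ≤ 1} |S^x_{[nt]} - v W_{nt}| > n^{1/2 - ε}) ≤ c n^{-ε}`. -/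
structure IsStrongApproximation {Ω' : Type*} [MeasurableSpace Ω'] (μ : Measure G)
    (σ : G → X → ℝ) (v : ℝ) (P' : Measure Ω') (π : Ω' → ℕ → G) (W : ℝ≥0 → Ω' → ℝ) : Prop where
  measurePreserving : MeasurePreserving π P' (pathLaw μ)
  isBrownian : IsBrownianReal W P'
  bound : ∀ ε : ℝ, 0 < ε → ε < 1 / 4 → ∃ c : ℝ, 0 < c ∧ ∀ (x : X) (n : ℕ), 1 ≤ n →
    P' {ω' | ENNReal.ofReal ((n : ℝ) ^ (1 / 2 - ε)) <
        ⨆ t ∈ Set.Icc (0 : ℝ≥0) 1,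
          ENNReal.ofReal |walk σ x ⌊(n : ℝ≥0) * t⌋₊ (π ω') - v * W ((n : ℝ≥0) * t) ω'|}
      ≤ ENNReal.ofReal (c * (n : ℝ) ^ (-ε))

/-- `C_α(f) = sup_n ∫_X ∫_Ω exp (α |f_n(ω, x)|) ℙ(dω) ν(dx)`. -/
noncomputable def momentConst (μ : Measure G) (ν : Measure X) (α : ℝ)
    (f : ℕ → (ℕ → G) × X → ℝ) : ℝ≥0∞ :=
  ⨆ n : ℕ, ∫⁻ x, ∫⁻ ω, ENNReal.ofReal (Real.exp (α * |f n (ω, x)|)) ∂(pathLaw μ) ∂ν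

/-- `D_{α,β}(f) = sup_n sup_p e^{βp}
  (∫_X ∫_Ω exp (α |f_n(ω, x) - 𝔼(f_n(·, x) | 𝒜_p)(ω)|) ℙ(dω) ν(dx) - 1)`.
The double integral is at least `1`, so that the subtraction in `[0, ∞]` does not truncate. -/
noncomputable def approxConst (μ : Measure G) (ν : Measure X) (α β : ℝ)
    (f : ℕ → (ℕ → G) × X → ℝ) : ℝ≥0∞ :=
  ⨆ (n : ℕ) (p : ℕ), ENNReal.ofReal (Real.exp (β * p)) *
    ((∫⁻ x, ∫⁻ ω, ENNReal.ofReal (Real.exp (α *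
        |f n (ω, x) - (pathLaw μ)[fun ω' => f n (ω', x) | coordAlgebra G p] ω|))
      ∂(pathLaw μ) ∂ν) - 1)

/-- The admissible perturbations: sequences of measurable functions `f_n` on `Ω × X` with
`C_α(f) ≤ b` and `D_{α,β}(f) ≤ b`. -/
structure IsAdmissiblePerturbation (μ : Measure G) (ν : Measure X) (α β b : ℝ)
    (f : ℕ → (ℕ → G) × X → ℝ) : Prop where
  measurable : ∀ n, Measurable (f n)
  moment : momentConst μ ν α f ≤ ENNReal.ofReal b
  approx : approxConst μ ν α β f ≤ ENNReal.ofReal b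

/-- The admissible twists: non-negative `θ ∈ L^∞(Ω, ℙ)` with `‖θ‖_∞ ≤ b` and `N_β(θ) ≤ b`. -/
structure IsAdmissibleTwist (μ : Measure G) (β b : ℝ) (θ : (ℕ → G) → ℝ) : Prop where
  memLp : MemLp θ ∞ (pathLaw μ)
  nonneg : 0 ≤ᵐ[pathLaw μ] θ
  norm_le : eLpNorm θ ∞ (pathLaw μ) ≤ ENNReal.ofReal b
  rate_le : twistRate μ β θ ≤ ENNReal.ofReal b

/-- `U_n^{f,θ}(t) = ∫_X 𝔼((t + S_n^x + f_n ∘ T^n - f_0) θ; τ_{x,t}^f > n) ν(dx)`. -/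
noncomputable def preharmonic (μ : Measure G) (ν : Measure X) (σ : G → X → ℝ)
    (f : ℕ → (ℕ → G) × X → ℝ) (θ : (ℕ → G) → ℝ) (n : ℕ) (t : ℝ) : ℝ :=
  ∫ x, ∫ ω in survival σ f x t n, perturbedWalk σ f x t n ω * θ ω ∂(pathLaw μ) ∂ν

/-- `U` is a version of the function `U^{f,θ}`: an increasing function `ℝ → ℝ₊` such that
`∫ U_n^{f,θ}(t) ψ(t) dt → ∫ U(t) ψ(t) dt` for every continuous compactly supported `ψ`.
Two such functions agree outside a countable set. -/
structure IsHarmonicLimit (μ : Measure G) (ν : Measure X) (σ : G → X → ℝ)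
    (f : ℕ → (ℕ → G) × X → ℝ) (θ : (ℕ → G) → ℝ) (U : ℝ → ℝ) : Prop where
  mono : Monotone U
  nonneg : ∀ t, 0 ≤ U t
  tendsto : ∀ ψ : ℝ → ℝ, Continuous ψ → HasCompactSupport ψ →
    Tendsto (fun n : ℕ => ∫ t, preharmonic μ ν σ f θ n t * ψ t) atTop (𝓝 (∫ t, U t * ψ t))

end Walk

end PerturbedWalk

open PerturbedWalk

/-!
Fix a nonnegative test function `φ`, give the starting height `t` the law `φ(t) dt`, and let
`q n` (`aliveMass`) and `a n` (`aliveHeight`) be the total weight and the total weighted height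
at time `n` of the paths along which the perturbed walk is nonnegative at the times `1, …, n`. By
Fubini, `q n` is the integral of `φ` against the survival probabilities, and `a n` is the
integral of the preharmonic function `U_n` against `φ`. Put `κ = v √(2π) / 2`. It has to be shown
that `a n` has a limit `l` and that `κ √n q n` tends to `l`, uniformly over admissible
perturbations and twists.

*Bounded look-ahead.* Perturbations and twists depend on the whole future of the path. They are
replaced by their averages over the steps after time `window n`, which is of order
`n ^ (1 / 16)`. By admissibility the difference is exponentially small in `window n`, hence
smaller than any power of `1 / n`. Survival is not continuous in the perturbation, but the
starting height has a bounded density and is independent of everything else, so that the mass and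
the mean height change as little (`integral_abs_weight_sub_le`,
`abs_aliveHeight_sub_aliveHeight_le`, `exists_windowApprox`).

*Heights are almost constant.* If the perturbations look at most `p` steps ahead, survival up to
time `k` is determined by the first `k + p` steps, and the height at time `k` may be replaced by
the unperturbed walk at time `k + p`, which is a martingale. Its mean on survival changes from
`k` to `k + 1` only through the paths which are killed at time `k + 1`, on which the height is
small. With all variables truncated at height `p`, which costs an exponentially small error, this
gives that `|a n - a m|` is at most a multiple of `p² q m` for `m ≤ n`
(`LookAheadSystem.abs_aliveHeight_sub_le`).

*Mass and height.* By the strong approximation and the reflection principle, the unperturbed walk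
started at `y ≥ 0` stays nonnegative during `N` steps with probability about `y / (κ √N)`, with
an error of order `N ^ (3 / 8)` in `y` (`exists_stayProb_bounds`). The Markov property at time
`m + p` therefore shows that `κ √N q n` agrees with `a m` for `n = m + p + N`, up to errors which
are controlled by `q m` and by the second moment of the walk on survival
(`LookAheadSystem.mass_upper`, `LookAheadSystem.mass_lower`).

*Recursion.* These bounds, collected in `RecursionBounds`, involve `q` and `a` only. They force
`q n = O(n ^ (-3 / 8))`, then the convergence of `a n`, then `q n = O(n ^ (-1 / 2))`, and finally
the convergence of `κ √n q n` to the limit of `a n`, with a rate which depends on the constants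
only (`RecursionBounds.uniform_limit`).

The limit function exists because the functions `U_n`, `n ≥ 1`, are nonnegative and increasing
and their integrals against test functions converge (`exists_monotone_vague_limit`). Test
functions which change sign are split into positive and negative parts.
-/

namespace PerturbedWalk

set_option linter.unusedSectionVars false

/-! ### Resampling the future of a path -/

section Concat

variable {G : Type*}

/-- The path which follows `ω` for the first `j` steps and then follows `ω'` from its start. -/
def concat (j : ℕ) (ω ω' : ℕ → G) : ℕ → G := fun i => if i < j then ω i else ω' (i - j)

/-- The path `ω` with its first `j` steps removed. -/
def dropPath (j : ℕ) (ω : ℕ → G) : ℕ → G := fun i => ω (i + j)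

theorem concat_of_lt {j i : ℕ} (h : i < j) (ω ω' : ℕ → G) : concat j ω ω' i = ω i := if_pos h

theorem concat_self (j : ℕ) (ω ω' : ℕ → G) : concat j ω ω' j = ω' 0 := by simp [concat]

theorem dropPath_concat (j : ℕ) (ω ω' : ℕ → G) : dropPath j (concat j ω ω') = ω' := by
  funext i; simp [dropPath, concat]

theorem concat_concat_left {j k : ℕ} (h : j ≤ k) (ω ω' ω'' : ℕ → G) :
    concat j (concat k ω ω') ω'' = concat j ω ω'' := by
  funext i
  simp only [concat]
  grind

variable {E : Type*}

/-- A function of a path and of a further variable is past up to time `j` if it does not change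
when the steps of the path after time `j` are changed. -/
def IsPast (j : ℕ) (h : (ℕ → G) × E → ℝ) : Prop :=
  ∀ (ω ω' : ℕ → G) (e : E), h (concat j ω ω', e) = h (ω, e)

theorem IsPast.mono {j k : ℕ} {h : (ℕ → G) × E → ℝ} (hh : IsPast j h) (hjk : j ≤ k) :
    IsPast k h := fun ω ω' e => by
  rw [← hh (concat k ω ω') ω, ← hh ω ω, concat_concat_left hjk]

theorem IsPast.mul {j : ℕ} {h g : (ℕ → G) × E → ℝ} (hh : IsPast j h) (hg : IsPast j g) :
    IsPast j fun z => h z * g z := fun ω ω' e => by simp only [hh ω ω' e, hg ω ω' e]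

variable [MeasurableSpace G]

theorem measurable_concat (j : ℕ) :
    Measurable fun p : (ℕ → G) × (ℕ → G) => concat j p.1 p.2 := by
  refine measurable_pi_lambda _ fun i => ?_
  unfold concat
  split_ifs <;> fun_prop

theorem measurable_dropPath (j : ℕ) : Measurable (dropPath (G := G) j) :=
  measurable_pi_lambda _ fun _ => measurable_pi_apply _

variable (μ : Measure G)

/-- The average of `f` over the steps after time `p`; this is a jointly measurable version of the
conditional expectation given the first `p` steps. -/
noncomputable def pastMean (p : ℕ) (f : (ℕ → G) × E → ℝ) (z : (ℕ → G) × E) : ℝ :=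
  ∫ ω', f (concat p z.1 ω', z.2) ∂(pathLaw μ)

theorem isPast_pastMean (p : ℕ) (f : (ℕ → G) × E → ℝ) : IsPast p (pastMean μ p f) :=
  fun ω ω' e => by simp only [pastMean, concat_concat_left le_rfl]

variable [IsProbabilityMeasure μ]

instance : IsProbabilityMeasure (pathLaw μ) := by unfold pathLaw; infer_instance

theorem measurePreserving_concat (j : ℕ) :
    MeasurePreserving (fun p : (ℕ → G) × (ℕ → G) => concat j p.1 p.2)
      ((pathLaw μ).prod (pathLaw μ)) (pathLaw μ) := by
  refine ⟨measurable_concat j, Measure.eq_infinitePi _ fun s t ht => ?_⟩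
  classical
  rw [Measure.map_apply (measurable_concat j)
    (MeasurableSet.pi s.countable_toSet fun i _ => ht i)]
  have h : (fun p : (ℕ → G) × (ℕ → G) => concat j p.1 p.2) ⁻¹' (Set.pi s t) =
      (Set.pi (s.filter (· < j)) t) ×ˢ
        (Set.pi ((s.filter (¬ · < j)).image (· - j)) fun i => t (i + j)) := by
    ext ⟨ω, ω'⟩
    simp only [Set.mem_preimage, Set.mem_pi, Set.mem_prod, concat, Finset.coe_filter,
      Finset.coe_image, Set.mem_image, Set.mem_ofPred_eq]
    constructor
    · intro h
      refine ⟨fun i hi => by simpa [hi.2] using h i hi.1, ?_⟩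
      rintro _ ⟨i, ⟨hi, hj⟩, rfl⟩
      have := h i hi
      rw [if_neg hj] at this
      rwa [Nat.sub_add_cancel (not_lt.1 hj)]
    · rintro ⟨h1, h2⟩ i hi
      split_ifs with hj
      · exact h1 i ⟨hi, hj⟩
      · have := h2 (i - j) ⟨i, ⟨hi, hj⟩, rfl⟩
        rwa [Nat.sub_add_cancel (not_lt.1 hj)] at this
  rw [h, Measure.prod_prod, pathLaw, Measure.infinitePi_pi _ fun i _ => ht i,
    Measure.infinitePi_pi _ fun i _ => ht _, Finset.prod_image,
    ← Finset.prod_filter_mul_prod_filter_not s (· < j)]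
  · congr 1
    refine Finset.prod_congr rfl fun i hi => ?_
    rw [Nat.sub_add_cancel (not_lt.1 (Finset.mem_filter.1 hi).2)]
  · intro a ha b hb hab
    simp only [Finset.coe_filter, Set.mem_ofPred_eq, not_lt] at ha hb
    simp only at hab
    omega

theorem measurePreserving_eval (i : ℕ) :
    MeasurePreserving (fun ω : ℕ → G => ω i) (pathLaw μ) μ :=
  measurePreserving_eval_infinitePi (fun _ : ℕ => μ) i

variable [MeasurableSpace E]

/-- The map `((ω, e), ω') ↦ (concat j ω ω', e)` preserves the product laws: the future of a path
may be drawn afresh after time `j`. -/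
theorem measurePreserving_resample (ρ : Measure E) [SFinite ρ] (j : ℕ) :
    MeasurePreserving (fun q : ((ℕ → G) × E) × (ℕ → G) => (concat j q.1.1 q.2, q.1.2))
      (((pathLaw μ).prod ρ).prod (pathLaw μ)) ((pathLaw μ).prod ρ) := by
  have h1 : MeasurePreserving
      (Prod.map (fun p : (ℕ → G) × (ℕ → G) => concat j p.1 p.2) (id : E → E))
      (((pathLaw μ).prod (pathLaw μ)).prod ρ) ((pathLaw μ).prod ρ) :=
    (measurePreserving_concat μ j).prod (MeasurePreserving.id ρ)
  have h2 : MeasurePreserving (MeasurableEquiv.prodAssoc (α := ℕ → G) (β := E) (γ := ℕ → G))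
      (((pathLaw μ).prod ρ).prod (pathLaw μ)) ((pathLaw μ).prod (ρ.prod (pathLaw μ))) :=
    measurePreserving_prodAssoc _ _ _
  have h3 : MeasurePreserving (Prod.map (id : (ℕ → G) → (ℕ → G)) (Prod.swap : E × (ℕ → G) → _))
      ((pathLaw μ).prod (ρ.prod (pathLaw μ))) ((pathLaw μ).prod ((pathLaw μ).prod ρ)) :=
    (MeasurePreserving.id _).prod Measure.measurePreserving_swap
  have h4 : MeasurePreserving
      (MeasurableEquiv.prodAssoc (α := ℕ → G) (β := ℕ → G) (γ := E)).symm
      ((pathLaw μ).prod ((pathLaw μ).prod ρ)) (((pathLaw μ).prod (pathLaw μ)).prod ρ) :=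
    (measurePreserving_prodAssoc _ _ _).symm _
  exact h1.comp (h4.comp (h3.comp h2))

variable {μ} in
theorem integral_resample {ρ : Measure E} [SFinite ρ] (j : ℕ) {H : (ℕ → G) × E → ℝ}
    (hH : Integrable H ((pathLaw μ).prod ρ)) :
    ∫ z, H z ∂((pathLaw μ).prod ρ) =
      ∫ z, ∫ ω', H (concat j z.1 ω', z.2) ∂(pathLaw μ) ∂((pathLaw μ).prod ρ) := by
  have h := measurePreserving_resample μ ρ j
  have h1 : Integrable (fun q : ((ℕ → G) × E) × (ℕ → G) => H (concat j q.1.1 q.2, q.1.2))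
      (((pathLaw μ).prod ρ).prod (pathLaw μ)) := h.integrable_comp_of_integrable hH
  rw [← integral_prod _ h1]
  nth_rw 1 [← h.map_eq]
  refine integral_map h.aemeasurable ?_
  rw [h.map_eq]
  exact hH.aestronglyMeasurable

variable {μ} in
theorem integrable_resample {ρ : Measure E} [SFinite ρ] (j : ℕ) {H : (ℕ → G) × E → ℝ}
    (hH : Integrable H ((pathLaw μ).prod ρ)) :
    Integrable (fun z => ∫ ω', H (concat j z.1 ω', z.2) ∂(pathLaw μ)) ((pathLaw μ).prod ρ) :=
  ((measurePreserving_resample μ ρ j).integrable_comp_of_integrable hH).integral_prod_left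

theorem measurable_pastMean (p : ℕ) {f : (ℕ → G) × E → ℝ} (hf : Measurable f) :
    Measurable (pastMean μ p f) := by
  have h1 : Measurable fun q : ((ℕ → G) × E) × (ℕ → G) => f (concat p q.1.1 q.2, q.1.2) :=
    hf.comp (((measurable_concat p).comp
      ((measurable_fst.comp measurable_fst).prodMk measurable_snd)).prodMk
        (measurable_snd.comp measurable_fst))
  exact (h1.stronglyMeasurable.integral_prod_right (ν := pathLaw μ)).measurable

variable {μ} in
/-- The average over independent copies of the steps after time `p` is a version of the conditional
expectation given the first `p` steps. -/
theorem condExp_coordAlgebra_eq [Group G] (p : ℕ) {f : (ℕ → G) → ℝ} (hf : Measurable f)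
    (hi : Integrable f (pathLaw μ)) :
    (pathLaw μ)[f | coordAlgebra G p] =ᵐ[pathLaw μ]
      fun ω => ∫ ω', f (concat p ω ω') ∂(pathLaw μ) := by
  have hmp := measurePreserving_concat μ p
  have hi2 := hmp.integrable_comp_of_integrable hi
  have hgi : Integrable (fun ω => ∫ ω', f (concat p ω ω') ∂(pathLaw μ)) (pathLaw μ) :=
    hi2.integral_prod_left
  have hgm : Measurable fun ω => ∫ ω', f (concat p ω ω') ∂(pathLaw μ) :=
    ((hf.comp (measurable_concat p)).stronglyMeasurable.integral_prod_right'
      (ν := pathLaw μ)).measurable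
  have hc : @Measurable _ _ (coordAlgebra G p) _ (fun ω : ℕ → G => concat p ω (fun _ => 1)) := by
    refine @measurable_pi_lambda _ _ _ (coordAlgebra G p) _ _ fun i => ?_
    by_cases h : i < p
    · simp only [concat, if_pos h]
      have h1 : @Measurable _ _ (coordAlgebra G p) _ (fun (ω : ℕ → G) (i : Fin p) => ω i) :=
        comap_measurable _
      exact (measurable_pi_apply (⟨i, h⟩ : Fin p)).comp h1
    · simp only [concat, if_neg h]
      exact @measurable_const _ _ _ (coordAlgebra G p) _
  symm
  refine ae_eq_condExp_of_forall_setIntegral_eq (coordAlgebra_le G p) hi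
    (fun s _ _ => hgi.integrableOn) (fun s hs _ => ?_) ?_
  · have hs' := coordAlgebra_le G p s hs
    have hpast : ∀ ω ω', concat p ω ω' ∈ s ↔ ω ∈ s := by
      obtain ⟨t, -, rfl⟩ := hs
      intro ω ω'
      simp only [Set.mem_preimage]
      have : (fun i : Fin p => concat p ω ω' i) = fun i : Fin p => ω i := by
        funext i; exact concat_of_lt i.2 _ _
      rw [this]
    rw [← integral_indicator hs', ← integral_indicator hs']
    have h1 : ∫ ω, s.indicator f ω ∂(pathLaw μ) =
        ∫ q, s.indicator f (concat p q.1 q.2) ∂((pathLaw μ).prod (pathLaw μ)) := by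
      conv_lhs => rw [← hmp.map_eq]
      rw [integral_map hmp.aemeasurable]
      exact (hf.indicator hs').aestronglyMeasurable
    rw [h1, integral_prod]
    · refine integral_congr_ae (ae_of_all _ fun ω => ?_)
      by_cases hω : ω ∈ s
      · simp [hω, Set.indicator, hpast]
      · simp [hω, Set.indicator, hpast]
    · exact hmp.integrable_comp_of_integrable (hi.indicator hs')
  · have : (fun ω => ∫ ω', f (concat p ω ω') ∂(pathLaw μ)) =
        (fun ω => ∫ ω', f (concat p ω ω') ∂(pathLaw μ)) ∘ fun ω => concat p ω (fun _ => 1) := by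
      funext ω; simp only [Function.comp, concat_concat_left le_rfl]
    rw [this]
    exact (hgm.comp hc).stronglyMeasurable.aestronglyMeasurable

end Concat

/-! ### Algebra and measurability of the walk -/

section WalkBasics

variable {G X : Type*} [Group G] [MulAction G X]

theorem leftProd_add (ω : ℕ → G) (j k : ℕ) :
    leftProd ω (j + k) = leftProd (dropPath j ω) k * leftProd ω j := by
  induction k with
  | zero => simp [leftProd]
  | succ k ih => rw [← add_assoc, leftProd, ih, leftProd, mul_assoc, dropPath, add_comm j k]

theorem leftProd_concat {j k : ℕ} (h : k ≤ j) (ω ω' : ℕ → G) :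
    leftProd (concat j ω ω') k = leftProd ω k := by
  induction k with
  | zero => rfl
  | succ k ih => rw [leftProd, leftProd, ih (by omega), concat_of_lt (by omega)]

theorem shift_iterate (n : ℕ) (ω : ℕ → G) (x : X) :
    shift^[n] (ω, x) = (dropPath n ω, leftProd ω n • x) := by
  induction n with
  | zero =>
    simp only [Function.iterate_zero, id, leftProd, one_smul, Prod.mk.injEq, and_true]
    rfl
  | succ n ih =>
    rw [Function.iterate_succ_apply', ih, shift]
    simp only [Prod.mk.injEq, dropPath, leftProd, mul_smul, zero_add, and_true]
    funext i
    congr 1; omega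

variable {σ : G → X → ℝ}

theorem mem_survival_iff (σ : G → X → ℝ) (f : ℕ → (ℕ → G) × X → ℝ) (x : X) (t : ℝ) (n : ℕ)
    (ω : ℕ → G) :
    ω ∈ survival σ f x t n ↔ ∀ k, 1 ≤ k → k ≤ n → 0 ≤ perturbedWalk σ f x t k ω := by
  simp only [survival, Set.mem_ofPred_eq, exitTime]
  constructor
  · intro h k h1 hk
    by_contra hneg
    have : sInf {m : ℕ∞ | ∃ k : ℕ, 1 ≤ k ∧ perturbedWalk σ f x t k ω < 0 ∧ m = k} ≤ (k : ℕ∞) :=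
      sInf_le ⟨k, h1, not_le.1 hneg, rfl⟩
    have h2 := h.trans_le this
    have h3 : n < k := by exact_mod_cast h2
    omega
  · intro h
    have h1 : ((n + 1 : ℕ) : ℕ∞) ≤
        sInf {m : ℕ∞ | ∃ k : ℕ, 1 ≤ k ∧ perturbedWalk σ f x t k ω < 0 ∧ m = k} := by
      refine le_sInf ?_
      rintro _ ⟨k, h1, hk, rfl⟩
      have : n < k := by
        by_contra hle
        exact absurd (h k h1 (not_lt.1 hle)) (not_le.2 hk)
      exact_mod_cast this
    refine lt_of_lt_of_le ?_ h1
    exact_mod_cast Nat.lt_succ_self n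

theorem walk_concat {j k : ℕ} (h : k ≤ j) (x : X) (ω ω' : ℕ → G) :
    walk σ x k (concat j ω ω') = walk σ x k ω := by simp only [walk, leftProd_concat h]

variable (hσ : IsCocycle σ)
include hσ

theorem IsCocycle.walk_zero (x : X) (ω : ℕ → G) : walk σ x 0 ω = 0 := by
  have := hσ 1 1 x
  simp only [mul_one, one_smul] at this
  simp only [walk, leftProd]
  linarith

theorem IsCocycle.walk_add (x : X) (j k : ℕ) (ω : ℕ → G) :
    walk σ x (j + k) ω = walk σ (leftProd ω j • x) k (dropPath j ω) + walk σ x j ω := by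
  simp only [walk, leftProd_add]
  exact hσ _ _ _

theorem IsCocycle.walk_succ (x : X) (k : ℕ) (ω : ℕ → G) :
    walk σ x (k + 1) ω = σ (ω k) (leftProd ω k • x) + walk σ x k ω := hσ _ _ _

end WalkBasics

section WalkMeas

variable {G X : Type*} [Group G] [MulAction G X] [MeasurableSpace G] [MeasurableSpace X]
  [MeasurableMul₂ G] [MeasurableSMul₂ G X]

@[fun_prop]
theorem measurable_leftProd (n : ℕ) : Measurable fun ω : ℕ → G => leftProd ω n := by
  induction n with
  | zero => exact measurable_const
  | succ n ih =>
    simp only [leftProd]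
    exact (measurable_pi_apply n).mul ih

@[fun_prop]
theorem measurable_shift : Measurable (shift : (ℕ → G) × X → (ℕ → G) × X) := by
  unfold shift
  refine Measurable.prodMk (measurable_pi_lambda _ fun i => by fun_prop) ?_
  exact ((measurable_pi_apply 0).comp measurable_fst).smul measurable_snd

theorem measurePreserving_shift (μ : Measure G) [IsProbabilityMeasure μ] {ν : Measure X}
    [IsProbabilityMeasure ν] (hν : IsStationary μ ν) :
    MeasurePreserving (shift : (ℕ → G) × X → (ℕ → G) × X) ((pathLaw μ).prod ν)
      ((pathLaw μ).prod ν) := by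
  have h1 := measurePreserving_resample μ ν 1
  have hmulti : MeasurePreserving (fun p : G × X => p.1 • p.2) (μ.prod ν) ν :=
    ⟨measurable_fst.smul measurable_snd, hν⟩
  have h2 : MeasurePreserving (fun q : ((ℕ → G) × X) × (ℕ → G) => (q.2, q.1.1 0 • q.1.2))
      (((pathLaw μ).prod ν).prod (pathLaw μ)) ((pathLaw μ).prod ν) := by
    have h3 : MeasurePreserving (Prod.map (fun ω : ℕ → G => ω 0) (id : X → X))
      ((pathLaw μ).prod ν) (μ.prod ν) :=
        (measurePreserving_eval μ 0).prod (MeasurePreserving.id ν)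
    exact Measure.measurePreserving_swap.comp
      ((hmulti.comp h3).prod (MeasurePreserving.id (pathLaw μ)))
  have h4 : (fun q : ((ℕ → G) × X) × (ℕ → G) => (q.2, q.1.1 0 • q.1.2)) =
      shift ∘ fun q : ((ℕ → G) × X) × (ℕ → G) => (concat 1 q.1.1 q.2, q.1.2) := by
    funext q
    simp only [Function.comp, shift, Prod.mk.injEq]
    refine ⟨?_, by simp [concat]⟩
    funext i; simp [concat]
  refine ⟨measurable_shift, ?_⟩
  nth_rw 1 [← h1.map_eq]
  rw [Measure.map_map measurable_shift h1.measurable, ← h4, h2.map_eq]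

theorem measurable_walk {σ : G → X → ℝ} (hσ : Measurable (Function.uncurry σ)) (n : ℕ) :
    Measurable fun z : (ℕ → G) × X => walk σ z.2 n z.1 :=
  hσ.comp (((measurable_leftProd n).comp measurable_fst).prodMk measurable_snd)

end WalkMeas

/-! ### Gaussian estimates -/

section Gaussian

theorem gaussianReal_real_Iio_eq_Ioi (w : ℝ≥0) (y : ℝ) :
    (gaussianReal 0 w).real (Set.Iio (-y)) = (gaussianReal 0 w).real (Set.Ioi y) := by
  have h := gaussianReal_map_neg (μ := 0) (v := w)
  rw [neg_zero] at h
  conv_lhs => rw [← h]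
  rw [map_measureReal_apply measurable_neg measurableSet_Iio]
  congr 1
  ext x; simp

theorem gaussianReal_real_Iio_zero_le (w : ℝ≥0) :
    (gaussianReal 0 w).real (Set.Iio 0) ≤ 1 / 2 := by
  have h := gaussianReal_real_Iio_eq_Ioi w 0
  rw [neg_zero] at h
  have h2 : (gaussianReal 0 w).real (Set.Iio 0 ∪ Set.Ioi 0) ≤ 1 := measureReal_le_one
  rw [measureReal_union (by
    rw [Set.disjoint_left]; intro x hx hx'
    exact lt_asymm (Set.mem_Iio.1 hx) (Set.mem_Ioi.1 hx')) measurableSet_Ioi] at h2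
  linarith

theorem half_le_gaussianReal_real_Iic_zero (w : ℝ≥0) :
    1 / 2 ≤ (gaussianReal 0 w).real (Set.Iic 0) := by
  have h := gaussianReal_real_Iio_zero_le w
  have h0 := gaussianReal_real_Iio_eq_Ioi w 0
  rw [neg_zero] at h0
  have h1 := probReal_add_probReal_compl (μ := gaussianReal 0 w) (measurableSet_Iic (a := (0 : ℝ)))
  rw [Set.compl_Iic] at h1
  linarith

theorem one_sub_two_mul_gaussianReal_Iio (w : ℝ≥0) {y : ℝ} (hy : 0 ≤ y) :
    1 - 2 * (gaussianReal 0 w).real (Set.Iio (-y)) =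
      (gaussianReal 0 w).real (Set.Icc (-y) y) := by
  have h0 := gaussianReal_real_Iio_eq_Ioi w y
  have h1 := probReal_add_probReal_compl (μ := gaussianReal 0 w)
    (measurableSet_Icc (a := -y) (b := y))
  have h2 : (Set.Icc (-y) y)ᶜ = Set.Iio (-y) ∪ Set.Ioi y := by
    ext x
    simp only [Set.mem_compl_iff, Set.mem_Icc, not_and_or, not_le, Set.mem_union, Set.mem_Iio,
      Set.mem_Ioi]
  rw [h2, measureReal_union (by
    rw [Set.disjoint_left]; intro x hx hx'
    have := Set.mem_Iio.1 hx
    have := Set.mem_Ioi.1 hx'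
    linarith) measurableSet_Ioi] at h1
  linarith

theorem gaussianReal_real_Icc_le {N : ℕ} (hN : 0 < N) {y : ℝ} (hy : 0 ≤ y) :
    √(2 * Real.pi * N) / 2 * (gaussianReal 0 N).real (Set.Icc (-y) y) ≤ y := by
  have hN' : (N : ℝ≥0) ≠ 0 := by exact_mod_cast hN.ne'
  have hpos : 0 < √(2 * Real.pi * N) := by
    have : (0 : ℝ) < N := by exact_mod_cast hN
    positivity
  have h1 : (gaussianReal 0 N).real (Set.Icc (-y) y) ≤ (√(2 * Real.pi * N))⁻¹ * (2 * y) := by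
    rw [measureReal_def, gaussianReal_apply_eq_integral _ hN', ENNReal.toReal_ofReal
      (setIntegral_nonneg measurableSet_Icc fun x _ => gaussianPDFReal_nonneg _ _ _)]
    calc _ ≤ ∫ x in Set.Icc (-y) y, (√(2 * Real.pi * N))⁻¹ := by
          refine setIntegral_mono_on (integrable_gaussianPDFReal _ _).integrableOn
            (integrableOn_const (by simp)) measurableSet_Icc fun x _ => ?_
          rw [gaussianPDFReal_def]
          simp only [NNReal.coe_natCast]
          refine mul_le_of_le_one_right (by positivity) (Real.exp_le_one_iff.2 ?_)
          rw [neg_div]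
          exact neg_nonpos.2 (by positivity)
      _ = _ := by
          rw [setIntegral_const, smul_eq_mul, Real.volume_real_Icc_of_le (by linarith)]
          ring
  calc _ ≤ √(2 * Real.pi * N) / 2 * ((√(2 * Real.pi * N))⁻¹ * (2 * y)) := by gcongr
    _ = y := by field_simp

theorem le_gaussianReal_real_Icc {N : ℕ} (hN : 0 < N) {y : ℝ} (hy : 0 ≤ y) :
    y - y ^ 2 / √N ≤ √(2 * Real.pi * N) / 2 * (gaussianReal 0 N).real (Set.Icc (-y) y) := by
  have hN' : (N : ℝ≥0) ≠ 0 := by exact_mod_cast hN.ne'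
  have hN0 : (0 : ℝ) < N := by exact_mod_cast hN
  have hpos : 0 < √(2 * Real.pi * N) := by positivity
  have hs : 0 < √(N : ℝ) := by positivity
  have h1 : (√(2 * Real.pi * N))⁻¹ * (1 - y / √N) * (2 * y) ≤
      (gaussianReal 0 N).real (Set.Icc (-y) y) := by
    rw [measureReal_def, gaussianReal_apply_eq_integral _ hN', ENNReal.toReal_ofReal
      (setIntegral_nonneg measurableSet_Icc fun x _ => gaussianPDFReal_nonneg _ _ _)]
    calc _ = ∫ x in Set.Icc (-y) y, (√(2 * Real.pi * N))⁻¹ * (1 - y / √N) := by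
          rw [setIntegral_const, smul_eq_mul, Real.volume_real_Icc_of_le (by linarith)]
          ring
      _ ≤ _ := by
          refine setIntegral_mono_on (integrableOn_const (by simp))
            (integrable_gaussianPDFReal _ _).integrableOn measurableSet_Icc fun x hx => ?_
          rw [gaussianPDFReal_def]
          simp only [NNReal.coe_natCast, sub_zero]
          refine mul_le_mul_of_nonneg_left ?_ (by positivity)
          have hx2 : x ^ 2 ≤ y ^ 2 := by
            rw [sq_le_sq, abs_of_nonneg hy]; exact abs_le.2 hx
          have hw : x ^ 2 / (2 * N) ≤ (y / √N) ^ 2 / 2 := by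
            rw [div_pow, Real.sq_sqrt hN0.le, div_div, mul_comm (2 : ℝ)]
            gcongr
          have hw0 : 0 ≤ y / √N := by positivity
          rcases le_total (y / √N) 1 with h | h
          · have := Real.add_one_le_exp (-x ^ 2 / (2 * N))
            rw [neg_div] at this ⊢
            nlinarith
          · have := Real.exp_pos (-x ^ 2 / (2 * N))
            linarith
  calc y - y ^ 2 / √N
      = √(2 * Real.pi * N) / 2 * ((√(2 * Real.pi * N))⁻¹ * (1 - y / √N) * (2 * y)) := by
        field_simp
    _ ≤ _ := by gcongr

theorem gaussianReal_one_real_Iic_le {L : ℝ} (hL : 0 < L) :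
    (gaussianReal 0 1).real (Set.Iic (-L)) ≤ 12 / L ^ 3 := by
  have h := measure_le_le_exp_mul_mgf (X := id) (μ := gaussianReal 0 1) (t := -1) (-L) (by norm_num)
    (integrable_exp_mul_gaussianReal _)
  rw [mgf_id_gaussianReal] at h
  have h1 : {ω : ℝ | id ω ≤ -L} = Set.Iic (-L) := rfl
  rw [h1] at h
  refine h.trans ?_
  simp only [neg_neg, one_mul, zero_mul, NNReal.coe_one, zero_add]
  have h2 : Real.exp ((-1) ^ 2 / 2) ≤ 2 := by
    have h3 : Real.exp ((-1) ^ 2 / 2) ^ 2 ≤ 2 ^ 2 := by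
      rw [← Real.exp_nat_mul]
      have := Real.exp_one_lt_d9
      norm_num
      linarith
    exact le_of_sq_le_sq h3 (by norm_num)
  have h4 : L ^ 3 / 6 ≤ Real.exp L := by
    have := Real.pow_div_factorial_le_exp L hL.le 3
    norm_num [Nat.factorial] at this
    exact this
  rw [Real.exp_neg]
  have h5 : (Real.exp L)⁻¹ ≤ 6 / L ^ 3 := by
    rw [inv_le_comm₀ (Real.exp_pos _) (by positivity), inv_div]
    exact h4
  calc _ ≤ 6 / L ^ 3 * 2 := by gcongr
    _ = _ := by ring

end Gaussian

/-! ### The reflection principle for random walks with symmetric increments -/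

section Reflection

variable {Ω' : Type*} [MeasurableSpace Ω'] {P : Measure Ω'} [IsProbabilityMeasure P]

/-- The event that `j` is the first time at which the sequence `V` is below `-y`. -/
def firstBelow (V : ℕ → Ω' → ℝ) (y : ℝ) (j : ℕ) : Set Ω' :=
  {ω | (∀ i < j, -y ≤ V i ω) ∧ V j ω < -y}

omit [MeasurableSpace Ω'] in
theorem pairwiseDisjoint_firstBelow (V : ℕ → Ω' → ℝ) (y : ℝ) (s : Set ℕ) :
    s.PairwiseDisjoint (firstBelow V y) := by
  intro i _ j _ hij
  simp only [Function.onFun, Set.disjoint_left]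
  rintro ω ⟨h1, h2⟩ ⟨h3, h4⟩
  rcases lt_or_gt_of_ne hij with h | h
  · exact absurd h2 (not_lt.2 (h3 i h))
  · exact absurd h4 (not_lt.2 (h1 j h))

omit [MeasurableSpace Ω'] in
theorem biUnion_firstBelow (V : ℕ → Ω' → ℝ) (y : ℝ) (N : ℕ) :
    ⋃ j ∈ Finset.range (N + 1), firstBelow V y j = {ω | ∃ i ≤ N, V i ω < -y} := by
  ext ω
  simp only [Finset.mem_range, Set.mem_iUnion, exists_prop, Set.mem_ofPred_eq, firstBelow]
  constructor
  · rintro ⟨j, hj, -, h⟩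
    exact ⟨j, by omega, h⟩
  · intro h
    classical
    obtain ⟨h1, h2⟩ := Nat.find_spec h
    refine ⟨Nat.find h, by omega, fun i hi => ?_, h2⟩
    by_contra hc
    exact Nat.find_min h hi ⟨by omega, not_le.1 hc⟩

theorem measurableSet_firstBelow {V : ℕ → Ω' → ℝ} (hV : ∀ i, Measurable (V i)) (y : ℝ) (j : ℕ) :
    MeasurableSet (firstBelow V y j) := by
  have : firstBelow V y j = (⋂ i ∈ Finset.range j, {ω | -y ≤ V i ω}) ∩ {ω | V j ω < -y} := by
    ext ω; simp [firstBelow]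
  rw [this]
  exact (Finset.measurableSet_biInter _ fun i _ => measurableSet_le measurable_const (hV i)).inter
    (measurableSet_lt (hV j) measurable_const)

variable {V : ℕ → Ω' → ℝ} {N : ℕ}

omit [IsProbabilityMeasure P] in
theorem measureReal_firstBelow_inter (hV : ∀ i, Measurable (V i)) (y : ℝ) {j : ℕ}
    (hind : IndepFun (fun ω => V N ω - V j ω) (fun ω (i : Fin (j + 1)) => V i ω) P)
    {S : Set ℝ} (hS : MeasurableSet S) :
    P.real (firstBelow V y j ∩ {ω | V N ω - V j ω ∈ S}) =
      P.real (firstBelow V y j) * (P.map fun ω => V N ω - V j ω).real S := by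
  have hT : firstBelow V y j = (fun ω (i : Fin (j + 1)) => V i ω) ⁻¹'
      {u : Fin (j + 1) → ℝ |
        (∀ i : Fin (j + 1), (i : ℕ) < j → -y ≤ u i) ∧ u (Fin.last j) < -y} := by
    ext ω
    simp only [firstBelow, Set.mem_ofPred_eq, Set.mem_preimage, Fin.val_last]
    refine and_congr_left fun _ => ⟨fun h i hi => h i hi, fun h i hi => ?_⟩
    exact h ⟨i, by omega⟩ hi
  have hTm : MeasurableSet {u : Fin (j + 1) → ℝ |
      (∀ i : Fin (j + 1), (i : ℕ) < j → -y ≤ u i) ∧ u (Fin.last j) < -y} := by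
    refine MeasurableSet.inter
      (s₁ := {u : Fin (j + 1) → ℝ | ∀ i : Fin (j + 1), (i : ℕ) < j → -y ≤ u i})
      (s₂ := {u : Fin (j + 1) → ℝ | u (Fin.last j) < -y}) ?_
      (measurableSet_lt (measurable_pi_apply _) measurable_const)
    rw [Set.ofPred_forall]
    refine MeasurableSet.iInter fun i => ?_
    rw [Set.ofPred_forall]
    exact MeasurableSet.iInter fun _ => measurableSet_le measurable_const (measurable_pi_apply _)
  have h := hind.measure_inter_preimage_eq_mul S _ hS hTm
  rw [← hT] at h
  rw [map_measureReal_apply (by fun_prop) hS, Set.inter_comm, measureReal_def,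
    show {ω | V N ω - V j ω ∈ S} = (fun ω => V N ω - V j ω) ⁻¹' S from rfl, h,
    ENNReal.toReal_mul, mul_comm]
  rfl

/-- The reflection principle, upper bound for the probability to go below `-y`: given the past at
the first passage time `j`, the increment `V N - V j` is nonpositive with probability at least
`1 / 2`. -/
theorem measureReal_exists_lt_le (hV : ∀ i, Measurable (V i)) (y : ℝ)
    (hind : ∀ j ≤ N, IndepFun (fun ω => V N ω - V j ω) (fun ω (i : Fin (j + 1)) => V i ω) P)
    (hlaw : ∀ j ≤ N, 1 / 2 ≤ (P.map fun ω => V N ω - V j ω).real (Set.Iic 0)) :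
    P.real {ω | ∃ i ≤ N, V i ω < -y} ≤ 2 * P.real {ω | V N ω < -y} := by
  have hm := measurableSet_firstBelow hV y
  rw [← biUnion_firstBelow, measureReal_biUnion_finset (pairwiseDisjoint_firstBelow V y _)
    fun j _ => hm j]
  have hm2 : ∀ j, MeasurableSet {ω | V N ω - V j ω ∈ Set.Iic 0} := fun j =>
    ((hV N).sub (hV j)) measurableSet_Iic
  have h1 : ∀ j ∈ Finset.range (N + 1), P.real (firstBelow V y j) ≤
      2 * P.real (firstBelow V y j ∩ {ω | V N ω - V j ω ∈ Set.Iic 0}) := fun j hj => by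
    have hj' : j ≤ N := Nat.lt_succ_iff.1 (Finset.mem_range.1 hj)
    rw [measureReal_firstBelow_inter hV y (hind j hj') measurableSet_Iic]
    nlinarith [hlaw j hj', measureReal_nonneg (μ := P) (s := firstBelow V y j)]
  refine (Finset.sum_le_sum h1).trans ?_
  rw [← Finset.mul_sum, ← measureReal_biUnion_finset]
  · gcongr
    · finiteness
    · intro ω hω
      simp only [Set.mem_iUnion, Set.mem_inter_iff, firstBelow, Set.mem_ofPred_eq, Set.mem_Iic,
        exists_prop] at hω
      obtain ⟨j, -, ⟨-, h2⟩, h3⟩ := hω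
      simp only [Set.mem_ofPred_eq]
      linarith
  · exact fun i hi j hj hij => (pairwiseDisjoint_firstBelow V y _ hi hj hij).mono
      Set.inter_subset_left Set.inter_subset_left
  · exact fun j _ => (hm j).inter (hm2 j)

/-- The reflection principle, lower bound for the probability to go below `-y`; the overshoot
below `-y` at the first passage time is at most one step of the walk. -/
theorem le_measureReal_exists_lt (hV : ∀ i, Measurable (V i)) (hV0 : ∀ ω, V 0 ω = 0) {y : ℝ}
    (hy : 0 ≤ y) (L : ℝ)
    (hind : ∀ j ≤ N, IndepFun (fun ω => V N ω - V j ω) (fun ω (i : Fin (j + 1)) => V i ω) P)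
    (hlaw : ∀ j ≤ N, (P.map fun ω => V N ω - V j ω).real (Set.Iio 0) ≤ 1 / 2)
    (hL : 0 ≤ L) :
    2 * P.real {ω | V N ω < -(y + L)} ≤ P.real {ω | ∃ i ≤ N, V i ω < -y} +
      2 * ∑ j ∈ Finset.range N, P.real {ω | V (j + 1) ω - V j ω < -L} := by
  have hm := measurableSet_firstBelow hV y
  have hm2 : ∀ j, MeasurableSet {ω | V N ω - V j ω ∈ Set.Iio 0} := fun j =>
    ((hV N).sub (hV j)) measurableSet_Iio
  have hsub : {ω | V N ω < -(y + L)} ⊆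
      (⋃ j ∈ Finset.range (N + 1), (firstBelow V y j ∩ {ω | V N ω - V j ω ∈ Set.Iio 0})) ∪
        ⋃ j ∈ Finset.range N, {ω | V (j + 1) ω - V j ω < -L} := by
    intro ω hω
    simp only [Set.mem_ofPred_eq] at hω
    have : ω ∈ ⋃ j ∈ Finset.range (N + 1), firstBelow V y j := by
      rw [biUnion_firstBelow]
      exact ⟨N, le_rfl, by linarith⟩
    simp only [Set.mem_iUnion, exists_prop] at this
    obtain ⟨j, hj, hj'⟩ := this
    by_cases h : V N ω - V j ω < 0
    · left
      simp only [Set.mem_iUnion, exists_prop]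
      exact ⟨j, hj, hj', h⟩
    · right
      simp only [Set.mem_iUnion, exists_prop, Set.mem_ofPred_eq]
      obtain ⟨h1, h2⟩ := hj'
      rcases j with _ | j
      · rw [hV0] at h2; linarith
      · refine ⟨j, by simpa using hj, ?_⟩
        have := h1 j (Nat.lt_succ_self j)
        linarith
  have h1 : P.real (⋃ j ∈ Finset.range (N + 1),
      (firstBelow V y j ∩ {ω | V N ω - V j ω ∈ Set.Iio 0})) ≤
      1 / 2 * P.real {ω | ∃ i ≤ N, V i ω < -y} := by
    rw [← biUnion_firstBelow, measureReal_biUnion_finset (pairwiseDisjoint_firstBelow V y _)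
      fun j _ => hm j, Finset.mul_sum]
    refine (measureReal_biUnion_finset_le _ _).trans (Finset.sum_le_sum fun j hj => ?_)
    have hj' : j ≤ N := Nat.lt_succ_iff.1 (Finset.mem_range.1 hj)
    rw [measureReal_firstBelow_inter hV y (hind j hj') measurableSet_Iio]
    nlinarith [hlaw j hj', measureReal_nonneg (μ := P) (s := firstBelow V y j)]
  have h2 := (measureReal_mono hsub (by finiteness)).trans (measureReal_union_le (μ := P) _ _)
  have h3 := measureReal_biUnion_finset_le (μ := P) (Finset.range N)
    fun j => {ω | V (j + 1) ω - V j ω < -L}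
  linarith

end Reflection

/-! ### Brownian motion at integer times -/

section Brownian

variable {Ω' : Type*} [MeasurableSpace Ω'] {P : Measure Ω'} [IsProbabilityMeasure P]

/-- The values of a pre-Brownian motion at the integers, up to a null set: a Gaussian random walk
of measurable functions which starts exactly at `0`. -/
theorem exists_gaussian_walk {W : ℝ≥0 → Ω' → ℝ} (hW : IsPreBrownianReal W P) :
    ∃ V : ℕ → Ω' → ℝ, (∀ i, Measurable (V i)) ∧ (∀ ω, V 0 ω = 0) ∧
      (∀ᵐ ω ∂P, ∀ i : ℕ, W i ω = V i ω) ∧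
      (∀ N j : ℕ, j ≤ N →
        IndepFun (fun ω => V N ω - V j ω) (fun ω (i : Fin (j + 1)) => V i ω) P) ∧
      ∀ N j : ℕ, j ≤ N → P.map (fun ω => V N ω - V j ω) = gaussianReal 0 ((N - j : ℕ) : ℝ≥0) := by
  let V : ℕ → Ω' → ℝ := fun i => if i = 0 then 0 else (hW.aemeasurable i).mk
  have hae : ∀ᵐ ω ∂P, ∀ i : ℕ, W i ω = V i ω := by
    rw [ae_all_iff]
    intro i
    by_cases hi : i = 0
    · subst hi
      simpa [V] using hW.eval_zero_ae_eq_zero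
    · simp only [V, hi, if_false]
      exact (hW.aemeasurable i).ae_eq_mk
  have hVm : ∀ i, Measurable (V i) := fun i => by
    by_cases hi : i = 0
    · simp only [V, hi, if_true]; exact measurable_const
    · simp only [V, hi, if_false]; exact (hW.aemeasurable i).measurable_mk
  refine ⟨V, hVm, fun ω => by simp [V], hae, fun N j hj => ?_, fun N j hj => ?_⟩
  · have h := hW.indepFun_shift (j : ℝ≥0)
    have hφ : Measurable fun u : ℝ≥0 → ℝ => u ((N - j : ℕ) : ℝ≥0) := measurable_pi_apply _
    have hψ : Measurable fun (u : Set.Iic (j : ℝ≥0) → ℝ) (i : Fin (j + 1)) => u ⟨(i : ℕ), by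
        simp only [Set.mem_Iic, Nat.cast_le]; omega⟩ :=
      measurable_pi_lambda _ fun i => measurable_pi_apply _
    have h2 := h.comp hφ hψ
    refine h2.congr ?_ ?_
    · filter_upwards [hae] with ω hω
      simp only [Function.comp]
      rw [← Nat.cast_add, Nat.add_sub_cancel' hj, hω, hω]
    · filter_upwards [hae] with ω hω
      funext i
      exact hω i
  · have h := (hW.hasLaw_sub N j).map_eq
    have h2 : P.map (fun ω => V N ω - V j ω) = P.map (W N - W j) := by
      refine Measure.map_congr ?_
      filter_upwards [hae] with ω hω
      simp [hω]
    rw [h2, h]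
    congr 1
    rw [← NNReal.coe_inj, coe_nndist, Real.dist_eq]
    simp only [NNReal.val_eq_coe, NNReal.coe_natCast]
    rw [Nat.cast_sub hj, abs_of_nonneg (by simpa using hj)]

/-- The probability that a Gaussian random walk stays above `-y` up to time `N` is about
`2 y / √(2 π N)`. -/
theorem gaussian_walk_survival {V : ℕ → Ω' → ℝ} (hV : ∀ i, Measurable (V i))
    (hV0 : ∀ ω, V 0 ω = 0)
    (hind : ∀ N j : ℕ, j ≤ N →
        IndepFun (fun ω => V N ω - V j ω) (fun ω (i : Fin (j + 1)) => V i ω) P)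
    (hlaw : ∀ N j : ℕ, j ≤ N →
      P.map (fun ω => V N ω - V j ω) = gaussianReal 0 ((N - j : ℕ) : ℝ≥0))
    {N : ℕ} (hN : 0 < N) {y : ℝ} (hy : 0 ≤ y) :
    y - y ^ 2 / √N ≤ √(2 * Real.pi * N) / 2 * P.real {ω | ∀ i ≤ N, -y ≤ V i ω} ∧
    ∀ L : ℝ, 0 < L → √(2 * Real.pi * N) / 2 * P.real {ω | ∀ i ≤ N, -y ≤ V i ω} ≤
      y + L + √(2 * Real.pi * N) / 2 * (N * (24 / L ^ 3)) := by
  have hVN : ∀ u : ℝ, P.real {ω | V N ω < -u} = (gaussianReal 0 N).real (Set.Iio (-u)) := by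
    intro u
    have := hlaw N 0 (Nat.zero_le _)
    rw [Nat.sub_zero] at this
    rw [← this, map_measureReal_apply (by fun_prop) measurableSet_Iio]
    congr 1
    ext ω
    simp [hV0]
  have hmE : MeasurableSet {ω | ∃ i ≤ N, V i ω < -y} := by
    rw [← biUnion_firstBelow]
    exact Finset.measurableSet_biUnion _ fun j _ => measurableSet_firstBelow hV y j
  have hc : {ω | ∀ i ≤ N, -y ≤ V i ω} = {ω | ∃ i ≤ N, V i ω < -y}ᶜ := by
    ext ω; simp
  have hcompl := probReal_add_probReal_compl (μ := P) hmE
  rw [← hc] at hcompl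
  have hκ : 0 ≤ √(2 * Real.pi * N) / 2 := by positivity
  constructor
  · have h1 := measureReal_exists_lt_le hV y (fun j hj => hind N j hj)
      (fun j hj => by rw [hlaw N j hj]; exact half_le_gaussianReal_real_Iic_zero _)
    rw [hVN] at h1
    have h2 := one_sub_two_mul_gaussianReal_Iio N hy
    refine (le_gaussianReal_real_Icc hN hy).trans ?_
    gcongr
    linarith
  · intro L hL
    have h1 := le_measureReal_exists_lt hV hV0 hy L (fun j hj => hind N j hj)
      (fun j hj => by rw [hlaw N j hj]; exact gaussianReal_real_Iio_zero_le _) hL.le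
    rw [hVN] at h1
    have h2 := one_sub_two_mul_gaussianReal_Iio N (add_nonneg hy hL.le)
    have h3 := gaussianReal_real_Icc_le hN (add_nonneg hy hL.le)
    have h4 : ∑ j ∈ Finset.range N, P.real {ω | V (j + 1) ω - V j ω < -L} ≤ N * (12 / L ^ 3) := by
      refine (Finset.sum_le_card_nsmul _ _ (12 / L ^ 3) fun j _ => ?_).trans (by simp)
      have h5 := hlaw (j + 1) j (Nat.le_succ j)
      rw [Nat.add_sub_cancel_left, Nat.cast_one] at h5
      refine le_trans ?_ (gaussianReal_one_real_Iic_le hL)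
      rw [← h5, map_measureReal_apply (by fun_prop) measurableSet_Iic]
      exact measureReal_mono (fun ω hω => by
        simp only [Set.mem_ofPred_eq] at hω
        exact hω.le) (by finiteness)
    have h6 : P.real {ω | ∀ i ≤ N, -y ≤ V i ω} ≤
        (gaussianReal 0 N).real (Set.Icc (-(y + L)) (y + L)) + N * (24 / L ^ 3) := by
      have : (N : ℝ) * (24 / L ^ 3) = 2 * (N * (12 / L ^ 3)) := by ring
      linarith
    calc _ ≤ √(2 * Real.pi * N) / 2 * ((gaussianReal 0 N).real (Set.Icc (-(y + L)) (y + L)) +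
          N * (24 / L ^ 3)) := by gcongr
      _ ≤ _ := by rw [mul_add]; gcongr

end Brownian

/-! ### Survival of the unperturbed walk -/

section Coupling

variable {G X Ω' : Type*} [Group G] [MulAction G X] [MeasurableSpace G] [MeasurableSpace X]
  [MeasurableMul₂ G] [MeasurableSMul₂ G X] [MeasurableSpace Ω']

/-- The probability that the walk with starting value `y` is nonnegative up to time `N`, the
starting time included. -/
noncomputable def stayProb (μ : Measure G) (σ : G → X → ℝ) (N : ℕ) (x : X) (y : ℝ) : ℝ :=
  (pathLaw μ).real {ω | ∀ i ≤ N, 0 ≤ y + walk σ x i ω}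

omit [MulAction G X] [MeasurableSpace X] [MeasurableMul₂ G] [MeasurableSMul₂ G X] in
/-- At integer times, the walk and the Wiener process of a strong approximation are within
`N ^ (3 / 8)` of each other up to time `N`, outside an event of probability
`O(N ^ (-1 / 8))`. -/
theorem IsStrongApproximation.exists_bad {μ : Measure G} {σ : G → X → ℝ} {v : ℝ} {P' : Measure Ω'}
    {π : Ω' → ℕ → G} {W : ℝ≥0 → Ω' → ℝ} (hW : IsStrongApproximation μ σ v P' π W) :
    ∃ c : ℝ, 0 < c ∧ ∀ (x : X) (N : ℕ), 1 ≤ N →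
      P' {ω' | ¬ ∀ i ≤ N, |walk σ x i (π ω') - v * W i ω'| ≤ (N : ℝ) ^ (3 / 8 : ℝ)} ≤
        ENNReal.ofReal (c * (N : ℝ) ^ (-(1 / 8) : ℝ)) := by
  obtain ⟨c, hc, h⟩ := hW.bound (1 / 8) (by norm_num) (by norm_num)
  refine ⟨c, hc, fun x N hN => (measure_mono fun ω' hω' => ?_).trans (h x N hN)⟩
  simp only [Set.mem_ofPred_eq, not_forall, not_le, exists_prop] at hω' ⊢
  obtain ⟨i, hi, hlt⟩ := hω'
  have hN0 : (N : ℝ≥0) ≠ 0 := by exact_mod_cast (by omega : N ≠ 0)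
  have ht : (N : ℝ≥0) * (i / N) = i := mul_div_cancel₀ _ hN0
  have hmem : (i / N : ℝ≥0) ∈ Set.Icc (0 : ℝ≥0) 1 :=
    ⟨zero_le, by
      rw [div_le_one (by positivity)]
      exact_mod_cast hi⟩
  refine lt_of_lt_of_le ?_ (le_iSup₂ (f := fun (t : ℝ≥0) (_ : t ∈ Set.Icc (0 : ℝ≥0) 1) =>
    ENNReal.ofReal |walk σ x ⌊(N : ℝ≥0) * t⌋₊ (π ω') - v * W ((N : ℝ≥0) * t) ω'|) _ hmem)
  rw [ht, Nat.floor_natCast, ENNReal.ofReal_lt_ofReal_iff_of_nonneg (by positivity)]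
  norm_num at hlt ⊢
  exact hlt

/-- The probability that the walk stays nonnegative up to time `N` is about
`2 y / (v √(2 π N))`, uniformly in the starting point. -/
theorem exists_stayProb_bounds {μ : Measure G} [IsProbabilityMeasure μ] {σ : G → X → ℝ}
    (hσm : Measurable (Function.uncurry σ)) {v : ℝ} (hv : 0 < v) {P' : Measure Ω'}
    {π : Ω' → ℕ → G} {W : ℝ≥0 → Ω' → ℝ} (hW : IsStrongApproximation μ σ v P' π W) :
    ∃ C : ℝ, 0 < C ∧ ∀ (x : X) (y : ℝ) (N : ℕ), 1 ≤ N →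
      v * √(2 * Real.pi * N) / 2 * stayProb μ σ N x y ≤ max y 0 + C * (N : ℝ) ^ (3 / 8 : ℝ) ∧
      y - C * (N : ℝ) ^ (3 / 8 : ℝ) - C * y ^ 2 / √N ≤
        v * √(2 * Real.pi * N) / 2 * stayProb μ σ N x y := by
  have hpre := hW.isBrownian.toIsPreBrownianReal
  have : IsProbabilityMeasure P' := hpre.isGaussianProcess.isProbabilityMeasure
  obtain ⟨c, hc, hbad⟩ := hW.exists_bad
  obtain ⟨V, hV, hV0, hae, hind, hlaw⟩ := exists_gaussian_walk hpre
  have hsqrt : √(2 * Real.pi) ≤ 3 := by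
    rw [Real.sqrt_le_left (by norm_num)]
    have := Real.pi_lt_d2
    linarith
  refine ⟨1 + v + v * (24 + c) * 3 / 2 + v⁻¹, by positivity, fun x y N hN => ?_⟩
  have hN0 : (0 : ℝ) < N := by exact_mod_cast hN
  set D : ℝ := (N : ℝ) ^ (3 / 8 : ℝ) with hD
  have hD0 : 0 < D := by positivity
  set κ : ℝ := √(2 * Real.pi * N) / 2 with hκ
  have hκ0 : 0 ≤ κ := by positivity
  -- the error probabilities of order `N ^ (-1 / 8)` become `N ^ (3 / 8)` after scaling by `κ`
  have hκD : κ * (N : ℝ) ^ (-(1 / 8) : ℝ) ≤ 3 / 2 * D := by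
    have h1 : κ = √(2 * Real.pi) / 2 * (N : ℝ) ^ (1 / 2 : ℝ) := by
      rw [hκ, Real.sqrt_mul (by positivity), Real.sqrt_eq_rpow (N : ℝ)]; ring
    have h2 : (N : ℝ) ^ (1 / 2 : ℝ) * (N : ℝ) ^ (-(1 / 8) : ℝ) = D := by
      rw [← Real.rpow_add hN0, hD]; norm_num
    rw [h1, mul_assoc, h2]
    gcongr
  have hND : (N : ℝ) * (24 / D ^ 3) = 24 * (N : ℝ) ^ (-(1 / 8) : ℝ) := by
    have h1 : D ^ 3 = (N : ℝ) ^ (9 / 8 : ℝ) := by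
      rw [hD, ← Real.rpow_natCast, ← Real.rpow_mul hN0.le]; norm_num
    have h2 : (N : ℝ) ^ (-(1 / 8) : ℝ) * (N : ℝ) ^ (9 / 8 : ℝ) = N := by
      rw [← Real.rpow_add hN0]; norm_num
    rw [h1, eq_comm, ← mul_div_assoc, eq_div_iff (by positivity), mul_assoc, h2, mul_comm]
  have hh : stayProb μ σ N x y = P'.real {ω' | ∀ i ≤ N, 0 ≤ y + walk σ x i (π ω')} := by
    have hm : MeasurableSet {ω : ℕ → G | ∀ i ≤ N, 0 ≤ y + walk σ x i ω} := by
      have : {ω : ℕ → G | ∀ i ≤ N, 0 ≤ y + walk σ x i ω} =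
          ⋂ i ∈ Finset.range (N + 1), {ω | 0 ≤ y + walk σ x i ω} := by
        ext ω; simp
      rw [this]
      exact Finset.measurableSet_biInter _ fun i _ => measurableSet_le measurable_const
        (measurable_const.add ((measurable_walk hσm i).comp
          (measurable_id.prodMk measurable_const)))
    rw [stayProb, ← hW.measurePreserving.measureReal_preimage hm.nullMeasurableSet]
    rfl
  set Bad : Set Ω' := {ω' | ¬ ∀ i ≤ N, |walk σ x i (π ω') - v * W i ω'| ≤ D} with hBad
  have hBadP : P'.real Bad ≤ c * (N : ℝ) ^ (-(1 / 8) : ℝ) :=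
    ENNReal.toReal_le_of_le_ofReal (by positivity) (hbad x N hN)
  set Nul : Set Ω' := {ω' | ¬ ∀ i : ℕ, W i ω' = V i ω'} with hNul
  have hNulP : P'.real Nul = 0 := by
    rw [measureReal_def, show P' Nul = 0 from hae, ENNReal.toReal_zero]
  have hC1 : (1 + v + v * (24 + c) * 3 / 2) * D ≤
      (1 + v + v * (24 + c) * 3 / 2 + v⁻¹) * D :=
    mul_le_mul_of_nonneg_right (le_add_of_nonneg_right (inv_pos.2 hv).le) hD0.le
  rw [hh, mul_div_assoc, ← hκ]
  constructor
  · have hy1 : 0 ≤ (max y 0 + D) / v := by positivity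
    have h1 := (gaussian_walk_survival hV hV0 hind hlaw hN hy1).2 D hD0
    rw [← hκ, hND] at h1
    have hsub : {ω' | ∀ i ≤ N, 0 ≤ y + walk σ x i (π ω')} ⊆
        {ω' | ∀ i ≤ N, -((max y 0 + D) / v) ≤ V i ω'} ∪ (Bad ∪ Nul) := by
      intro ω' hω'
      by_cases hb : ω' ∈ Bad
      · exact Or.inr (Or.inl hb)
      by_cases hn : ω' ∈ Nul
      · exact Or.inr (Or.inr hn)
      left
      simp only [hBad, hNul, Set.mem_ofPred_eq, not_not] at hb hn hω' ⊢
      intro i hi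
      have h2 := (abs_le.1 (hb i hi)).1
      have h3 := hω' i hi
      rw [← hn i, neg_le, ← sub_nonneg]
      have h4 : (max y 0 + D) / v - -W i ω' = (max y 0 + D + v * W i ω') / v := by
        field_simp
        ring
      rw [h4]
      have h5 := le_max_left y 0
      exact div_nonneg (by
        have h6 := (abs_le.1 (hb i hi)).2
        linarith) hv.le
    have h2 : P'.real {ω' | ∀ i ≤ N, 0 ≤ y + walk σ x i (π ω')} ≤
        P'.real {ω' | ∀ i ≤ N, -((max y 0 + D) / v) ≤ V i ω'} + c * (N : ℝ) ^ (-(1 / 8) : ℝ) := by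
      have h3 := (measureReal_mono hsub (by finiteness)).trans (measureReal_union_le (μ := P') _ _)
      have h4 := measureReal_union_le (μ := P') Bad Nul
      linarith
    calc v * κ * P'.real {ω' | ∀ i ≤ N, 0 ≤ y + walk σ x i (π ω')}
        ≤ v * κ * (P'.real {ω' | ∀ i ≤ N, -((max y 0 + D) / v) ≤ V i ω'} +
            c * (N : ℝ) ^ (-(1 / 8) : ℝ)) := by gcongr
      _ = v * (κ * P'.real {ω' | ∀ i ≤ N, -((max y 0 + D) / v) ≤ V i ω'}) +
            v * c * (κ * (N : ℝ) ^ (-(1 / 8) : ℝ)) := by ring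
      _ ≤ v * ((max y 0 + D) / v + D + κ * (24 * (N : ℝ) ^ (-(1 / 8) : ℝ))) +
            v * c * (κ * (N : ℝ) ^ (-(1 / 8) : ℝ)) := by gcongr
      _ = max y 0 + D + v * D + v * (24 + c) * (κ * (N : ℝ) ^ (-(1 / 8) : ℝ)) := by
          field_simp; ring
      _ ≤ max y 0 + D + v * D + v * (24 + c) * (3 / 2 * D) := by gcongr
      _ = max y 0 + (1 + v + v * (24 + c) * 3 / 2) * D := by ring
      _ ≤ _ := by linarith
  · rcases le_or_gt D y with hyD | hyD
    · have hy1 : 0 ≤ (y - D) / v := div_nonneg (by linarith) hv.le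
      have h1 := (gaussian_walk_survival hV hV0 hind hlaw hN hy1).1
      rw [← hκ] at h1
      have hsub : {ω' | ∀ i ≤ N, -((y - D) / v) ≤ V i ω'} ⊆
          {ω' | ∀ i ≤ N, 0 ≤ y + walk σ x i (π ω')} ∪ (Bad ∪ Nul) := by
        intro ω' hω'
        by_cases hb : ω' ∈ Bad
        · exact Or.inr (Or.inl hb)
        by_cases hn : ω' ∈ Nul
        · exact Or.inr (Or.inr hn)
        left
        simp only [hBad, hNul, Set.mem_ofPred_eq, not_not] at hb hn hω' ⊢
        intro i hi
        have h2 := (abs_le.1 (hb i hi)).1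
        have h3 := hω' i hi
        rw [← hn i, neg_le, le_div_iff₀ hv] at h3
        linarith
      have h2 : P'.real {ω' | ∀ i ≤ N, -((y - D) / v) ≤ V i ω'} ≤
          P'.real {ω' | ∀ i ≤ N, 0 ≤ y + walk σ x i (π ω')} + c * (N : ℝ) ^ (-(1 / 8) : ℝ) := by
        have h3 := (measureReal_mono hsub (by finiteness)).trans
          (measureReal_union_le (μ := P') _ _)
        have h4 := measureReal_union_le (μ := P') Bad Nul
        linarith
      have h5 : v * ((y - D) / v - ((y - D) / v) ^ 2 / √N) ≤
          v * κ * P'.real {ω' | ∀ i ≤ N, 0 ≤ y + walk σ x i (π ω')} + v * c * (3 / 2 * D) :=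
        calc _ ≤ v * (κ * P'.real {ω' | ∀ i ≤ N, -((y - D) / v) ≤ V i ω'}) := by gcongr
          _ ≤ v * (κ * (P'.real {ω' | ∀ i ≤ N, 0 ≤ y + walk σ x i (π ω')} +
                c * (N : ℝ) ^ (-(1 / 8) : ℝ))) := by gcongr
          _ = v * κ * P'.real {ω' | ∀ i ≤ N, 0 ≤ y + walk σ x i (π ω')} +
                v * c * (κ * (N : ℝ) ^ (-(1 / 8) : ℝ)) := by ring
          _ ≤ _ := by gcongr
      have h6 : v * ((y - D) / v - ((y - D) / v) ^ 2 / √N) =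
          y - D - v⁻¹ * (y - D) ^ 2 / √N := by field_simp
      have h7 : v⁻¹ * (y - D) ^ 2 / √N ≤
          (1 + v + v * (24 + c) * 3 / 2 + v⁻¹) * y ^ 2 / √N := by
        gcongr ?_ * ?_ ^ 2 / _
        · have : 0 < 1 + v + v * (24 + c) * 3 / 2 := by positivity
          linarith
        · linarith
      have h8 : D + v * c * (3 / 2 * D) ≤ (1 + v + v * (24 + c) * 3 / 2) * D := by
        have : 0 ≤ (v + v * 24 * 3 / 2) * D := by positivity
        linarith
      linarith
    · have h1 : D ≤ (1 + v + v * (24 + c) * 3 / 2) * D := by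
        have : 0 ≤ (v + v * (24 + c) * 3 / 2) * D := by positivity
        linarith
      have h2 : 0 ≤ (1 + v + v * (24 + c) * 3 / 2 + v⁻¹) * y ^ 2 / √N := by positivity
      have h3 : 0 ≤ v * κ * P'.real {ω' | ∀ i ≤ N, 0 ≤ y + walk σ x i (π ω')} := by positivity
      linarith

end Coupling

/-! ### A recursion for survival probabilities -/

section Recursion

/-- The eighth root of `n`, the unit in which error terms are measured. -/
noncomputable def root8 (n : ℕ) : ℝ := (n : ℝ) ^ (1 / 8 : ℝ)

/-- The number `⌈n ^ (1 / 16)⌉` of steps which the perturbations are allowed to look ahead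
when the walk is studied up to time `n`. -/
noncomputable def window (n : ℕ) : ℕ := ⌈√(root8 n)⌉₊

theorem root8_nonneg (n : ℕ) : 0 ≤ root8 n := Real.rpow_nonneg (Nat.cast_nonneg n) _

theorem root8_pow (n : ℕ) : root8 n ^ 8 = n := by
  rw [root8, ← Real.rpow_natCast, ← Real.rpow_mul (Nat.cast_nonneg n)]
  norm_num

theorem root8_mono : Monotone root8 := fun _ _ h =>
  Real.rpow_le_rpow (Nat.cast_nonneg _) (by exact_mod_cast h) (by norm_num)

theorem one_le_root8 {n : ℕ} (hn : 1 ≤ n) : 1 ≤ root8 n :=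
  Real.one_le_rpow (by exact_mod_cast hn) (by norm_num)

theorem sqrt_eq_root8_pow (n : ℕ) : √(n : ℝ) = root8 n ^ 4 := by
  rw [Real.sqrt_eq_iff_mul_self_eq (Nat.cast_nonneg n) (pow_nonneg (root8_nonneg n) 4),
    ← root8_pow n]
  ring

theorem root8_le_mul {m n : ℕ} {c : ℝ} (hc : 0 ≤ c) (h : (n : ℝ) ≤ c ^ 8 * m) :
    root8 n ≤ c * root8 m := by
  refine le_of_pow_le_pow_left₀ (n := 8) (by norm_num) (mul_nonneg hc (root8_nonneg m)) ?_
  rw [mul_pow, root8_pow, root8_pow]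
  exact h

theorem tendsto_root8 : Tendsto root8 atTop atTop :=
  (tendsto_rpow_atTop (by norm_num)).comp tendsto_natCast_atTop_atTop

theorem window_sq_le {n : ℕ} (hn : 1 ≤ n) : (window n : ℝ) ^ 2 ≤ 4 * root8 n := by
  have h0 := one_le_root8 hn
  have h1 : (window n : ℝ) ≤ 2 * √(root8 n) := by
    have h2 : (window n : ℝ) < √(root8 n) + 1 := Nat.ceil_lt_add_one (Real.sqrt_nonneg _)
    have h3 : 1 ≤ √(root8 n) := Real.one_le_sqrt.2 h0
    linarith
  calc (window n : ℝ) ^ 2 ≤ (2 * √(root8 n)) ^ 2 := by gcongr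
    _ = 4 * root8 n := by
      rw [mul_pow, Real.sq_sqrt (by linarith)]
      norm_num

theorem one_le_window {n : ℕ} (hn : 1 ≤ n) : 1 ≤ window n :=
  Nat.one_le_ceil_iff.2 (Real.sqrt_pos.2 (by linarith [one_le_root8 hn]))

theorem window_le {n : ℕ} (hn : 1 ≤ n) : (window n : ℝ) ≤ 4 * root8 n := by
  have h1 := window_sq_le hn
  have h2 : (1 : ℝ) ≤ window n := by exact_mod_cast one_le_window hn
  nlinarith

theorem le_window_pow (n : ℕ) : (n : ℝ) ≤ (window n : ℝ) ^ 16 := by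
  have h : √(root8 n) ≤ window n := Nat.le_ceil _
  calc (n : ℝ) = (√(root8 n) ^ 2) ^ 8 := by rw [Real.sq_sqrt (root8_nonneg n), root8_pow]
    _ = √(root8 n) ^ 16 := by ring
    _ ≤ _ := by gcongr

/-- Bounds which tie the survival masses `q n` to the mean heights `a n` of the surviving walk:
the height changes little in comparison with the mass, and the mass at time `n` is, up to the
factor `κ √N`, the height at an earlier time. -/
structure RecursionBounds (C κ : ℝ) (q a : ℕ → ℝ) : Prop where
  q_nonneg : ∀ n, 0 ≤ q n
  q_anti : Antitone q
  q_zero_le : q 0 ≤ C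
  a_one_le : a 1 ≤ C
  diff : ∀ m n, 1 ≤ m → m ≤ n → |a n - a m| ≤ C * root8 n * q m + C / n
  upper : ∀ m n N, 1 ≤ m → 1 ≤ N → N + m + window n = n →
    κ * √N * q n ≤ a m + C * root8 n ^ 3 * q m + C / n
  lower : ∀ m n N, 1 ≤ m → 1 ≤ N → N + m + window n = n →
    a m - C * root8 n ^ 3 * q m - C * (root8 n + ∑ k ∈ Finset.range m, q k) / √N - C / n ≤
      κ * √N * q n

/-- For `m ≤ n / 4`, the time left after `m` and the window is comparable to `n`. -/
theorem exists_split {m n : ℕ} (hn : 256 ≤ n) (hm : 4 * m ≤ n) :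
    ∃ N, 1 ≤ N ∧ N + m + window n = n ∧ root8 n ^ 4 / 2 ≤ √N ∧
      (n : ℝ) - N ≤ m + 4 * root8 n := by
  have hr1 : root8 256 = 2 := by
    have h1 := root8_pow 256
    have h2 : root8 256 ^ 8 = 2 ^ 8 := by rw [h1]; norm_num
    exact (pow_left_inj₀ (root8_nonneg _) (by norm_num) (by norm_num)).1 h2
  have hr : 2 ≤ root8 n := hr1 ▸ root8_mono hn
  have hw := window_le (n := n) (by omega)
  have hn8 := root8_pow n
  have h7 : (2 : ℝ) ^ 7 ≤ root8 n ^ 7 := by gcongr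
  have hw2 : (4 * window n : ℝ) ≤ n := by
    rw [← hn8]
    calc (4 * window n : ℝ) ≤ 2 ^ 7 * root8 n := by linarith
      _ ≤ root8 n ^ 7 * root8 n := by gcongr
      _ = _ := by ring
  have hw3 : 4 * window n ≤ n := by exact_mod_cast hw2
  have hN : n - m - window n + m + window n = n := by omega
  refine ⟨n - m - window n, by omega, hN, ?_, ?_⟩
  · rw [← sqrt_eq_root8_pow]
    refine Real.le_sqrt_of_sq_le ?_
    rw [div_pow, Real.sq_sqrt (Nat.cast_nonneg n)]
    have : (n : ℝ) ≤ 4 * (n - m - window n : ℕ) := by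
      have : n ≤ 4 * (n - m - window n) := by omega
      exact_mod_cast this
    linarith
  · have h1 : ((n - m - window n : ℕ) : ℝ) + m + window n = n := by exact_mod_cast hN
    linarith

namespace RecursionBounds

variable {C κ : ℝ} {q a : ℕ → ℝ}

theorem C_nonneg (h : RecursionBounds C κ q a) : 0 ≤ C := (h.q_nonneg 0).trans h.q_zero_le

theorem q_le (h : RecursionBounds C κ q a) (n : ℕ) : q n ≤ C :=
  (h.q_anti (Nat.zero_le n)).trans h.q_zero_le

theorem a_le_root8 (h : RecursionBounds C κ q a) {n : ℕ} (hn : 1 ≤ n) :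
    a n ≤ (2 * C + C ^ 2) * root8 n := by
  have h1 := (abs_le.1 (h.diff 1 n le_rfl hn)).2
  have hC := h.C_nonneg
  have hr := one_le_root8 hn
  have h2 : C / n ≤ C := div_le_self hC (by exact_mod_cast hn)
  have h3 : C * root8 n * q 1 ≤ C * root8 n * C := by
    gcongr
    exact h.q_le 1
  nlinarith [h.a_one_le]

/-- The recursion step with `m = n / 4`. -/
theorem q_step (h : RecursionBounds C κ q a) (hκ : 0 < κ) {n : ℕ} (hn : 256 ≤ n) :
    q n ≤ 2 / κ * (a (n / 4) + C * root8 n ^ 3 * q (n / 4) + C) / root8 n ^ 4 := by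
  obtain ⟨N, hN1, hN2, hN3, -⟩ := exists_split (m := n / 4) hn (by omega)
  have h1 := h.upper (n / 4) n N (by omega) hN1 hN2
  have hr := one_le_root8 (n := n) (by omega)
  have h2 : C / n ≤ C := div_le_self h.C_nonneg (by exact_mod_cast (by omega : 1 ≤ n))
  have h3 : κ * (root8 n ^ 4 / 2) * q n ≤ κ * √N * q n := by
    have := h.q_nonneg n
    gcongr
  rw [le_div_iff₀ (by positivity), div_mul_eq_mul_div, le_div_iff₀ hκ]
  linarith

theorem root8_le_two_mul_div_four {n : ℕ} (hn : 4 ≤ n) : root8 n ≤ 2 * root8 (n / 4) := by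
  refine root8_le_mul (by norm_num) ?_
  have : n ≤ 2 ^ 8 * (n / 4) := by omega
  exact_mod_cast this

/-- A first bound `q n = O(n ^ (-3 / 8))`, by strong induction: for large `n` the recursion step
contracts the constant. -/
theorem exists_q_le_cube (C κ : ℝ) (hκ : 0 < κ) (hC : 0 ≤ C) :
    ∃ A : ℝ, 0 ≤ A ∧ ∀ q a, RecursionBounds C κ q a → ∀ n, 1 ≤ n → q n ≤ A / root8 n ^ 3 := by
  obtain ⟨n₀, hn₀⟩ := (tendsto_root8.eventually_ge_atTop (32 * C / κ)).exists
  set n₁ := max n₀ 256 with hn₁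
  set C₁ := 2 * C + C ^ 2 with hC₁
  have hC1 : 0 ≤ C₁ := by positivity
  set A := 4 / κ * (C₁ + C) + C * root8 n₁ ^ 3 with hA
  have hr1 := root8_nonneg n₁
  have hA0 : 0 ≤ A := by positivity
  refine ⟨A, hA0, fun q a h n => ?_⟩
  induction n using Nat.strong_induction_on with
  | _ n ih =>
    intro hn
    have hr := one_le_root8 hn
    rcases lt_or_ge n n₁ with hlt | hge
    · rw [le_div_iff₀ (by positivity)]
      have h1 : root8 n ^ 3 ≤ root8 n₁ ^ 3 := by
        gcongr
        exact root8_mono hlt.le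
      calc q n * root8 n ^ 3 ≤ C * root8 n₁ ^ 3 := by
            have := h.q_nonneg n
            gcongr
            exact h.q_le n
        _ ≤ A := by
            rw [hA]
            have : 0 ≤ 4 / κ * (C₁ + C) := by positivity
            linarith
    · have hn256 : 256 ≤ n := (le_max_right _ _).trans hge
      have hrn : 32 * C / κ ≤ root8 n := hn₀.trans (root8_mono ((le_max_left _ _).trans hge))
      have hm1 : 1 ≤ n / 4 := by omega
      have hih := ih (n / 4) (by omega) hm1
      have h2 := root8_le_two_mul_div_four (n := n) (by omega)
      have hrm := one_le_root8 hm1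
      have h3 : root8 n ^ 3 * q (n / 4) ≤ 8 * A := by
        have h4 : root8 n ^ 3 ≤ (2 * root8 (n / 4)) ^ 3 := by gcongr
        rw [le_div_iff₀ (by positivity)] at hih
        have := h.q_nonneg (n / 4)
        calc root8 n ^ 3 * q (n / 4) ≤ (2 * root8 (n / 4)) ^ 3 * q (n / 4) := by gcongr
          _ = 8 * (q (n / 4) * root8 (n / 4) ^ 3) := by ring
          _ ≤ 8 * A := by gcongr
      have h5 : a (n / 4) ≤ C₁ * root8 n :=
        (h.a_le_root8 hm1).trans (mul_le_mul_of_nonneg_left (root8_mono (Nat.div_le_self _ _)) hC1)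
      refine (h.q_step hκ hn256).trans ?_
      rw [div_le_div_iff₀ (by positivity) (by positivity)]
      have h6 : 2 / κ * (a (n / 4) + C * root8 n ^ 3 * q (n / 4) + C) ≤ A * root8 n := by
        have h7 : 16 * C / κ * A ≤ A * root8 n / 2 := by
          have : 16 * C / κ = 32 * C / κ / 2 := by ring
          rw [this]
          nlinarith
        have h8 : 2 / κ * (C₁ + C) ≤ A / 2 := by
          rw [hA]
          have : 0 ≤ C * root8 n₁ ^ 3 := by positivity
          have : 2 / κ * (C₁ + C) = 4 / κ * (C₁ + C) / 2 := by ring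
          linarith
        calc 2 / κ * (a (n / 4) + C * root8 n ^ 3 * q (n / 4) + C)
            ≤ 2 / κ * (C₁ * root8 n + C * (8 * A) + C * root8 n) := by
              rw [mul_assoc]
              gcongr
              nlinarith
          _ = 2 / κ * (C₁ + C) * root8 n + 16 * C / κ * A := by ring
          _ ≤ A / 2 * root8 n + A * root8 n / 2 := by gcongr
          _ = _ := by ring
      calc _ ≤ A * root8 n * root8 n ^ 3 := by gcongr
        _ = _ := by ring

/-- The heights form a Cauchy sequence, with an explicit rate: consecutive blocks
`[n, 256 n]` contribute geometrically decreasing oscillations. -/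
theorem exists_oscillation_le (C κ : ℝ) (hκ : 0 < κ) (hC : 0 ≤ C) :
    ∃ D : ℝ, 0 ≤ D ∧ ∀ q a, RecursionBounds C κ q a → ∀ n n', 1 ≤ n → n ≤ n' →
      |a n' - a n| ≤ D / root8 n ^ 2 := by
  obtain ⟨A, hA0, hA⟩ := exists_q_le_cube C κ hκ hC
  set K := 2 * C * A + C with hK
  have hK0 : 0 ≤ K := by positivity
  refine ⟨2 * K, by positivity, fun q a h => ?_⟩
  have hstep : ∀ n n', 1 ≤ n → n ≤ n' → n' ≤ 256 * n → |a n' - a n| ≤ K / root8 n ^ 2 := by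
    intro n n' hn hnn' hn'
    have hr := one_le_root8 hn
    have h1 : root8 n' ≤ 2 * root8 n := by
      refine root8_le_mul (by norm_num) ?_
      norm_num
      exact_mod_cast hn'
    have h2 : C / n' ≤ C / root8 n ^ 2 := by
      gcongr
      calc root8 n ^ 2 ≤ root8 n ^ 8 := pow_le_pow_right₀ hr (by norm_num)
        _ = n := root8_pow n
        _ ≤ n' := by exact_mod_cast hnn'
    have h3 : C * root8 n' * q n ≤ 2 * C * A / root8 n ^ 2 :=
      calc C * root8 n' * q n ≤ C * (2 * root8 n) * (A / root8 n ^ 3) := by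
            have := h.q_nonneg n
            gcongr
            exact hA q a h n hn
        _ = _ := by field_simp
    calc |a n' - a n| ≤ _ := h.diff n n' hn hnn'
      _ ≤ 2 * C * A / root8 n ^ 2 + C / root8 n ^ 2 := add_le_add h3 h2
      _ = _ := by rw [hK]; ring
  have hall : ∀ k n n', 1 ≤ n → n ≤ n' → n' ≤ 256 ^ k * n → |a n' - a n| ≤ 2 * K / root8 n ^ 2 := by
    intro k
    induction k with
    | zero =>
      intro n n' hn h1 h2
      have : n' = n := by omega
      rw [this, sub_self, abs_zero]
      positivity
    | succ k ih =>
      intro n n' hn h1 h2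
      have hr := one_le_root8 hn
      rcases le_total n' (256 * n) with h3 | h3
      · refine (hstep n n' hn h1 h3).trans ?_
        gcongr
        linarith
      · have h4 := ih (256 * n) n' (by omega) h3 (by rw [pow_succ] at h2; linarith)
        have h5 := hstep n (256 * n) hn (by omega) le_rfl
        have h6 : root8 (256 * n) = 2 * root8 n := by
          have h7 : root8 (256 * n) ^ 8 = (2 * root8 n) ^ 8 := by
            rw [root8_pow, mul_pow, root8_pow]; push_cast; norm_num
          exact (pow_left_inj₀ (root8_nonneg _) (by linarith) (by norm_num)).1 h7
        rw [h6] at h4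
        calc |a n' - a n| ≤ |a n' - a (256 * n)| + |a (256 * n) - a n| := abs_sub_le _ _ _
          _ ≤ 2 * K / (2 * root8 n) ^ 2 + K / root8 n ^ 2 := add_le_add h4 h5
          _ = (3 / 2 * K) / root8 n ^ 2 := by ring
          _ ≤ _ := by gcongr; linarith
  intro n n' hn hnn'
  refine hall n' n n' hn hnn' ?_
  calc n' ≤ 256 ^ n' := (Nat.lt_pow_self (by norm_num)).le
    _ ≤ 256 ^ n' * n := Nat.le_mul_of_pos_right _ hn

/-- The bound `q n = O(n ^ (-1 / 2))`. -/
theorem exists_q_le_sqrt (C κ : ℝ) (hκ : 0 < κ) (hC : 0 ≤ C) :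
    ∃ A : ℝ, 0 ≤ A ∧ ∀ q a, RecursionBounds C κ q a → ∀ n, 1 ≤ n → q n ≤ A / root8 n ^ 4 := by
  obtain ⟨A, hA0, hA⟩ := exists_q_le_cube C κ hκ hC
  obtain ⟨D, hD0, hD⟩ := exists_oscillation_le C κ hκ hC
  refine ⟨2 / κ * (C + D + 8 * A * C + C) + C * root8 256 ^ 4,
    by have := root8_nonneg 256; positivity, fun q a h n hn => ?_⟩
  have hr := one_le_root8 hn
  have hr1 := root8_nonneg 256
  rcases lt_or_ge n 256 with hlt | hge
  · rw [le_div_iff₀ (by positivity)]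
    have h1 : root8 n ^ 4 ≤ root8 256 ^ 4 := by
      gcongr
      exact root8_mono hlt.le
    have h2 : 0 ≤ 2 / κ * (C + D + 8 * A * C + C) := by positivity
    have h3 : q n * root8 n ^ 4 ≤ C * root8 256 ^ 4 := by
      have := h.q_nonneg n
      gcongr
      exact h.q_le n
    linarith
  · refine (h.q_step hκ hge).trans ?_
    have hm1 : 1 ≤ n / 4 := by omega
    have hrm := one_le_root8 hm1
    have h1 := hA q a h (n / 4) hm1
    have h2 := root8_le_two_mul_div_four (n := n) (by omega)
    have h3 : root8 n ^ 3 * q (n / 4) ≤ 8 * A := by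
      have h4 : root8 n ^ 3 ≤ (2 * root8 (n / 4)) ^ 3 := by gcongr
      rw [le_div_iff₀ (by positivity)] at h1
      have := h.q_nonneg (n / 4)
      calc root8 n ^ 3 * q (n / 4) ≤ (2 * root8 (n / 4)) ^ 3 * q (n / 4) := by gcongr
        _ = 8 * (q (n / 4) * root8 (n / 4) ^ 3) := by ring
        _ ≤ 8 * A := by gcongr
    have h5 : a (n / 4) ≤ C + D := by
      have h6 := (abs_le.1 (hD q a h 1 (n / 4) le_rfl hm1)).2
      have h7 : D / root8 1 ^ 2 ≤ D := div_le_self hD0 (one_le_pow₀ (one_le_root8 le_rfl))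
      linarith [h.a_one_le]
    gcongr
    have h8 : 0 ≤ C * root8 256 ^ 4 := by positivity
    have h9 : C * root8 n ^ 3 * q (n / 4) ≤ 8 * A * C := by nlinarith
    calc 2 / κ * (a (n / 4) + C * root8 n ^ 3 * q (n / 4) + C)
        ≤ 2 / κ * (C + D + 8 * A * C + C) := by gcongr
      _ ≤ _ := by linarith

theorem sum_q_le (h : RecursionBounds C κ q a) {A : ℝ} (hA0 : 0 ≤ A)
    (hA : ∀ n, 1 ≤ n → q n ≤ A / root8 n ^ 4) (m : ℕ) :
    ∑ k ∈ Finset.range m, q k ≤ C + 4 * A * √m := by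
  induction m with
  | zero => simpa using h.C_nonneg
  | succ m ih =>
    rw [Finset.sum_range_succ]
    rcases Nat.eq_zero_or_pos m with rfl | hm
    · simp only [Finset.range_zero, Finset.sum_empty, zero_add]
      have : 0 ≤ 4 * A * √((1 : ℕ) : ℝ) := by positivity
      linarith [h.q_zero_le]
    · have h1 := hA m hm
      rw [← sqrt_eq_root8_pow] at h1
      have hm0 : (0 : ℝ) < m := by exact_mod_cast hm
      have hs : 0 < √(m : ℝ) := Real.sqrt_pos.2 hm0
      have h2 : √((m + 1 : ℕ) : ℝ) ≤ 2 * √m := by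
        refine Real.sqrt_le_iff.2 ⟨by positivity, ?_⟩
        rw [mul_pow, Real.sq_sqrt hm0.le]
        push_cast
        have : (1 : ℝ) ≤ m := by exact_mod_cast hm
        linarith
      have h3 : 1 / √m ≤ 4 * (√((m + 1 : ℕ) : ℝ) - √m) := by
        rw [div_le_iff₀ hs]
        have h4 : √((m + 1 : ℕ) : ℝ) ^ 2 = m + 1 := by
          rw [Real.sq_sqrt (Nat.cast_nonneg _)]; push_cast; ring
        have h5 : √(m : ℝ) ^ 2 = m := Real.sq_sqrt hm0.le
        have h6 : √(m : ℝ) ≤ √((m + 1 : ℕ) : ℝ) := Real.sqrt_le_sqrt (by push_cast; linarith)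
        nlinarith
      have h7 : A / √m ≤ 4 * A * (√((m + 1 : ℕ) : ℝ) - √m) := by
        have := mul_le_mul_of_nonneg_left h3 hA0
        calc A / √m = A * (1 / √m) := by ring
          _ ≤ _ := by linarith
      linarith

/-- The heights converge to a limit `l`, and `κ √n q n` tends to `l` as well, uniformly over all
sequences which satisfy the recursion bounds with given constants. -/
theorem uniform_limit (C κ : ℝ) (hκ : 0 < κ) (hC : 0 ≤ C) {ε : ℝ} (hε : 0 < ε) :
    ∃ n₀ : ℕ, ∀ q a, RecursionBounds C κ q a →
      ∃ l : ℝ, Tendsto a atTop (𝓝 l) ∧ ∀ n, n₀ ≤ n → |κ * √n * q n - l| ≤ ε := by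
  obtain ⟨A, hA0, hA⟩ := exists_q_le_sqrt C κ hκ hC
  obtain ⟨D, hD0, hD⟩ := exists_oscillation_le C κ hκ hC
  obtain ⟨k, hk⟩ := exists_nat_ge (4 + 2 * (κ * A + 8 * C * A) / ε)
  have hk4 : 4 ≤ k := by
    have : 0 ≤ 2 * (κ * A + 8 * C * A) / ε := by positivity
    have : (4 : ℝ) ≤ k := by linarith
    exact_mod_cast this
  have hk0 : (0 : ℝ) < k := by exact_mod_cast (by omega : 0 < k)
  have hkε : (κ * A + 8 * C * A) / k ≤ ε / 2 := by
    rw [div_le_iff₀ hk0]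
    have : 2 * (κ * A + 8 * C * A) / ε ≤ k := by linarith
    rw [div_le_iff₀ hε] at this
    linarith
  set M := k ^ 2 with hM
  have hM16 : 16 ≤ M := by rw [hM]; nlinarith
  have hM0 : (1 : ℝ) ≤ M := by exact_mod_cast (by omega : 1 ≤ M)
  set K : ℝ := D * (2 * M) ^ 2 + C * A * (2 * M) ^ 4 + C + 4 * κ * A + 2 * C + 2 * C ^ 2 with hK
  obtain ⟨n₁, hn₁⟩ := (tendsto_root8.eventually_ge_atTop (2 * K / ε)).exists
  refine ⟨max n₁ (256 * M), fun q a h => ?_⟩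
  have hcau : CauchySeq fun n => a (n + 1) := by
    refine cauchySeq_of_le_tendsto_0 (fun N => 2 * D / root8 (N + 1) ^ 2) (fun n m N hn hm => ?_) ?_
    · rw [Real.dist_eq]
      have h1 := hD q a h (N + 1) (n + 1) (by omega) (by omega)
      have h2 := hD q a h (N + 1) (m + 1) (by omega) (by omega)
      rw [abs_sub_comm] at h2
      calc _ ≤ _ := abs_sub_le _ (a (N + 1)) _
        _ ≤ _ := add_le_add h1 h2
        _ = _ := by ring
    · refine Tendsto.const_div_atTop ?_ _
      exact (tendsto_pow_atTop (by norm_num)).comp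
        (tendsto_root8.comp (tendsto_add_atTop_nat 1))
  obtain ⟨l, hl⟩ := cauchySeq_tendsto_of_complete hcau
  have hl' : Tendsto a atTop (𝓝 l) := (tendsto_add_atTop_iff_nat 1).1 hl
  refine ⟨l, hl', fun n hn => ?_⟩
  have hn256 : 256 * M ≤ n := (le_max_right _ _).trans hn
  have hnn : 1 ≤ n := by omega
  have hr := one_le_root8 hnn
  have hrK : 2 * K / ε ≤ root8 n := hn₁.trans (root8_mono ((le_max_left _ _).trans hn))
  set r := root8 n with hrdef
  set m := n / M with hm
  have hMpos : 0 < M := by omega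
  have hm1 : 1 ≤ m := (Nat.one_le_div_iff hMpos).2 (by omega)
  have hmM : m * M ≤ n := Nat.div_mul_le_self n M
  have hm4 : 4 * m ≤ n := by nlinarith
  have hnm : n ≤ 2 * M * m := by
    have h1 := Nat.lt_mul_div_succ n hMpos
    rw [← hm] at h1
    nlinarith
  obtain ⟨N, hN1, hN2, hN3, hN4⟩ := exists_split (by omega : 256 ≤ n) hm4
  have hrm := one_le_root8 hm1
  have hrrm : r ≤ 2 * M * root8 m := by
    refine root8_le_mul (by positivity) ?_
    have h1 : (n : ℝ) ≤ 2 * M * m := by exact_mod_cast hnm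
    have h2 : (2 * M : ℝ) ≤ (2 * M) ^ 8 := le_self_pow₀ (by linarith) (by norm_num)
    calc (n : ℝ) ≤ 2 * M * m := h1
      _ ≤ _ := by gcongr
  have hal : |a m - l| ≤ D / root8 m ^ 2 := by
    have h1 : Tendsto (fun n' => |a n' - a m|) atTop (𝓝 |l - a m|) := (hl'.sub_const _).abs
    rw [abs_sub_comm]
    exact le_of_tendsto h1 (eventually_atTop.2 ⟨m, fun n' hn' => hD q a h m n' hm1 hn'⟩)
  have hrpos : 0 < r := by linarith
  have hrmpos : 0 < root8 m := by linarith
  have hinv : ∀ j : ℕ, 1 / root8 m ^ j ≤ (2 * M) ^ j / r ^ j := fun j => by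
    rw [div_le_div_iff₀ (by positivity) (by positivity), one_mul, ← mul_pow]
    gcongr
  have hpow : ∀ j : ℕ, 1 ≤ j → 1 / r ^ j ≤ 1 / r := fun j hj => by
    gcongr
    exact le_self_pow₀ hr (by omega)
  -- the error terms
  have e1 : D / root8 m ^ 2 ≤ D * (2 * M) ^ 2 / r :=
    calc D / root8 m ^ 2 = D * (1 / root8 m ^ 2) := by ring
      _ ≤ D * ((2 * M) ^ 2 / r ^ 2) := mul_le_mul_of_nonneg_left (hinv 2) hD0
      _ = D * (2 * M) ^ 2 * (1 / r ^ 2) := by ring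
      _ ≤ D * (2 * M) ^ 2 * (1 / r) := by gcongr ?_ * ?_; exact hpow 2 (by norm_num)
      _ = _ := by ring
  have e2 : C * r ^ 3 * q m ≤ C * A * (2 * M) ^ 4 / r :=
    calc C * r ^ 3 * q m ≤ C * r ^ 3 * (A / root8 m ^ 4) := by
          gcongr
          exact hA q a h m hm1
      _ = C * A * r ^ 3 * (1 / root8 m ^ 4) := by ring
      _ ≤ C * A * r ^ 3 * ((2 * M) ^ 4 / r ^ 4) :=
        mul_le_mul_of_nonneg_left (hinv 4) (by positivity)
      _ = _ := by field_simp
  have e3 : C / n ≤ C / r := by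
    gcongr
    rw [← root8_pow n]
    exact le_self_pow₀ hr (by norm_num)
  have hqn := hA q a h n hnn
  have hq0 := h.q_nonneg n
  have hs4 : √(n : ℝ) = r ^ 4 := sqrt_eq_root8_pow n
  have hr8 : r ^ 8 = n := root8_pow n
  have hNn : √(N : ℝ) ≤ √(n : ℝ) := Real.sqrt_le_sqrt (by exact_mod_cast (by omega : N ≤ n))
  have hmn : (m : ℝ) * M ≤ n := by exact_mod_cast hmM
  have e4 : κ * √n * q n - κ * √N * q n ≤ κ * A / k + 4 * κ * A / r := by
    have h1 : √(n : ℝ) - √N ≤ (m + 4 * r) / r ^ 4 := by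
      rw [le_div_iff₀ (by positivity), ← hs4]
      have h2 : √(n : ℝ) ^ 2 = n := Real.sq_sqrt (Nat.cast_nonneg _)
      have h3 : √(N : ℝ) ^ 2 = N := Real.sq_sqrt (Nat.cast_nonneg _)
      have h4 := Real.sqrt_nonneg (N : ℝ)
      nlinarith
    have h5 : (m : ℝ) / r ^ 8 ≤ 1 / k := by
      rw [hr8, div_le_div_iff₀ (by positivity) hk0]
      have : (k : ℝ) ≤ M := by
        rw [hM]; push_cast
        exact le_self_pow₀ (by exact_mod_cast (by omega : 1 ≤ k)) (by norm_num)
      calc (m : ℝ) * k ≤ m * M := by gcongr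
        _ ≤ 1 * n := by linarith
    calc κ * √n * q n - κ * √N * q n = κ * q n * (√n - √N) := by ring
      _ ≤ κ * (A / r ^ 4) * ((m + 4 * r) / r ^ 4) := by
          gcongr
      _ = κ * A * (m / r ^ 8) + 4 * κ * A * (1 / r ^ 7) := by field_simp
      _ ≤ κ * A * (1 / k) + 4 * κ * A * (1 / r) := by
          gcongr ?_ * ?_ + ?_ * ?_
          exact hpow 7 (by norm_num)
      _ = _ := by ring
  have e5 : C * (r + ∑ k ∈ Finset.range m, q k) / √N ≤
      8 * C * A / k + (2 * C + 2 * C ^ 2) / r := by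
    have h1 := h.sum_q_le hA0 (hA q a h) m
    have h2 : √(m : ℝ) ≤ r ^ 4 / k := by
      rw [le_div_iff₀ hk0, ← hs4]
      refine Real.le_sqrt_of_sq_le ?_
      rw [mul_pow, Real.sq_sqrt (Nat.cast_nonneg _)]
      have : (M : ℝ) = (k : ℝ) ^ 2 := by rw [hM]; push_cast; ring
      rw [← this]
      exact hmn
    calc C * (r + ∑ k ∈ Finset.range m, q k) / √N
        ≤ C * (r + (C + 4 * A * (r ^ 4 / k))) / (r ^ 4 / 2) := by
          gcongr
          refine h1.trans ?_
          gcongr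
      _ = 8 * C * A / k + 2 * C * (1 / r ^ 3) + 2 * C ^ 2 * (1 / r ^ 4) := by
          field_simp; ring
      _ ≤ 8 * C * A / k + 2 * C * (1 / r) + 2 * C ^ 2 * (1 / r) := by
          gcongr 8 * C * A / k + ?_ * ?_ + ?_ * ?_
          · exact hpow 3 (by norm_num)
          · exact hpow 4 (by norm_num)
      _ = _ := by ring
  have hKr : K / r ≤ ε / 2 := by
    rw [div_le_iff₀ hε] at hrK
    rw [div_le_iff₀ hrpos]
    linarith
  have hKsum : K / r = D * (2 * M) ^ 2 / r + C * A * (2 * M) ^ 4 / r + C / r + 4 * κ * A / r +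
      (2 * C + 2 * C ^ 2) / r := by rw [hK]; ring
  have hksum : (κ * A + 8 * C * A) / k = κ * A / k + 8 * C * A / k := by ring
  have hup := h.upper m n N hm1 hN1 hN2
  have hlo := h.lower m n N hm1 hN1 hN2
  rw [← hrdef] at hup hlo
  have hal' := abs_le.1 hal
  have hge : κ * √N * q n ≤ κ * √n * q n := by gcongr
  have p1 : 0 ≤ κ * A / k := by positivity
  have p2 : 0 ≤ 8 * C * A / k := by positivity
  have p3 : 0 ≤ 4 * κ * A / r := by positivity
  have p4 : 0 ≤ (2 * C + 2 * C ^ 2) / r := by positivity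
  rw [abs_le]
  constructor <;> linarith

end RecursionBounds

end Recursion

/-! ### Functions with exponential moments -/

section ExpBounded

variable {Z : Type*} [MeasurableSpace Z]

/-- The measurable function `h` has exponential moment of order `a` at most `C`. -/
structure ExpBounded (Q : Measure Z) (a C : ℝ) (h : Z → ℝ) : Prop where
  measurable : Measurable h
  bound : ∫⁻ z, ENNReal.ofReal (Real.exp (a * |h z|)) ∂Q ≤ ENNReal.ofReal C

namespace ExpBounded

variable {Q : Measure Z} {a C : ℝ} {h : Z → ℝ}

theorem measurable_exp (hh : ExpBounded Q a C h) : Measurable fun z => Real.exp (a * |h z|) := by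
  have := hh.measurable
  fun_prop

theorem integrable_exp (hh : ExpBounded Q a C h) :
    Integrable (fun z => Real.exp (a * |h z|)) Q := by
  refine ⟨hh.measurable_exp.aestronglyMeasurable, ?_⟩
  rw [hasFiniteIntegral_iff_ofReal (ae_of_all _ fun z => (Real.exp_pos _).le)]
  exact hh.bound.trans_lt ENNReal.ofReal_lt_top

theorem integral_exp_le (hh : ExpBounded Q a C h) (hC : 0 ≤ C) :
    ∫ z, Real.exp (a * |h z|) ∂Q ≤ C := by
  rw [integral_eq_lintegral_of_nonneg_ae (ae_of_all _ fun z => (Real.exp_pos _).le)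
    hh.measurable_exp.aestronglyMeasurable]
  exact ENNReal.toReal_le_of_le_ofReal hC hh.bound

theorem sq_le_exp (ha : 0 < a) (u : ℝ) : u ^ 2 ≤ 2 / a ^ 2 * Real.exp (a * |u|) := by
  have h1 := Real.pow_div_factorial_le_exp (a * |u|) (by positivity) 2
  rw [mul_pow, sq_abs] at h1
  norm_num [Nat.factorial] at h1
  rw [div_mul_eq_mul_div, le_div_iff₀ (by positivity)]
  linarith

theorem memLp_two (hh : ExpBounded Q a C h) (ha : 0 < a) : MemLp h 2 Q := by
  rw [memLp_two_iff_integrable_sq hh.measurable.aestronglyMeasurable]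
  refine (hh.integrable_exp.const_mul (2 / a ^ 2)).mono'
    (hh.measurable.pow_const 2).aestronglyMeasurable (ae_of_all _ fun z => ?_)
  rw [Real.norm_of_nonneg (sq_nonneg _)]
  exact sq_le_exp ha _

theorem integral_sq_le (hh : ExpBounded Q a C h) (ha : 0 < a) (hC : 0 ≤ C) :
    ∫ z, h z ^ 2 ∂Q ≤ 2 / a ^ 2 * C := by
  calc ∫ z, h z ^ 2 ∂Q ≤ ∫ z, 2 / a ^ 2 * Real.exp (a * |h z|) ∂Q :=
        integral_mono (hh.memLp_two ha).integrable_sq (hh.integrable_exp.const_mul _)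
          fun z => sq_le_exp ha _
    _ ≤ _ := by
        rw [integral_const_mul]
        gcongr
        exact hh.integral_exp_le hC

theorem abs_le_add_exp (ha : 0 < a) (L u : ℝ) :
    |u| ≤ L + 2 / a * Real.exp (-(a * L / 2)) * Real.exp (a * |u|) := by
  rcases le_or_gt |u| L with hu | hu
  · have : 0 ≤ 2 / a * Real.exp (-(a * L / 2)) * Real.exp (a * |u|) := by positivity
    rcases le_or_gt 0 L with hL | hL
    · linarith
    · linarith [abs_nonneg u]
  · have h1 := Real.add_one_le_exp (a * |u| / 2)
    have h2 : Real.exp (a * |u| / 2) ≤ Real.exp (-(a * L / 2)) * Real.exp (a * |u|) := by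
      rw [← Real.exp_add, Real.exp_le_exp]
      nlinarith
    have h3 : |u| = 2 / a * (a * |u| / 2) := by field_simp
    have h4 : 2 / a * (a * |u| / 2) ≤
        2 / a * (Real.exp (-(a * L / 2)) * Real.exp (a * |u|)) := by
      gcongr
      linarith
    rcases le_or_gt 0 L with hL | hL
    · linarith
    · have h5 : -L ≤ 2 / a * (Real.exp (-(a * L / 2)) * Real.exp (a * |u|)) - |u| := by
        have h6 := Real.add_one_le_exp (-(a * L / 2) + a * |u|)
        rw [Real.exp_add] at h6
        have h7 : 2 / a * (-(a * L / 2) + a * |u|) = -L + 2 * |u| := by field_simp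
        have h8 : 2 / a * (-(a * L / 2) + a * |u|) ≤
            2 / a * (Real.exp (-(a * L / 2)) * Real.exp (a * |u|)) := by
          gcongr
          linarith
        have := abs_nonneg u
        linarith
      linarith

/-- Against a bounded weight, a function with exponential moments behaves like a function bounded
by `L`, up to an error which is exponentially small in `L`. -/
theorem integral_mul_abs_le (hh : ExpBounded Q a C h) (ha : 0 < a) (hC : 0 ≤ C)
    {B : ℝ} (hB : 0 ≤ B) {w : Z → ℝ} (hw : Integrable w Q) (hw0 : ∀ z, 0 ≤ w z)
    (hwB : ∀ z, w z ≤ B) (L : ℝ) :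
    ∫ z, w z * |h z| ∂Q ≤ L * ∫ z, w z ∂Q + B * (2 / a * Real.exp (-(a * L / 2))) * C := by
  have hi : Integrable
      (fun z => L * w z + B * (2 / a * Real.exp (-(a * L / 2))) * Real.exp (a * |h z|)) Q :=
    (hw.const_mul L).add (hh.integrable_exp.const_mul _)
  calc ∫ z, w z * |h z| ∂Q
      ≤ ∫ z, L * w z + B * (2 / a * Real.exp (-(a * L / 2))) * Real.exp (a * |h z|) ∂Q := by
        refine integral_mono_of_nonneg (ae_of_all _ fun z => mul_nonneg (hw0 z) (abs_nonneg _)) hi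
          (ae_of_all _ fun z => ?_)
        have h0 : 0 ≤ 2 / a * Real.exp (-(a * L / 2)) * Real.exp (a * |h z|) := by positivity
        calc w z * |h z| ≤
              w z * (L + 2 / a * Real.exp (-(a * L / 2)) * Real.exp (a * |h z|)) :=
              mul_le_mul_of_nonneg_left (abs_le_add_exp ha L (h z)) (hw0 z)
          _ = L * w z + w z * (2 / a * Real.exp (-(a * L / 2)) * Real.exp (a * |h z|)) := by ring
          _ ≤ L * w z + B * (2 / a * Real.exp (-(a * L / 2)) * Real.exp (a * |h z|)) :=
              (add_le_add_iff_left _).2 (mul_le_mul_of_nonneg_right (hwB z) h0)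
          _ = _ := by ring
    _ = L * ∫ z, w z ∂Q +
          B * (2 / a * Real.exp (-(a * L / 2))) * ∫ z, Real.exp (a * |h z|) ∂Q := by
        rw [integral_add (hw.const_mul L) (hh.integrable_exp.const_mul _), integral_const_mul,
          integral_const_mul]
    _ ≤ _ := by
        gcongr
        exact hh.integral_exp_le hC

theorem measureReal_lt_abs_le [IsFiniteMeasure Q] (hh : ExpBounded Q a C h) (ha : 0 < a)
    (hC : 0 ≤ C) (L : ℝ) : Q.real {z | L < |h z|} ≤ C * Real.exp (-(a * L)) := by
  have h1 := mul_meas_ge_le_integral_of_nonneg (ae_of_all Q fun z => (Real.exp_pos (a * |h z|)).le)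
    hh.integrable_exp (Real.exp (a * L))
  have h2 : Q.real {z | L < |h z|} ≤ Q.real {z | Real.exp (a * L) ≤ Real.exp (a * |h z|)} :=
    measureReal_mono (fun z hz => by
      simp only [Set.mem_ofPred_eq, Real.exp_le_exp] at hz ⊢
      gcongr) (by finiteness)
  rw [Real.exp_neg, ← div_eq_mul_inv, le_div_iff₀ (Real.exp_pos _), mul_comm]
  calc _ ≤ Real.exp (a * L) * Q.real {z | Real.exp (a * L) ≤ Real.exp (a * |h z|)} := by gcongr
    _ ≤ _ := h1.trans (hh.integral_exp_le hC)

end ExpBounded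

end ExpBounded

/-! ### Steps of the walk given the past -/

section Steps

variable {G X : Type*} [Group G] [MulAction G X]

theorem dropPath_concat_of_le {j n : ℕ} (h : j ≤ n) (ω ω' : ℕ → G) :
    dropPath j (concat n ω ω') = concat (n - j) (dropPath j ω) ω' := by
  funext i
  simp only [dropPath, concat]
  grind

/-- A function of `(ω, x)` along the orbit of the shift, on the space of paths, starting points
and starting heights. -/
def alongOrbit (F : ℕ → (ℕ → G) × X → ℝ) (k : ℕ) (z : (ℕ → G) × (X × ℝ)) : ℝ :=
  F k (shift^[k] (z.1, z.2.1))

/-- The increment of the walk between the times `i` and `i + 1`. -/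
def step (σ : G → X → ℝ) (i : ℕ) (z : (ℕ → G) × (X × ℝ)) : ℝ :=
  σ (z.1 i) (leftProd z.1 i • z.2.1)

/-- The perturbed walk as a function of the path, the starting point and the starting height. -/
def height (σ : G → X → ℝ) (F : ℕ → (ℕ → G) × X → ℝ) (k : ℕ) (z : (ℕ → G) × (X × ℝ)) : ℝ :=
  perturbedWalk σ F z.2.1 z.2.2 k z.1

/-- The event that the perturbed walk is nonnegative at the times `1, …, k`. -/
def alive (σ : G → X → ℝ) (F : ℕ → (ℕ → G) × X → ℝ) (k : ℕ) : Set ((ℕ → G) × (X × ℝ)) :=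
  {z | ∀ j, 1 ≤ j → j ≤ k → 0 ≤ height σ F j z}

/-- The weight `θ` restricted to the event that the perturbed walk is nonnegative at the times
`1, …, k`. -/
noncomputable def aliveWeight (σ : G → X → ℝ) (F : ℕ → (ℕ → G) × X → ℝ) (θ : (ℕ → G) → ℝ) (k : ℕ)
    (z : (ℕ → G) × (X × ℝ)) : ℝ :=
  (alive σ F k).indicator (fun z => θ z.1) z

variable {σ : G → X → ℝ} {F : ℕ → (ℕ → G) × X → ℝ}

theorem height_eq (k : ℕ) (z : (ℕ → G) × (X × ℝ)) :
    height σ F k z = z.2.2 + walk σ z.2.1 k z.1 + alongOrbit F k z - alongOrbit F 0 z := rfl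

theorem alive_anti : Antitone (alive σ F) := fun _ _ h _ hz j h1 h2 => hz j h1 (h2.trans h)

theorem mem_alive_succ {k : ℕ} {z : (ℕ → G) × (X × ℝ)} :
    z ∈ alive σ F (k + 1) ↔ z ∈ alive σ F k ∧ 0 ≤ height σ F (k + 1) z := by
  constructor
  · exact fun h => ⟨alive_anti (Nat.le_succ k) h, h (k + 1) (by omega) le_rfl⟩
  · rintro ⟨h1, h2⟩ j hj hjk
    rcases Nat.lt_or_ge j (k + 1) with h | h
    · exact h1 j hj (by omega)
    · have : j = k + 1 := by omega
      exact this ▸ h2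

theorem isPast_alongOrbit {p : ℕ} (hF : ∀ k, IsPast p (F k)) (k : ℕ) :
    IsPast (k + p) (alongOrbit F k) := fun ω ω' e => by
  simp only [alongOrbit, shift_iterate, leftProd_concat (Nat.le_add_right k p),
    dropPath_concat_of_le (Nat.le_add_right k p), Nat.add_sub_cancel_left]
  exact hF k _ _ _

theorem isPast_walk (k : ℕ) :
    IsPast k (fun z : (ℕ → G) × (X × ℝ) => walk σ z.2.1 k z.1) :=
  fun _ _ _ => walk_concat le_rfl _ _ _

theorem isPast_height {p : ℕ} (hF : ∀ k, IsPast p (F k)) (k : ℕ) :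
    IsPast (k + p) (height σ F k) := fun ω ω' e => by
  simp only [height_eq]
  rw [walk_concat (Nat.le_add_right k p), isPast_alongOrbit hF k ω ω' e,
    (isPast_alongOrbit hF 0).mono (by omega : 0 + p ≤ k + p) ω ω' e]

theorem isPast_aliveWeight {p : ℕ} (hF : ∀ k, IsPast p (F k)) {θ : (ℕ → G) → ℝ}
    (hθ : ∀ ω ω', θ (concat p ω ω') = θ ω) (k : ℕ) :
    IsPast (k + p) (aliveWeight σ F θ k) := fun ω ω' e => by
  have h1 : (concat (k + p) ω ω', e) ∈ alive σ F k ↔ (ω, e) ∈ alive σ F k := by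
    simp only [alive, Set.mem_ofPred_eq]
    refine forall_congr' fun j => forall_congr' fun _ => forall_congr' fun hj => ?_
    rw [(isPast_height hF j).mono (by omega : j + p ≤ k + p) ω ω' e]
  have h2 : θ (concat (k + p) ω ω') = θ ω := by
    rw [← hθ (concat (k + p) ω ω') ω, ← hθ ω ω, concat_concat_left (Nat.le_add_left p k)]
  simp only [aliveWeight, Set.indicator]
  by_cases h : (ω, e) ∈ alive σ F k
  · rw [if_pos h, if_pos (h1.2 h), h2]
  · rw [if_neg h, if_neg (mt h1.1 h)]

theorem step_concat (j : ℕ) (ω ω' : ℕ → G) (e : X × ℝ) :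
    step σ j (concat j ω ω', e) = σ (ω' 0) (leftProd ω j • e.1) := by
  simp only [step, concat_self, leftProd_concat le_rfl]

theorem walk_succ_eq (hσ : IsCocycle σ) (k : ℕ) (z : (ℕ → G) × (X × ℝ)) :
    walk σ z.2.1 (k + 1) z.1 = walk σ z.2.1 k z.1 + step σ k z := by
  rw [hσ.walk_succ, step, add_comm]

theorem walk_add_eq_sum (hσ : IsCocycle σ) (k p : ℕ) (z : (ℕ → G) × (X × ℝ)) :
    walk σ z.2.1 (k + p) z.1 = walk σ z.2.1 k z.1 + ∑ i ∈ Finset.range p, step σ (k + i) z := by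
  induction p with
  | zero => simp
  | succ p ih => rw [← add_assoc, walk_succ_eq hσ, ih, Finset.sum_range_succ, add_assoc]

section Measurability

variable [MeasurableSpace G] [MeasurableSpace X] [MeasurableMul₂ G] [MeasurableSMul₂ G X]

theorem measurable_alongOrbit (hF : ∀ k, Measurable (F k)) (k : ℕ) :
    Measurable (alongOrbit F k) :=
  (hF k).comp ((measurable_shift.iterate k).comp (measurable_fst.prodMk
    (measurable_fst.comp measurable_snd)))

theorem measurable_step (hσ : Measurable (Function.uncurry σ)) (i : ℕ) :
    Measurable (step σ i) :=
  hσ.comp (((measurable_pi_apply i).comp measurable_fst).prodMk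
    (((measurable_leftProd i).comp measurable_fst).smul (measurable_fst.comp measurable_snd)))

theorem measurable_walk' (hσ : Measurable (Function.uncurry σ)) (k : ℕ) :
    Measurable fun z : (ℕ → G) × (X × ℝ) => walk σ z.2.1 k z.1 :=
  (measurable_walk hσ k).comp (measurable_fst.prodMk (measurable_fst.comp measurable_snd))

theorem measurable_height (hσ : Measurable (Function.uncurry σ)) (hF : ∀ k, Measurable (F k))
    (k : ℕ) : Measurable (height σ F k) := by
  have h1 := measurable_walk' hσ k
  have h2 := measurable_alongOrbit hF k
  have h3 := measurable_alongOrbit hF 0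
  exact (((measurable_snd.comp measurable_snd).add h1).add h2).sub h3

theorem measurableSet_alive (hσ : Measurable (Function.uncurry σ)) (hF : ∀ k, Measurable (F k))
    (k : ℕ) : MeasurableSet (alive σ F k) := by
  have : alive σ F k = ⋂ j ∈ Finset.Icc 1 k, {z | 0 ≤ height σ F j z} := by
    ext z; simp [alive]
  rw [this]
  exact Finset.measurableSet_biInter _ fun j _ =>
    measurableSet_le measurable_const (measurable_height hσ hF j)

theorem measurable_aliveWeight (hσ : Measurable (Function.uncurry σ))
    (hF : ∀ k, Measurable (F k)) {θ : (ℕ → G) → ℝ} (hθ : Measurable θ) (k : ℕ) :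
    Measurable (aliveWeight σ F θ k) :=
  (hθ.comp measurable_fst).indicator (measurableSet_alive hσ hF k)

variable {μ : Measure G} [IsProbabilityMeasure μ] {ρ : Measure (X × ℝ)} [IsFiniteMeasure ρ]

/-- The steps of the walk are martingale increments. -/
theorem integral_mul_step_eq_zero (hσ : Measurable (Function.uncurry σ)) (hc : IsCentered μ σ)
    {j : ℕ} {w : (ℕ → G) × (X × ℝ) → ℝ} (hw : IsPast j w)
    (hi : Integrable (fun z => w z * step σ j z) ((pathLaw μ).prod ρ)) :
    ∫ z, w z * step σ j z ∂((pathLaw μ).prod ρ) = 0 := by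
  rw [integral_resample j hi]
  refine integral_eq_zero_of_ae (ae_of_all _ fun z => ?_)
  simp only [hw z.1 _ z.2, step_concat, Pi.zero_apply]
  rw [integral_const_mul]
  have h := measurePreserving_eval μ 0
  have h1 : ∫ ω' : ℕ → G, σ (ω' 0) (leftProd z.1 j • z.2.1) ∂(pathLaw μ) =
      ∫ g, σ g (leftProd z.1 j • z.2.1) ∂μ := by
    conv_rhs => rw [← h.map_eq]
    rw [integral_map h.aemeasurable]
    exact (hσ.comp (measurable_id.prodMk measurable_const)).aestronglyMeasurable
  rw [h1, hc, mul_zero]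

omit [MeasurableMul₂ G] [MeasurableSMul₂ G X] in
/-- The steps of the walk have bounded conditional variances. -/
theorem integral_mul_step_sq_le (hσ : Measurable (Function.uncurry σ)) {M : ℝ}
    (hM : ∀ x, ∫ g, σ g x ^ 2 ∂μ ≤ M)
    {j : ℕ} {w : (ℕ → G) × (X × ℝ) → ℝ} (hw : IsPast j w) (hw0 : ∀ z, 0 ≤ w z)
    (hwi : Integrable w ((pathLaw μ).prod ρ))
    (hi : Integrable (fun z => w z * step σ j z ^ 2) ((pathLaw μ).prod ρ)) :
    ∫ z, w z * step σ j z ^ 2 ∂((pathLaw μ).prod ρ) ≤ M * ∫ z, w z ∂((pathLaw μ).prod ρ) := by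
  rw [integral_resample j hi, ← integral_const_mul]
  refine integral_mono (integrable_resample j hi) (hwi.const_mul M) fun z => ?_
  simp only [hw z.1 _ z.2, step_concat]
  rw [integral_const_mul, mul_comm]
  refine mul_le_mul_of_nonneg_right ?_ (hw0 z)
  have h := measurePreserving_eval μ 0
  have h1 : ∫ ω' : ℕ → G, σ (ω' 0) (leftProd z.1 j • z.2.1) ^ 2 ∂(pathLaw μ) =
      ∫ g, σ g (leftProd z.1 j • z.2.1) ^ 2 ∂μ := by
    conv_rhs => rw [← h.map_eq]
    rw [integral_map h.aemeasurable]
    exact ((hσ.comp (measurable_id.prodMk measurable_const)).pow_const 2).aestronglyMeasurable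
  rw [h1]
  exact hM _

/-- The Markov property at time `j` for the event to stay nonnegative during the next `N` steps. -/
theorem integral_mul_indicator_stay (hσ : Measurable (Function.uncurry σ)) (N j : ℕ) (c : ℝ)
    {w : (ℕ → G) × (X × ℝ) → ℝ} (hw : IsPast j w) (hwi : Integrable w ((pathLaw μ).prod ρ)) :
    Integrable (fun z => w z * stayProb μ σ N (leftProd z.1 j • z.2.1) (walk σ z.2.1 j z.1 + c))
      ((pathLaw μ).prod ρ) ∧
    ∫ z, {z : (ℕ → G) × (X × ℝ) | ∀ i ≤ N, 0 ≤ walk σ z.2.1 j z.1 + c +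
        walk σ (leftProd z.1 j • z.2.1) i (dropPath j z.1)}.indicator w z ∂((pathLaw μ).prod ρ) =
      ∫ z, w z * stayProb μ σ N (leftProd z.1 j • z.2.1) (walk σ z.2.1 j z.1 + c)
        ∂((pathLaw μ).prod ρ) := by
  set S : Set ((ℕ → G) × (X × ℝ)) := {z | ∀ i ≤ N, 0 ≤ walk σ z.2.1 j z.1 + c +
        walk σ (leftProd z.1 j • z.2.1) i (dropPath j z.1)} with hS
  have hSm : MeasurableSet S := by
    have : S = ⋂ i ∈ Finset.range (N + 1), {z | 0 ≤ walk σ z.2.1 j z.1 + c +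
        walk σ (leftProd z.1 j • z.2.1) i (dropPath j z.1)} := by
      ext z; simp [hS]
    rw [this]
    refine Finset.measurableSet_biInter _ fun i _ => measurableSet_le measurable_const
      (((measurable_walk' hσ j).add_const c).add ?_)
    exact (measurable_walk hσ i).comp (((measurable_dropPath j).comp measurable_fst).prodMk
      (((measurable_leftProd j).comp measurable_fst).smul (measurable_fst.comp measurable_snd)))
  have hi : Integrable (S.indicator w) ((pathLaw μ).prod ρ) := hwi.indicator hSm
  have hinner : ∀ z : (ℕ → G) × (X × ℝ),
      ∫ ω', S.indicator w (concat j z.1 ω', z.2) ∂(pathLaw μ) =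
        w z * stayProb μ σ N (leftProd z.1 j • z.2.1) (walk σ z.2.1 j z.1 + c) := by
    intro z
    set T : Set (ℕ → G) := {ω' | ∀ i ≤ N, 0 ≤ walk σ z.2.1 j z.1 + c +
      walk σ (leftProd z.1 j • z.2.1) i ω'} with hT
    have hTm : MeasurableSet T := by
      have : T = ⋂ i ∈ Finset.range (N + 1), {ω' | 0 ≤ walk σ z.2.1 j z.1 + c +
          walk σ (leftProd z.1 j • z.2.1) i ω'} := by
        ext ω'; simp [hT]
      rw [this]
      exact Finset.measurableSet_biInter _ fun i _ => measurableSet_le measurable_const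
        (((measurable_walk hσ i).comp (measurable_id.prodMk measurable_const)).const_add _)
    have h1 : (fun ω' => S.indicator w (concat j z.1 ω', z.2)) = T.indicator fun _ => w z := by
      funext ω'
      have hmem : (concat j z.1 ω', z.2) ∈ S ↔ ω' ∈ T := by
        simp only [hS, hT, Set.mem_ofPred_eq, dropPath_concat, leftProd_concat le_rfl,
          walk_concat le_rfl]
      simp only [Set.indicator, hmem, hw z.1 ω' z.2]
    rw [h1, integral_indicator hTm, setIntegral_const, smul_eq_mul, mul_comm]
    rfl
  have h2 := integrable_resample j hi
  have h3 := integral_resample j hi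
  simp only [hinner] at h2 h3
  exact ⟨h2, h3⟩

end Measurability

end Steps

/-! ### Perturbations with a bounded look-ahead -/

section LookAhead

variable {G X : Type*} [Group G] [MulAction G X] [MeasurableSpace G] [MeasurableSpace X]

/-- A measurable cocycle whose increments are centered with variance at most `M`. -/
structure CenteredCocycle (μ : Measure G) (σ : G → X → ℝ) (M : ℝ) : Prop where
  measurable : Measurable (Function.uncurry σ)
  cocycle : IsCocycle σ
  centered : IsCentered μ σ
  sq_le : ∀ x, ∫ g, σ g x ^ 2 ∂μ ≤ M

/-- A measurable perturbation `F` and a weight `θ` with values in `[0, B]`, with exponential moments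
of order `a` at most `C` for all quantities which govern the perturbed walk. The law of starting
point and starting height is `ρ`. -/
structure PerturbedSystem (μ : Measure G) (ρ : Measure (X × ℝ)) (σ : G → X → ℝ) (a C B : ℝ)
    (F : ℕ → (ℕ → G) × X → ℝ) (θ : (ℕ → G) → ℝ) : Prop where
  measurable_F : ∀ k, Measurable (F k)
  measurable_θ : Measurable θ
  θ_nonneg : ∀ ω, 0 ≤ θ ω
  θ_le : ∀ ω, θ ω ≤ B
  exp_orbit : ∀ k, ExpBounded ((pathLaw μ).prod ρ) a C (alongOrbit F k)
  exp_start : ExpBounded ((pathLaw μ).prod ρ) a C (fun z => z.2.2)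
  exp_step : ∀ i, ExpBounded ((pathLaw μ).prod ρ) a C (step σ i)

/-- A perturbed system in which the perturbations `F` and the weight `θ` depend on `p` steps of the
path only. -/
structure LookAheadSystem (μ : Measure G) (ρ : Measure (X × ℝ)) (σ : G → X → ℝ) (a C B : ℝ) (p : ℕ)
    (F : ℕ → (ℕ → G) × X → ℝ) (θ : (ℕ → G) → ℝ) : Prop
    extends PerturbedSystem μ ρ σ a C B F θ where
  isPast_F : ∀ k, IsPast p (F k)
  past_θ : ∀ ω ω', θ (concat p ω ω') = θ ω

/-- The total weight of the paths along which the perturbed walk is nonnegative at the times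
`1, …, k`. -/
noncomputable def aliveMass (μ : Measure G) (ρ : Measure (X × ℝ)) (σ : G → X → ℝ)
    (F : ℕ → (ℕ → G) × X → ℝ) (θ : (ℕ → G) → ℝ) (k : ℕ) : ℝ :=
  ∫ z, aliveWeight σ F θ k z ∂((pathLaw μ).prod ρ)

/-- The total weighted height at time `k` of the paths along which the perturbed walk is nonnegative
at the times `1, …, k`. -/
noncomputable def aliveHeight (μ : Measure G) (ρ : Measure (X × ℝ)) (σ : G → X → ℝ)
    (F : ℕ → (ℕ → G) × X → ℝ) (θ : (ℕ → G) → ℝ) (k : ℕ) : ℝ :=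
  ∫ z, aliveWeight σ F θ k z * height σ F k z ∂((pathLaw μ).prod ρ)

/-- An upper bound for the distance between the height at time `k` and the walk at time `k + p`,
and for the walk at time `k + 1 + p` on the event that the perturbed walk becomes negative at time
`k + 1`. -/
noncomputable def gap (σ : G → X → ℝ) (F : ℕ → (ℕ → G) × X → ℝ) (p k : ℕ)
    (z : (ℕ → G) × (X × ℝ)) : ℝ :=
  2 * |z.2.2| + ∑ i ∈ Finset.range (p + 1), |step σ (k + i) z| + 2 * |alongOrbit F (k + 1) z| +
    2 * |alongOrbit F k z| + 2 * |alongOrbit F 0 z|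

/-- The error from truncating a variable with exponential moments at level `L`. -/
noncomputable def truncErr (a C B L : ℝ) : ℝ := B * (2 / a * Real.exp (-(a * L / 2))) * C

omit [MeasurableSpace G] [MeasurableSpace X] in
theorem abs_walk_sub_height_le {σ : G → X → ℝ} (hσ : IsCocycle σ) (F : ℕ → (ℕ → G) × X → ℝ)
    (p k : ℕ) (z : (ℕ → G) × (X × ℝ)) :
    |walk σ z.2.1 (k + p) z.1 - height σ F k z| ≤ gap σ F p k z := by
  rw [walk_add_eq_sum hσ, height_eq, gap, Finset.sum_range_succ]
  have h1 : |∑ i ∈ Finset.range p, step σ (k + i) z| ≤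
      ∑ i ∈ Finset.range p, |step σ (k + i) z| := Finset.abs_sum_le_sum_abs _ _
  have h2 := abs_nonneg (step σ (k + p) z)
  rw [abs_le] at h1 ⊢
  have h3 := abs_le.1 (le_refl |z.2.2|)
  have h4 := abs_le.1 (le_refl |alongOrbit F k z|)
  have h5 := abs_le.1 (le_refl |alongOrbit F 0 z|)
  have h6 := abs_nonneg (alongOrbit F (k + 1) z)
  have h7 := abs_nonneg z.2.2
  have h8 := abs_nonneg (alongOrbit F k z)
  have h9 := abs_nonneg (alongOrbit F 0 z)
  constructor <;> linarith

omit [MeasurableSpace G] [MeasurableSpace X] in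
theorem abs_walk_le_of_exit {σ : G → X → ℝ} (hσ : IsCocycle σ) {F : ℕ → (ℕ → G) × X → ℝ}
    (p : ℕ) {k : ℕ} {z : (ℕ → G) × (X × ℝ)} (h1 : z ∈ alive σ F k) (h2 : z ∉ alive σ F (k + 1)) :
    |walk σ z.2.1 (k + 1 + p) z.1| ≤ gap σ F p k z := by
  have hneg : height σ F (k + 1) z < 0 := by
    by_contra hc
    exact h2 (mem_alive_succ.2 ⟨h1, not_lt.1 hc⟩)
  have hpos : -|z.2.2| ≤ height σ F k z := by
    rcases Nat.eq_zero_or_pos k with rfl | hk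
    · rw [height_eq, hσ.walk_zero]
      linarith [neg_abs_le z.2.2]
    · linarith [h1 k hk le_rfl, abs_nonneg z.2.2]
  rw [height_eq] at hneg hpos
  rw [walk_succ_eq hσ] at hneg
  rw [walk_add_eq_sum hσ, walk_succ_eq hσ, gap, Finset.sum_range_succ']
  have hs : ∀ i, k + 1 + i = k + (i + 1) := fun i => by omega
  simp only [hs, add_zero]
  have e1 : |∑ i ∈ Finset.range p, step σ (k + (i + 1)) z| ≤
      ∑ i ∈ Finset.range p, |step σ (k + (i + 1)) z| := Finset.abs_sum_le_sum_abs _ _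
  rw [abs_le] at e1 ⊢
  have h3 := abs_le.1 (le_refl |z.2.2|)
  have h4 := abs_le.1 (le_refl |alongOrbit F k z|)
  have h5 := abs_le.1 (le_refl |alongOrbit F 0 z|)
  have h6 := abs_le.1 (le_refl |alongOrbit F (k + 1) z|)
  have h7 := abs_le.1 (le_refl |step σ k z|)
  have h8 := abs_nonneg z.2.2
  constructor <;> linarith

variable [MeasurableMul₂ G] [MeasurableSMul₂ G X]

namespace PerturbedSystem

variable {μ : Measure G} [IsProbabilityMeasure μ] {ρ : Measure (X × ℝ)} [IsFiniteMeasure ρ]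
  {σ : G → X → ℝ} {a C B M : ℝ} {p : ℕ} {F : ℕ → (ℕ → G) × X → ℝ} {θ : (ℕ → G) → ℝ}

omit [MeasurableMul₂ G] [MeasurableSMul₂ G X] [IsProbabilityMeasure μ] [IsFiniteMeasure ρ] in
theorem weight_nonneg (h : PerturbedSystem μ ρ σ a C B F θ) (k : ℕ) (z : (ℕ → G) × (X × ℝ)) :
    0 ≤ aliveWeight σ F θ k z := Set.indicator_nonneg (fun _ _ => h.θ_nonneg _) _

omit [MeasurableMul₂ G] [MeasurableSMul₂ G X] [IsProbabilityMeasure μ] [IsFiniteMeasure ρ] in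
theorem B_nonneg (h : PerturbedSystem μ ρ σ a C B F θ) : 0 ≤ B :=
  (h.θ_nonneg fun _ => 1).trans (h.θ_le _)

omit [MeasurableMul₂ G] [MeasurableSMul₂ G X] [IsProbabilityMeasure μ] [IsFiniteMeasure ρ] in
theorem weight_le (h : PerturbedSystem μ ρ σ a C B F θ) (k : ℕ) (z : (ℕ → G) × (X × ℝ)) :
    aliveWeight σ F θ k z ≤ B :=
  Set.indicator_apply_le' (fun _ => h.θ_le _) fun _ => h.B_nonneg

omit [MeasurableMul₂ G] [MeasurableSMul₂ G X] [IsProbabilityMeasure μ] [IsFiniteMeasure ρ] in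
theorem weight_anti (h : PerturbedSystem μ ρ σ a C B F θ) {k l : ℕ} (hkl : k ≤ l)
    (z : (ℕ → G) × (X × ℝ)) : aliveWeight σ F θ l z ≤ aliveWeight σ F θ k z :=
  Set.indicator_le_indicator_of_subset (alive_anti hkl) (fun _ => h.θ_nonneg _) z

theorem measurable_weight (h : PerturbedSystem μ ρ σ a C B F θ) (hσ : CenteredCocycle μ σ M)
    (k : ℕ) : Measurable (aliveWeight σ F θ k) :=
  measurable_aliveWeight hσ.measurable h.measurable_F h.measurable_θ k

/-- Multiplication by a weight preserves integrability. -/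
theorem integrable_weight_mul (h : PerturbedSystem μ ρ σ a C B F θ) (hσ : CenteredCocycle μ σ M)
    (k : ℕ) {g : (ℕ → G) × (X × ℝ) → ℝ} (hg : Integrable g ((pathLaw μ).prod ρ)) :
    Integrable (fun z => aliveWeight σ F θ k z * g z) ((pathLaw μ).prod ρ) :=
  hg.bdd_mul (h.measurable_weight hσ k).aestronglyMeasurable (c := B)
    (ae_of_all _ fun z => by
      rw [Real.norm_of_nonneg (h.weight_nonneg k z)]
      exact h.weight_le k z)

theorem integrable_weight (h : PerturbedSystem μ ρ σ a C B F θ) (hσ : CenteredCocycle μ σ M)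
    (k : ℕ) : Integrable (aliveWeight σ F θ k) ((pathLaw μ).prod ρ) := by
  simpa using h.integrable_weight_mul hσ k (integrable_const (μ := ((pathLaw μ).prod ρ)) (1 : ℝ))

omit [MeasurableMul₂ G] [MeasurableSMul₂ G X] [IsProbabilityMeasure μ] [IsFiniteMeasure ρ] in
theorem mass_nonneg (h : PerturbedSystem μ ρ σ a C B F θ) (k : ℕ) :
    0 ≤ aliveMass μ ρ σ F θ k := integral_nonneg fun z => h.weight_nonneg k z

theorem mass_anti (h : PerturbedSystem μ ρ σ a C B F θ) (hσ : CenteredCocycle μ σ M) :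
    Antitone (aliveMass μ ρ σ F θ) := fun _ _ hkl =>
  integral_mono (h.integrable_weight hσ _) (h.integrable_weight hσ _) fun z => h.weight_anti hkl z

theorem memLp_walk (h : PerturbedSystem μ ρ σ a C B F θ) (hσ : CenteredCocycle μ σ M)
    (ha : 0 < a) (k : ℕ) :
    MemLp (fun z : (ℕ → G) × (X × ℝ) => walk σ z.2.1 k z.1) 2 ((pathLaw μ).prod ρ) := by
  induction k with
  | zero =>
    simp only [hσ.cocycle.walk_zero]
    exact memLp_const 0
  | succ k ih =>
    simp only [walk_succ_eq hσ.cocycle]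
    exact ih.add ((h.exp_step k).memLp_two ha)

theorem memLp_height (h : PerturbedSystem μ ρ σ a C B F θ) (hσ : CenteredCocycle μ σ M)
    (ha : 0 < a) (k : ℕ) : MemLp (height σ F k) 2 ((pathLaw μ).prod ρ) :=
  (((h.exp_start.memLp_two ha).add (h.memLp_walk hσ ha k)).add
    ((h.exp_orbit k).memLp_two ha)).sub ((h.exp_orbit 0).memLp_two ha)

theorem integrable_walk (h : PerturbedSystem μ ρ σ a C B F θ) (hσ : CenteredCocycle μ σ M)
    (ha : 0 < a) (k : ℕ) :
    Integrable (fun z : (ℕ → G) × (X × ℝ) => walk σ z.2.1 k z.1) ((pathLaw μ).prod ρ) :=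
  (h.memLp_walk hσ ha k).integrable one_le_two

omit [MeasurableMul₂ G] [MeasurableSMul₂ G X] in
/-- Against a bounded weight, the gap is of order `p L`. -/
theorem integral_mul_gap_le (h : PerturbedSystem μ ρ σ a C B F θ) (p : ℕ) (ha : 0 < a) (hC : 0 ≤ C)
    {w : (ℕ → G) × (X × ℝ) → ℝ} (hw : Integrable w ((pathLaw μ).prod ρ))
    (hw0 : ∀ z, 0 ≤ w z) (hwB : ∀ z, w z ≤ B) (k : ℕ) (L : ℝ) :
    Integrable (fun z => w z * gap σ F p k z) ((pathLaw μ).prod ρ) ∧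
    ∫ z, w z * gap σ F p k z ∂((pathLaw μ).prod ρ) ≤
      (p + 9) * (L * ∫ z, w z ∂((pathLaw μ).prod ρ) + truncErr a C B L) := by
  have hint : ∀ {g : (ℕ → G) × (X × ℝ) → ℝ}, ExpBounded ((pathLaw μ).prod ρ) a C g →
      Integrable (fun z => w z * |g z|) ((pathLaw μ).prod ρ) := fun hg =>
    (((hg.memLp_two ha).integrable one_le_two).abs).bdd_mul hw.aestronglyMeasurable (c := B)
      (ae_of_all _ fun z => by
        rw [Real.norm_of_nonneg (hw0 z)]
        exact hwB z)
  have hle : ∀ {g : (ℕ → G) × (X × ℝ) → ℝ}, ExpBounded ((pathLaw μ).prod ρ) a C g →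
      ∫ z, w z * |g z| ∂((pathLaw μ).prod ρ) ≤
        L * ∫ z, w z ∂((pathLaw μ).prod ρ) + truncErr a C B L := fun hg =>
    hg.integral_mul_abs_le ha hC h.B_nonneg hw hw0 hwB L
  have hexp : (fun z => w z * gap σ F p k z) = fun z =>
      2 * (w z * |z.2.2|) + ∑ i ∈ Finset.range (p + 1), w z * |step σ (k + i) z| +
        2 * (w z * |alongOrbit F (k + 1) z|) + 2 * (w z * |alongOrbit F k z|) +
        2 * (w z * |alongOrbit F 0 z|) := by
    funext z
    rw [gap, ← Finset.mul_sum]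
    ring
  have i1 := (hint h.exp_start).const_mul 2
  have i2 : Integrable (fun z => ∑ i ∈ Finset.range (p + 1), w z * |step σ (k + i) z|)
      ((pathLaw μ).prod ρ) :=
    integrable_finsetSum _ fun i _ => hint (h.exp_step (k + i))
  have i3 := (hint (h.exp_orbit (k + 1))).const_mul 2
  have i4 := (hint (h.exp_orbit k)).const_mul 2
  have i5 := (hint (h.exp_orbit 0)).const_mul 2
  have i12 : Integrable (fun z => 2 * (w z * |z.2.2|) +
      ∑ i ∈ Finset.range (p + 1), w z * |step σ (k + i) z|) ((pathLaw μ).prod ρ) := i1.add i2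
  have i123 : Integrable (fun z => 2 * (w z * |z.2.2|) +
      ∑ i ∈ Finset.range (p + 1), w z * |step σ (k + i) z| +
        2 * (w z * |alongOrbit F (k + 1) z|)) ((pathLaw μ).prod ρ) := i12.add i3
  have i1234 : Integrable (fun z => 2 * (w z * |z.2.2|) +
      ∑ i ∈ Finset.range (p + 1), w z * |step σ (k + i) z| +
        2 * (w z * |alongOrbit F (k + 1) z|) + 2 * (w z * |alongOrbit F k z|))
      ((pathLaw μ).prod ρ) := i123.add i4
  rw [hexp]
  refine ⟨i1234.add i5, ?_⟩
  rw [integral_add i1234 i5, integral_add i123 i4, integral_add i12 i3, integral_add i1 i2,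
    integral_const_mul, integral_const_mul, integral_const_mul, integral_const_mul,
    integral_finsetSum _ fun i _ => hint (h.exp_step (k + i))]
  have hsum : ∑ i ∈ Finset.range (p + 1), ∫ z, w z * |step σ (k + i) z| ∂((pathLaw μ).prod ρ) ≤
      (p + 1) * (L * ∫ z, w z ∂((pathLaw μ).prod ρ) + truncErr a C B L) := by
    refine (Finset.sum_le_card_nsmul _ _ _ fun i _ => hle (h.exp_step (k + i))).trans ?_
    rw [Finset.card_range, nsmul_eq_mul]
    push_cast
    exact le_rfl
  have h1 := hle h.exp_start
  have h3 := hle (h.exp_orbit (k + 1))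
  have h4 := hle (h.exp_orbit k)
  have h5 := hle (h.exp_orbit 0)
  linarith

/-- The second moment of the walk against a past weight grows at most by `M` times the weight. -/
theorem integral_mul_walk_succ_sq_le (h : PerturbedSystem μ ρ σ a C B F θ)
    (hσ : CenteredCocycle μ σ M) (ha : 0 < a) (j : ℕ) {w : (ℕ → G) × (X × ℝ) → ℝ}
    (hw : IsPast j w) (hwm : Measurable w) (hw0 : ∀ z, 0 ≤ w z) (hwB : ∀ z, w z ≤ B) :
    ∫ z, w z * walk σ z.2.1 (j + 1) z.1 ^ 2 ∂((pathLaw μ).prod ρ) ≤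
      ∫ z, w z * walk σ z.2.1 j z.1 ^ 2 ∂((pathLaw μ).prod ρ) +
        M * ∫ z, w z ∂((pathLaw μ).prod ρ) := by
  have hbd : ∀ {g : (ℕ → G) × (X × ℝ) → ℝ}, Integrable g ((pathLaw μ).prod ρ) →
      Integrable (fun z => w z * g z) ((pathLaw μ).prod ρ) := fun hg =>
    hg.bdd_mul hwm.aestronglyMeasurable (c := B) (ae_of_all _ fun z => by
      rw [Real.norm_of_nonneg (hw0 z)]
      exact hwB z)
  have hwi : Integrable w ((pathLaw μ).prod ρ) := by simpa using hbd (integrable_const (1 : ℝ))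
  have m1 := h.memLp_walk hσ ha j
  have m2 := (h.exp_step j).memLp_two ha
  have i1 := hbd m1.integrable_sq
  have i2 := hbd m2.integrable_sq
  have i3 : Integrable (fun z => w z * walk σ z.2.1 j z.1 * step σ j z) ((pathLaw μ).prod ρ) := by
    have := hbd (m1.integrable_mul m2)
    simpa only [Pi.mul_apply, mul_assoc] using this
  have hz := integral_mul_step_eq_zero hσ.measurable hσ.centered
    (hw.mul (isPast_walk j)) i3
  have hs := integral_mul_step_sq_le hσ.measurable hσ.sq_le hw hw0 hwi i2
  have hexp : (fun z : (ℕ → G) × (X × ℝ) => w z * walk σ z.2.1 (j + 1) z.1 ^ 2) = fun z =>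
      w z * walk σ z.2.1 j z.1 ^ 2 + 2 * (w z * walk σ z.2.1 j z.1 * step σ j z) +
        w z * step σ j z ^ 2 := by
    funext z
    rw [walk_succ_eq hσ.cocycle]
    ring
  have i13 : Integrable (fun z : (ℕ → G) × (X × ℝ) => w z * walk σ z.2.1 j z.1 ^ 2 +
      2 * (w z * walk σ z.2.1 j z.1 * step σ j z)) ((pathLaw μ).prod ρ) := i1.add (i3.const_mul 2)
  rw [hexp, integral_add i13 i2, integral_add i1 (i3.const_mul 2),
    integral_const_mul, hz]
  linarith

/-- The mean square of the walk grows at most linearly. -/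
theorem integral_walk_sq_le (h : PerturbedSystem μ ρ σ a C B F θ)
    (hσ : CenteredCocycle μ σ M) (ha : 0 < a) (j : ℕ) :
    ∫ z : (ℕ → G) × (X × ℝ), B * walk σ z.2.1 j z.1 ^ 2 ∂((pathLaw μ).prod ρ) ≤
      M * (B * ((pathLaw μ).prod ρ).real Set.univ * j) := by
  induction j with
  | zero => simp [hσ.cocycle.walk_zero]
  | succ j ih =>
    have h1 := h.integral_mul_walk_succ_sq_le hσ ha j (w := fun _ => B) (fun _ _ _ => rfl)
      measurable_const (fun _ => h.B_nonneg) fun _ => le_rfl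
    simp only [integral_const, smul_eq_mul] at h1
    push_cast
    linarith

end PerturbedSystem

namespace LookAheadSystem

variable {μ : Measure G} [IsProbabilityMeasure μ] {ρ : Measure (X × ℝ)} [IsFiniteMeasure ρ]
  {σ : G → X → ℝ} {a C B M : ℝ} {p : ℕ} {F : ℕ → (ℕ → G) × X → ℝ} {θ : (ℕ → G) → ℝ}

omit [MeasurableMul₂ G] [MeasurableSMul₂ G X] [IsProbabilityMeasure μ] [IsFiniteMeasure ρ] in
theorem isPast_weight (h : LookAheadSystem μ ρ σ a C B p F θ) (k : ℕ) :
    IsPast (k + p) (aliveWeight σ F θ k) := isPast_aliveWeight h.isPast_F h.past_θ k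

/-- The mean height and the mean of the walk `p` steps later differ by a multiple of `p L` times
the mass. -/
theorem abs_sub_aliveHeight_le (h : LookAheadSystem μ ρ σ a C B p F θ)
    (hσ : CenteredCocycle μ σ M) (ha : 0 < a) (hC : 0 ≤ C) (k : ℕ) (L : ℝ) :
    |∫ z, aliveWeight σ F θ k z * walk σ z.2.1 (k + p) z.1 ∂((pathLaw μ).prod ρ) -
        aliveHeight μ ρ σ F θ k| ≤
      (p + 9) * (L * aliveMass μ ρ σ F θ k + truncErr a C B L) := by
  obtain ⟨h1, h2⟩ := h.integral_mul_gap_le p ha hC (h.integrable_weight hσ k) (h.weight_nonneg k)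
    (h.weight_le k) k L
  rw [aliveHeight, ← integral_sub (h.integrable_weight_mul hσ k (h.integrable_walk hσ ha _))
    (h.integrable_weight_mul hσ k ((h.memLp_height hσ ha k).integrable one_le_two))]
  rw [← Real.norm_eq_abs]
  refine (norm_integral_le_of_norm_le h1 (ae_of_all _ fun z => ?_)).trans h2
  rw [← mul_sub, norm_mul, Real.norm_of_nonneg (h.weight_nonneg k z), Real.norm_eq_abs]
  exact mul_le_mul_of_nonneg_left (abs_walk_sub_height_le hσ.cocycle F p k z)
    (h.weight_nonneg k z)

/-- By the martingale property, the mean of the walk `p` steps after time `k` changes from `k` to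
`k + 1` only through the paths along which the perturbed walk becomes negative at time `k + 1`. -/
theorem abs_sub_le_of_succ (h : LookAheadSystem μ ρ σ a C B p F θ)
    (hσ : CenteredCocycle μ σ M) (ha : 0 < a) (hC : 0 ≤ C) (k : ℕ) (L : ℝ) :
    |∫ z, aliveWeight σ F θ (k + 1) z * walk σ z.2.1 (k + 1 + p) z.1 ∂((pathLaw μ).prod ρ) -
      ∫ z, aliveWeight σ F θ k z * walk σ z.2.1 (k + p) z.1 ∂((pathLaw μ).prod ρ)| ≤
      (p + 9) * (L * (aliveMass μ ρ σ F θ k - aliveMass μ ρ σ F θ (k + 1)) +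
        truncErr a C B L) := by
  have hwi := h.integrable_weight hσ k
  have hwi' := h.integrable_weight hσ (k + 1)
  obtain ⟨h1, h2⟩ := h.integral_mul_gap_le p ha hC (hwi.sub hwi')
    (fun z => sub_nonneg.2 (h.weight_anti (Nat.le_succ k) z))
    (fun z => by
      have h1 := h.weight_le k z
      have h2 := h.weight_nonneg (k + 1) z
      simp only [Pi.sub_apply]
      linarith) k L
  simp only [Pi.sub_apply] at h1 h2
  rw [integral_sub hwi hwi'] at h2
  have hkp : k + 1 + p = k + p + 1 := by omega
  have hzero : ∫ z, aliveWeight σ F θ k z * step σ (k + p) z ∂((pathLaw μ).prod ρ) = 0 :=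
    integral_mul_step_eq_zero hσ.measurable hσ.centered (h.isPast_weight k)
      (h.integrable_weight_mul hσ k (((h.exp_step _).memLp_two ha).integrable one_le_two))
  have hb : ∫ z, aliveWeight σ F θ k z * walk σ z.2.1 (k + 1 + p) z.1 ∂((pathLaw μ).prod ρ) =
      ∫ z, aliveWeight σ F θ k z * walk σ z.2.1 (k + p) z.1 ∂((pathLaw μ).prod ρ) := by
    simp only [hkp, walk_succ_eq hσ.cocycle, mul_add]
    rw [integral_add (h.integrable_weight_mul hσ k (h.integrable_walk hσ ha _))
      (h.integrable_weight_mul hσ k (((h.exp_step _).memLp_two ha).integrable one_le_two)), hzero,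
      add_zero]
  rw [← hb, ← integral_sub (h.integrable_weight_mul hσ _ (h.integrable_walk hσ ha _))
    (h.integrable_weight_mul hσ k (h.integrable_walk hσ ha _))]
  rw [← Real.norm_eq_abs]
  refine (norm_integral_le_of_norm_le h1 (ae_of_all _ fun z => ?_)).trans h2
  rw [← sub_mul, norm_mul, Real.norm_eq_abs, Real.norm_eq_abs, abs_sub_comm,
    abs_of_nonneg (sub_nonneg.2 (h.weight_anti (Nat.le_succ k) z))]
  by_cases hz : z ∈ alive σ F k ∧ z ∉ alive σ F (k + 1)
  · exact mul_le_mul_of_nonneg_left (abs_walk_le_of_exit hσ.cocycle p hz.1 hz.2)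
      (sub_nonneg.2 (h.weight_anti (Nat.le_succ k) z))
  · have heq : aliveWeight σ F θ k z - aliveWeight σ F θ (k + 1) z = 0 := by
      simp only [aliveWeight, Set.indicator]
      by_cases h1 : z ∈ alive σ F (k + 1)
      · rw [if_pos h1, if_pos (alive_anti (Nat.le_succ k) h1), sub_self]
      · have h2 : z ∉ alive σ F k := fun h2 => hz ⟨h2, h1⟩
        rw [if_neg h1, if_neg h2, sub_self]
    rw [heq, zero_mul, zero_mul]

theorem abs_aliveHeight_sub_le (h : LookAheadSystem μ ρ σ a C B p F θ)
    (hσ : CenteredCocycle μ σ M) (ha : 0 < a) (hC : 0 ≤ C) {m n : ℕ} (hmn : m ≤ n) {L : ℝ}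
    (hL : 0 ≤ L) :
    |aliveHeight μ ρ σ F θ n - aliveHeight μ ρ σ F θ m| ≤
      (p + 9) * (3 * L * aliveMass μ ρ σ F θ m + (n + 2) * truncErr a C B L) := by
  set b : ℕ → ℝ := fun k =>
    ∫ z, aliveWeight σ F θ k z * walk σ z.2.1 (k + p) z.1 ∂((pathLaw μ).prod ρ) with hb
  set q := aliveMass μ ρ σ F θ with hq
  have hE : 0 ≤ truncErr a C B L := by
    have := h.B_nonneg
    unfold truncErr
    positivity
  have hbn : |b n - b m| ≤ (p + 9) * (L * (q m - q n) + (n - m) * truncErr a C B L) := by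
    induction n, hmn using Nat.le_induction with
    | base => simp
    | succ n hmn ih =>
      have h1 := h.abs_sub_le_of_succ hσ ha hC n L
      calc |b (n + 1) - b m| ≤ |b (n + 1) - b n| + |b n - b m| := abs_sub_le _ _ _
        _ ≤ (p + 9) * (L * (q n - q (n + 1)) + truncErr a C B L) +
            (p + 9) * (L * (q m - q n) + (n - m) * truncErr a C B L) := add_le_add h1 ih
        _ = _ := by push_cast; ring
  have h1 := h.abs_sub_aliveHeight_le hσ ha hC n L
  have h2 := h.abs_sub_aliveHeight_le hσ ha hC m L
  rw [abs_sub_comm] at h1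
  have hqn : q n ≤ q m := h.mass_anti hσ hmn
  have hqn0 : 0 ≤ q n := h.mass_nonneg n
  calc |aliveHeight μ ρ σ F θ n - aliveHeight μ ρ σ F θ m|
      ≤ |aliveHeight μ ρ σ F θ n - b n| + |b n - aliveHeight μ ρ σ F θ m| := abs_sub_le _ _ _
    _ ≤ |aliveHeight μ ρ σ F θ n - b n| + (|b n - b m| + |b m - aliveHeight μ ρ σ F θ m|) := by
        gcongr
        exact abs_sub_le _ _ _
    _ ≤ (p + 9) * (L * q n + truncErr a C B L) +
          ((p + 9) * (L * (q m - q n) + (n - m) * truncErr a C B L) +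
          (p + 9) * (L * q m + truncErr a C B L)) := add_le_add h1 (add_le_add hbn h2)
    _ = (p + 9) * (2 * L * q m + (n - m + 2) * truncErr a C B L) := by ring
    _ ≤ _ := by
        have hm0 : (0 : ℝ) ≤ m := Nat.cast_nonneg m
        have hq0 : 0 ≤ q m := h.mass_nonneg m
        gcongr
        · linarith
        · linarith

/-- The second moment of the walk on survival grows at most by the mass at each step. -/
theorem integral_weight_mul_walk_sq_le (h : LookAheadSystem μ ρ σ a C B p F θ)
    (hσ : CenteredCocycle μ σ M) (ha : 0 < a) (m : ℕ) :
    ∫ z, aliveWeight σ F θ m z * walk σ z.2.1 (m + p) z.1 ^ 2 ∂((pathLaw μ).prod ρ) ≤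
      M * (B * ((pathLaw μ).prod ρ).real Set.univ * p +
        ∑ k ∈ Finset.range m, aliveMass μ ρ σ F θ k) := by
  induction m with
  | zero =>
    simp only [Finset.range_zero, Finset.sum_empty, add_zero, zero_add]
    refine le_trans (integral_mono ?_ ?_ fun z => ?_) (h.integral_walk_sq_le hσ ha p)
    · exact h.integrable_weight_mul hσ 0 (h.memLp_walk hσ ha p).integrable_sq
    · exact (h.memLp_walk hσ ha p).integrable_sq.const_mul B
    · exact mul_le_mul_of_nonneg_right (h.weight_le 0 z) (sq_nonneg _)
  | succ m ih =>
    have h1 := h.integral_mul_walk_succ_sq_le hσ ha (m + p) (h.isPast_weight m)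
      (h.measurable_weight hσ m) (h.weight_nonneg m) (h.weight_le m)
    have h2 : ∫ z, aliveWeight σ F θ (m + 1) z * walk σ z.2.1 (m + 1 + p) z.1 ^ 2
          ∂((pathLaw μ).prod ρ) ≤
        ∫ z, aliveWeight σ F θ m z * walk σ z.2.1 (m + p + 1) z.1 ^ 2 ∂((pathLaw μ).prod ρ) := by
      have hmp : m + 1 + p = m + p + 1 := by omega
      rw [hmp]
      refine integral_mono ?_ ?_ fun z => ?_
      · exact h.integrable_weight_mul hσ _ (h.memLp_walk hσ ha _).integrable_sq
      · exact h.integrable_weight_mul hσ _ (h.memLp_walk hσ ha _).integrable_sq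
      · exact mul_le_mul_of_nonneg_right (h.weight_anti (Nat.le_succ m) z) (sq_nonneg _)
    rw [Finset.sum_range_succ]
    have h3 : ∫ z, aliveWeight σ F θ m z ∂((pathLaw μ).prod ρ) = aliveMass μ ρ σ F θ m := rfl
    rw [h3] at h1
    linarith

end LookAheadSystem

end LookAhead

section LookAhead

variable {G X : Type*} [Group G] [MulAction G X] [MeasurableSpace G] [MeasurableSpace X]
variable [MeasurableMul₂ G] [MeasurableSMul₂ G X]

/-- The event that one of the variables which govern the perturbed walk up to time `n` exceeds
`L` in absolute value. -/
def largeValues (σ : G → X → ℝ) (F : ℕ → (ℕ → G) × X → ℝ) (n : ℕ) (L : ℝ) :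
    Set ((ℕ → G) × (X × ℝ)) :=
  {z | L < |z.2.2|} ∪ ((⋃ k ∈ Finset.range (n + 1), {z | L < |alongOrbit F k z|}) ∪
    ⋃ i ∈ Finset.range n, {z | L < |step σ i z|})

omit [MeasurableSpace G] [MeasurableSpace X] [MeasurableMul₂ G] [MeasurableSMul₂ G X] in
theorem notMem_largeValues {σ : G → X → ℝ} {F : ℕ → (ℕ → G) × X → ℝ} {n : ℕ} {L : ℝ}
    {z : (ℕ → G) × (X × ℝ)} (hz : z ∉ largeValues σ F n L) :
    |z.2.2| ≤ L ∧ (∀ k ≤ n, |alongOrbit F k z| ≤ L) ∧ ∀ i < n, |step σ i z| ≤ L := by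
  simp only [largeValues, Set.mem_union, Set.mem_iUnion, Finset.mem_range, Set.mem_ofPred_eq,
    exists_prop, not_or, not_exists, not_and, not_lt] at hz
  exact ⟨hz.1, fun k hk => hz.2.1 k (by omega), fun i hi => hz.2.2 i hi⟩

namespace LookAheadSystem

variable {μ : Measure G} [IsProbabilityMeasure μ] {ρ : Measure (X × ℝ)} [IsFiniteMeasure ρ]
  {σ : G → X → ℝ} {a C B M : ℝ} {p : ℕ} {F : ℕ → (ℕ → G) × X → ℝ} {θ : (ℕ → G) → ℝ}

theorem measurableSet_largeValues (h : LookAheadSystem μ ρ σ a C B p F θ) (n : ℕ) (L : ℝ) :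
    MeasurableSet (largeValues σ F n L) := by
  have h1 : ∀ {g : (ℕ → G) × (X × ℝ) → ℝ}, ExpBounded ((pathLaw μ).prod ρ) a C g →
      MeasurableSet {z | L < |g z|} := fun hg =>
    measurableSet_lt measurable_const (measurable_norm.comp hg.measurable)
  exact (h1 h.exp_start).union ((Finset.measurableSet_biUnion _ fun k _ => h1 (h.exp_orbit k)).union
    (Finset.measurableSet_biUnion _ fun i _ => h1 (h.exp_step i)))

theorem measureReal_largeValues_le (h : LookAheadSystem μ ρ σ a C B p F θ) (ha : 0 < a)
    (hC : 0 ≤ C) (n : ℕ) (L : ℝ) :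
    ((pathLaw μ).prod ρ).real (largeValues σ F n L) ≤
      (2 * n + 2) * (C * Real.exp (-(a * L))) := by
  have h1 := h.exp_start.measureReal_lt_abs_le ha hC L
  have h2 : ((pathLaw μ).prod ρ).real
      (⋃ k ∈ Finset.range (n + 1), {z | L < |alongOrbit F k z|}) ≤
      (n + 1) * (C * Real.exp (-(a * L))) := by
    refine (measureReal_biUnion_finset_le _ _).trans ((Finset.sum_le_card_nsmul _ _ _ fun k _ =>
      (h.exp_orbit k).measureReal_lt_abs_le ha hC L).trans ?_)
    rw [Finset.card_range, nsmul_eq_mul]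
    push_cast
    exact le_rfl
  have h3 : ((pathLaw μ).prod ρ).real (⋃ i ∈ Finset.range n, {z | L < |step σ i z|}) ≤
      n * (C * Real.exp (-(a * L))) := by
    refine (measureReal_biUnion_finset_le _ _).trans ((Finset.sum_le_card_nsmul _ _ _ fun k _ =>
      (h.exp_step k).measureReal_lt_abs_le ha hC L).trans ?_)
    rw [Finset.card_range, nsmul_eq_mul]
  have h4 := measureReal_union_le (μ := (pathLaw μ).prod ρ) {z | L < |z.2.2|}
    ((⋃ k ∈ Finset.range (n + 1), {z | L < |alongOrbit F k z|}) ∪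
      ⋃ i ∈ Finset.range n, {z | L < |step σ i z|})
  have h5 := measureReal_union_le (μ := (pathLaw μ).prod ρ)
    (⋃ k ∈ Finset.range (n + 1), {z | L < |alongOrbit F k z|})
    (⋃ i ∈ Finset.range n, {z | L < |step σ i z|})
  unfold largeValues
  linarith

/-- Upper bound for the mass at time `n = N + m + p` in terms of the height at time `m`: at time
`m + p` the past is forgotten, and the walk has to stay nonnegative for `N` further steps, up to a
shift of its starting height by `3 L`. -/
theorem mass_upper (h : LookAheadSystem μ ρ σ a C B p F θ) (hσ : CenteredCocycle μ σ M)
    (ha : 0 < a) (hC : 0 ≤ C) {m n N : ℕ} (hm : 1 ≤ m) (hn : N + m + p = n) {L : ℝ} (hL : 0 ≤ L)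
    {s D : ℝ} (hs : 0 ≤ s) (hstay : ∀ x y, s * stayProb μ σ N x y ≤ max y 0 + D) :
    s * aliveMass μ ρ σ F θ n ≤ aliveHeight μ ρ σ F θ m +
      (p + 9) * (L * aliveMass μ ρ σ F θ m + truncErr a C B L) +
      (3 * L + D) * aliveMass μ ρ σ F θ m +
      s * B * ((2 * n + 2) * (C * Real.exp (-(a * L)))) := by
  set E : Set ((ℕ → G) × (X × ℝ)) := {z | ∀ i ≤ N, 0 ≤ walk σ z.2.1 (m + p) z.1 + 3 * L +
        walk σ (leftProd z.1 (m + p) • z.2.1) i (dropPath (m + p) z.1)} with hE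
  set Bd := largeValues σ F n L with hBd
  have hBdm : MeasurableSet Bd := h.measurableSet_largeValues n L
  have hwm := h.integrable_weight hσ m
  obtain ⟨hi, heq⟩ := integral_mul_indicator_stay hσ.measurable N (m + p) (3 * L)
    (h.isPast_weight m) hwm
  have hpt : ∀ z, aliveWeight σ F θ n z ≤
      E.indicator (aliveWeight σ F θ m) z + Bd.indicator (fun _ => B) z := by
    intro z
    have hE0 : 0 ≤ E.indicator (aliveWeight σ F θ m) z :=
      Set.indicator_nonneg (fun z _ => h.weight_nonneg m z) z
    by_cases hz : z ∈ Bd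
    · rw [Set.indicator_of_mem hz]
      linarith [h.weight_le n z]
    rw [Set.indicator_of_notMem hz, add_zero]
    by_cases hal : z ∈ alive σ F n
    · have hzE : z ∈ E := by
        intro i hi
        obtain ⟨h1, h2, -⟩ := notMem_largeValues hz
        have h3 := hal (m + p + i) (by omega) (by omega)
        rw [height_eq, hσ.cocycle.walk_add] at h3
        have h4 := abs_le.1 (h2 (m + p + i) (by omega))
        have h5 := abs_le.1 (h2 0 (by omega))
        have h6 := abs_le.1 h1
        linarith
      rw [Set.indicator_of_mem hzE, aliveWeight, aliveWeight, Set.indicator_of_mem hal,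
        Set.indicator_of_mem (alive_anti (by omega : m ≤ n) hal)]
    · rw [aliveWeight, Set.indicator_of_notMem hal]
      exact hE0
  have hEm : Integrable (E.indicator (aliveWeight σ F θ m)) ((pathLaw μ).prod ρ) := by
    refine hwm.indicator ?_
    have : E = ⋂ i ∈ Finset.range (N + 1), {z | 0 ≤ walk σ z.2.1 (m + p) z.1 + 3 * L +
        walk σ (leftProd z.1 (m + p) • z.2.1) i (dropPath (m + p) z.1)} := by
      ext z; simp [hE]
    rw [this]
    refine Finset.measurableSet_biInter _ fun i _ => measurableSet_le measurable_const
      (((measurable_walk' hσ.measurable (m + p)).add_const _).add ?_)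
    exact (measurable_walk hσ.measurable i).comp (((measurable_dropPath _).comp
      measurable_fst).prodMk (((measurable_leftProd _).comp measurable_fst).smul
        (measurable_fst.comp measurable_snd)))
  have hBi : Integrable (Bd.indicator fun _ => B) ((pathLaw μ).prod ρ) :=
    (integrable_const B).indicator hBdm
  have hq : aliveMass μ ρ σ F θ n ≤ ∫ z, aliveWeight σ F θ m z *
      stayProb μ σ N (leftProd z.1 (m + p) • z.2.1) (walk σ z.2.1 (m + p) z.1 + 3 * L)
        ∂((pathLaw μ).prod ρ) + B * ((2 * n + 2) * (C * Real.exp (-(a * L)))) := by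
    rw [← heq]
    refine (integral_mono (h.integrable_weight hσ n) (hEm.add hBi) hpt).trans ?_
    rw [integral_add' hEm hBi, integral_indicator hBdm, setIntegral_const, smul_eq_mul,
      mul_comm _ B]
    have := h.measureReal_largeValues_le ha hC n L
    have := h.B_nonneg
    gcongr
  obtain ⟨hgi, hgap⟩ := h.integral_mul_gap_le p ha hC hwm (h.weight_nonneg m) (h.weight_le m) m L
  have hhi := h.integrable_weight_mul hσ m ((h.memLp_height hσ ha m).integrable one_le_two)
  have hR : Integrable (fun z => aliveWeight σ F θ m z * height σ F m z +
      aliveWeight σ F θ m z * gap σ F p m z) ((pathLaw μ).prod ρ) := hhi.add hgi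
  have hR2 := hwm.const_mul (3 * L + D)
  have hmain : s * ∫ z, aliveWeight σ F θ m z *
      stayProb μ σ N (leftProd z.1 (m + p) • z.2.1) (walk σ z.2.1 (m + p) z.1 + 3 * L)
        ∂((pathLaw μ).prod ρ) ≤ aliveHeight μ ρ σ F θ m +
      (p + 9) * (L * aliveMass μ ρ σ F θ m + truncErr a C B L) +
      (3 * L + D) * aliveMass μ ρ σ F θ m := by
    rw [← integral_const_mul]
    refine (integral_mono (hi.const_mul s) (hR.add hR2) fun z => ?_).trans ?_
    · have hw0 := h.weight_nonneg m z
      have h1 := hstay (leftProd z.1 (m + p) • z.2.1) (walk σ z.2.1 (m + p) z.1 + 3 * L)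
      by_cases hal : z ∈ alive σ F m
      · have h2 := abs_le.1 (abs_walk_sub_height_le hσ.cocycle F p m z)
        have h3 := hal m hm le_rfl
        have h4 : max (walk σ z.2.1 (m + p) z.1 + 3 * L) 0 ≤
            height σ F m z + gap σ F p m z + 3 * L := max_le (by linarith) (by linarith)
        simp only [Pi.add_apply]
        calc _ = aliveWeight σ F θ m z * (s * stayProb μ σ N (leftProd z.1 (m + p) • z.2.1)
                (walk σ z.2.1 (m + p) z.1 + 3 * L)) := by ring
          _ ≤ aliveWeight σ F θ m z * (height σ F m z + gap σ F p m z + 3 * L + D) :=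
              mul_le_mul_of_nonneg_left (by linarith) hw0
          _ = _ := by ring
      · have : aliveWeight σ F θ m z = 0 := Set.indicator_of_notMem hal _
        simp [this]
    · rw [integral_add' hR hR2, integral_add hhi hgi, integral_const_mul]
      exact add_le_add (add_le_add le_rfl hgap) le_rfl
  calc s * aliveMass μ ρ σ F θ n ≤ s * _ := mul_le_mul_of_nonneg_left hq hs
    _ = s * ∫ z, aliveWeight σ F θ m z *
      stayProb μ σ N (leftProd z.1 (m + p) • z.2.1) (walk σ z.2.1 (m + p) z.1 + 3 * L)
        ∂((pathLaw μ).prod ρ) + s * B * ((2 * n + 2) * (C * Real.exp (-(a * L)))) := by ring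
    _ ≤ _ := by linarith

/-- Lower bound for the mass at time `n = N + m + p` in terms of the height at time `m`. -/
theorem mass_lower (h : LookAheadSystem μ ρ σ a C B p F θ) (hσ : CenteredCocycle μ σ M)
    (ha : 0 < a) (hC : 0 ≤ C) {m n N : ℕ} (hn : N + m + p = n) {L : ℝ} (hL : 0 ≤ L)
    {s D K : ℝ} (hs : 0 ≤ s) (hK : 0 ≤ K)
    (hstay : ∀ x y, y - D - K * y ^ 2 ≤ s * stayProb μ σ N x y) :
    aliveHeight μ ρ σ F θ m - (p + 9) * (L * aliveMass μ ρ σ F θ m + truncErr a C B L) -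
      ((p + 3) * L + D + 2 * K * ((p + 3) * L) ^ 2) * aliveMass μ ρ σ F θ m -
      2 * K * ∫ z, aliveWeight σ F θ m z * walk σ z.2.1 (m + p) z.1 ^ 2 ∂((pathLaw μ).prod ρ) -
      s * B * ((2 * n + 2) * (C * Real.exp (-(a * L)))) ≤ s * aliveMass μ ρ σ F θ n := by
  set c : ℝ := -((p + 3) * L) with hc
  set E : Set ((ℕ → G) × (X × ℝ)) := {z | ∀ i ≤ N, 0 ≤ walk σ z.2.1 (m + p) z.1 + c +
        walk σ (leftProd z.1 (m + p) • z.2.1) i (dropPath (m + p) z.1)} with hE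
  set Bd := largeValues σ F n L with hBd
  have hBdm : MeasurableSet Bd := h.measurableSet_largeValues n L
  have hwm := h.integrable_weight hσ m
  obtain ⟨hi, heq⟩ := integral_mul_indicator_stay hσ.measurable N (m + p) c
    (h.isPast_weight m) hwm
  have hpt : ∀ z, E.indicator (aliveWeight σ F θ m) z ≤
      aliveWeight σ F θ n z + Bd.indicator (fun _ => B) z := by
    intro z
    have hB := h.B_nonneg
    have hn0 := h.weight_nonneg n z
    by_cases hz : z ∈ Bd
    · rw [Set.indicator_of_mem hz]
      have : E.indicator (aliveWeight σ F θ m) z ≤ B :=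
        Set.indicator_apply_le' (fun _ => h.weight_le m z) fun _ => hB
      linarith
    rw [Set.indicator_of_notMem hz, add_zero]
    by_cases hzE : z ∈ E
    swap
    · rw [Set.indicator_of_notMem hzE]
      exact hn0
    by_cases hal : z ∈ alive σ F m
    swap
    · rw [Set.indicator_of_mem hzE, aliveWeight, Set.indicator_of_notMem hal]
      exact hn0
    have haln : z ∈ alive σ F n := by
      intro k hk1 hkn
      rcases le_or_gt k m with hkm | hkm
      · exact hal k hk1 hkm
      obtain ⟨h1, h2, h3⟩ := notMem_largeValues hz
      have h4 := abs_le.1 (h2 k hkn)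
      have h5 := abs_le.1 (h2 0 (by omega))
      have h6 := abs_le.1 h1
      have hwalk : 3 * L ≤ walk σ z.2.1 k z.1 := by
        rcases le_or_gt (m + p) k with hj | hj
        · have h7 := hzE (k - (m + p)) (by omega)
          have h8 := hσ.cocycle.walk_add z.2.1 (m + p) (k - (m + p)) z.1
          rw [Nat.add_sub_cancel' hj] at h8
          have h9 : (0 : ℝ) ≤ p * L := by positivity
          rw [h8]
          linarith
        · have h7 := hzE 0 (Nat.zero_le _)
          rw [hσ.cocycle.walk_zero] at h7
          have h8 := walk_add_eq_sum hσ.cocycle k (m + p - k) z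
          rw [Nat.add_sub_cancel' hj.le] at h8
          have h9 : ∑ i ∈ Finset.range (m + p - k), step σ (k + i) z ≤ p * L := by
            refine (Finset.sum_le_card_nsmul _ _ L fun i hi => ?_).trans ?_
            · have := Finset.mem_range.1 hi
              exact (abs_le.1 (h3 (k + i) (by omega))).2
            · rw [Finset.card_range, nsmul_eq_mul]
              gcongr
              omega
          linarith
      rw [height_eq]
      linarith
    rw [Set.indicator_of_mem hzE, aliveWeight, aliveWeight, Set.indicator_of_mem hal,
      Set.indicator_of_mem haln]
  have hEm : Integrable (E.indicator (aliveWeight σ F θ m)) ((pathLaw μ).prod ρ) := by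
    refine hwm.indicator ?_
    have : E = ⋂ i ∈ Finset.range (N + 1), {z | 0 ≤ walk σ z.2.1 (m + p) z.1 + c +
        walk σ (leftProd z.1 (m + p) • z.2.1) i (dropPath (m + p) z.1)} := by
      ext z; simp [hE]
    rw [this]
    refine Finset.measurableSet_biInter _ fun i _ => measurableSet_le measurable_const
      (((measurable_walk' hσ.measurable (m + p)).add_const _).add ?_)
    exact (measurable_walk hσ.measurable i).comp (((measurable_dropPath _).comp
      measurable_fst).prodMk (((measurable_leftProd _).comp measurable_fst).smul
        (measurable_fst.comp measurable_snd)))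
  have hBi : Integrable (Bd.indicator fun _ => B) ((pathLaw μ).prod ρ) :=
    (integrable_const B).indicator hBdm
  have hq : ∫ z, aliveWeight σ F θ m z *
      stayProb μ σ N (leftProd z.1 (m + p) • z.2.1) (walk σ z.2.1 (m + p) z.1 + c)
        ∂((pathLaw μ).prod ρ) ≤
      aliveMass μ ρ σ F θ n + B * ((2 * n + 2) * (C * Real.exp (-(a * L)))) := by
    rw [← heq]
    refine (integral_mono hEm ((h.integrable_weight hσ n).add hBi) hpt).trans ?_
    rw [integral_add' (h.integrable_weight hσ n) hBi, integral_indicator hBdm, setIntegral_const,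
      smul_eq_mul, mul_comm _ B]
    have := h.measureReal_largeValues_le ha hC n L
    have := h.B_nonneg
    unfold aliveMass
    gcongr
  obtain ⟨hgi, hgap⟩ := h.integral_mul_gap_le p ha hC hwm (h.weight_nonneg m) (h.weight_le m) m L
  have hhi := h.integrable_weight_mul hσ m ((h.memLp_height hσ ha m).integrable one_le_two)
  have hsi := h.integrable_weight_mul hσ m (h.memLp_walk hσ ha (m + p)).integrable_sq
  have hR : Integrable (fun z => aliveWeight σ F θ m z * height σ F m z -
      aliveWeight σ F θ m z * gap σ F p m z) ((pathLaw μ).prod ρ) := hhi.sub hgi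
  have hR2 := hwm.const_mul ((p + 3) * L + D + 2 * K * ((p + 3) * L) ^ 2)
  have hR3 := hsi.const_mul (2 * K)
  have hR4 : Integrable (fun z => aliveWeight σ F θ m z * height σ F m z -
      aliveWeight σ F θ m z * gap σ F p m z -
      ((p + 3) * L + D + 2 * K * ((p + 3) * L) ^ 2) * aliveWeight σ F θ m z)
      ((pathLaw μ).prod ρ) := hR.sub hR2
  have hmain : aliveHeight μ ρ σ F θ m -
      (p + 9) * (L * aliveMass μ ρ σ F θ m + truncErr a C B L) -
      ((p + 3) * L + D + 2 * K * ((p + 3) * L) ^ 2) * aliveMass μ ρ σ F θ m -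
      2 * K * ∫ z, aliveWeight σ F θ m z * walk σ z.2.1 (m + p) z.1 ^ 2 ∂((pathLaw μ).prod ρ) ≤
      s * ∫ z, aliveWeight σ F θ m z *
      stayProb μ σ N (leftProd z.1 (m + p) • z.2.1) (walk σ z.2.1 (m + p) z.1 + c)
        ∂((pathLaw μ).prod ρ) := by
    rw [← integral_const_mul s]
    refine le_trans ?_ (integral_mono (hR4.sub hR3) (hi.const_mul s) fun z => ?_)
    · rw [integral_sub' hR4 hR3, integral_sub hR hR2, integral_sub hhi hgi, integral_const_mul,
        integral_const_mul]
      exact sub_le_sub_right (sub_le_sub_right (sub_le_sub_left hgap _) _) _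
    · have hw0 := h.weight_nonneg m z
      have h1 := hstay (leftProd z.1 (m + p) • z.2.1) (walk σ z.2.1 (m + p) z.1 + c)
      have h2 := abs_le.1 (abs_walk_sub_height_le hσ.cocycle F p m z)
      have h3 : K * (walk σ z.2.1 (m + p) z.1 + c) ^ 2 ≤
          2 * K * ((p + 3) * L) ^ 2 + 2 * K * walk σ z.2.1 (m + p) z.1 ^ 2 := by
        have h4 : (walk σ z.2.1 (m + p) z.1 + c) ^ 2 ≤
            2 * ((p + 3) * L) ^ 2 + 2 * walk σ z.2.1 (m + p) z.1 ^ 2 := by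
          rw [hc]
          nlinarith [sq_nonneg (walk σ z.2.1 (m + p) z.1 + (p + 3) * L)]
        calc _ ≤ K * (2 * ((p + 3) * L) ^ 2 + 2 * walk σ z.2.1 (m + p) z.1 ^ 2) :=
              mul_le_mul_of_nonneg_left h4 hK
          _ = _ := by ring
      simp only [Pi.sub_apply]
      calc _ = aliveWeight σ F θ m z * (height σ F m z - gap σ F p m z + c - D -
              (2 * K * ((p + 3) * L) ^ 2 + 2 * K * walk σ z.2.1 (m + p) z.1 ^ 2)) := by
            rw [hc]; ring
        _ ≤ aliveWeight σ F θ m z * (s * stayProb μ σ N (leftProd z.1 (m + p) • z.2.1)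
              (walk σ z.2.1 (m + p) z.1 + c)) :=
            mul_le_mul_of_nonneg_left (by linarith) hw0
        _ = _ := by ring
  have hq' := mul_le_mul_of_nonneg_left hq hs
  rw [mul_add] at hq'
  linarith

end LookAheadSystem

end LookAhead

/-! ### Approximation by perturbations with a bounded look-ahead -/

section Admissible

variable {G X : Type*} [Group G] [MulAction G X] [MeasurableSpace G] [MeasurableSpace X]

/-- Paths and starting points on the one hand and starting heights on the other are independent. -/
theorem measurePreserving_assoc (μ : Measure G) [IsProbabilityMeasure μ] (ν : Measure X)
    [IsProbabilityMeasure ν] (lam : Measure ℝ) [IsFiniteMeasure lam] :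
    MeasurePreserving (fun z : (ℕ → G) × (X × ℝ) => ((z.1, z.2.1), z.2.2))
      ((pathLaw μ).prod (ν.prod lam)) (((pathLaw μ).prod ν).prod lam) :=
  (measurePreserving_prodAssoc (pathLaw μ) ν lam).symm _

section Marginal

variable {μ : Measure G} [IsProbabilityMeasure μ] {ν : Measure X} [IsProbabilityMeasure ν]
  {lam : Measure ℝ} [IsFiniteMeasure lam]

theorem lintegral_marginal {H : (ℕ → G) × X → ℝ≥0∞} (hH : Measurable H) :
    ∫⁻ z, H (z.1, z.2.1) ∂((pathLaw μ).prod (ν.prod lam)) =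
      (∫⁻ y, H y ∂((pathLaw μ).prod ν)) * lam Set.univ := by
  refine ((measurePreserving_assoc μ ν lam).lintegral_comp
    (f := fun y : ((ℕ → G) × X) × ℝ => H y.1) (hH.comp measurable_fst)).trans ?_
  refine (lintegral_prod _ (hH.comp measurable_fst).aemeasurable).trans ?_
  simp only [Function.comp_apply, lintegral_const]
  rw [lintegral_mul_const _ hH]

theorem integrable_marginal {H : (ℕ → G) × X → ℝ} (hH : Integrable H ((pathLaw μ).prod ν)) :
    Integrable (fun z : (ℕ → G) × (X × ℝ) => H (z.1, z.2.1))
      ((pathLaw μ).prod (ν.prod lam)) :=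
  (measurePreserving_assoc μ ν lam).integrable_comp_of_integrable
    (g := fun y : ((ℕ → G) × X) × ℝ => H y.1)
    (hH.comp_fst lam)

theorem integral_marginal {H : (ℕ → G) × X → ℝ} (hH : Integrable H ((pathLaw μ).prod ν)) :
    ∫ z, H (z.1, z.2.1) ∂((pathLaw μ).prod (ν.prod lam)) =
      (∫ y, H y ∂((pathLaw μ).prod ν)) * lam.real Set.univ := by
  have h := measurePreserving_assoc μ ν lam
  have h1 : ∫ z, H (z.1, z.2.1) ∂((pathLaw μ).prod (ν.prod lam)) =
      ∫ y, H y.1 ∂(((pathLaw μ).prod ν).prod lam) := by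
    rw [← h.map_eq, integral_map h.aemeasurable]
    rw [h.map_eq]
    exact (hH.comp_fst lam).aestronglyMeasurable
  rw [h1, integral_prod _ (hH.comp_fst lam)]
  simp only [integral_const, smul_eq_mul]
  rw [integral_const_mul, mul_comm]

/-- If `lam` has density at most `Φ` with respect to the Lebesgue measure, then the starting height
falls between two functions of path and starting point with probability at most `Φ` times the
mean distance between these functions. -/
theorem measureReal_mem_uIcc_le {Φ : ℝ} (hΦ : 0 ≤ Φ)
    (hlam : ∀ s, lam s ≤ ENNReal.ofReal Φ * volume s) {c c' : (ℕ → G) × X → ℝ}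
    (hc : Measurable c) (hc' : Measurable c')
    (hi : Integrable (fun y => |c y - c' y|) ((pathLaw μ).prod ν)) :
    MeasurableSet {z : (ℕ → G) × (X × ℝ) |
      z.2.2 ∈ Set.uIcc (c (z.1, z.2.1)) (c' (z.1, z.2.1))} ∧
    ((pathLaw μ).prod (ν.prod lam)).real {z | z.2.2 ∈ Set.uIcc (c (z.1, z.2.1)) (c' (z.1, z.2.1))} ≤
      Φ * ∫ y, |c y - c' y| ∂((pathLaw μ).prod ν) := by
  set S : Set (((ℕ → G) × X) × ℝ) := {y | y.2 ∈ Set.uIcc (c y.1) (c' y.1)} with hS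
  have hSm : MeasurableSet S := by
    have : S = {y | min (c y.1) (c' y.1) ≤ y.2} ∩ {y | y.2 ≤ max (c y.1) (c' y.1)} := rfl
    rw [this]
    exact (measurableSet_le ((hc.comp measurable_fst).min (hc'.comp measurable_fst))
      measurable_snd).inter (measurableSet_le measurable_snd
        ((hc.comp measurable_fst).max (hc'.comp measurable_fst)))
  have h := measurePreserving_assoc μ ν lam
  refine ⟨h.measurable hSm, ?_⟩
  have h1 : ((pathLaw μ).prod (ν.prod lam))
      {z | z.2.2 ∈ Set.uIcc (c (z.1, z.2.1)) (c' (z.1, z.2.1))} =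
      (((pathLaw μ).prod ν).prod lam) S := h.measure_preimage hSm.nullMeasurableSet
  rw [measureReal_def, h1, Measure.prod_apply hSm]
  refine ENNReal.toReal_le_of_le_ofReal
    (mul_nonneg hΦ (integral_nonneg fun y => abs_nonneg _)) ?_
  rw [ENNReal.ofReal_mul hΦ, ofReal_integral_eq_lintegral_ofReal hi
    (ae_of_all _ fun y => abs_nonneg _), ← lintegral_const_mul']
  · refine lintegral_mono fun y => (hlam _).trans ?_
    have : Prod.mk y ⁻¹' S = Set.uIcc (c y) (c' y) := rfl
    rw [this, Real.volume_interval, abs_sub_comm]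
  · exact ENNReal.ofReal_ne_top

end Marginal

variable [MeasurableMul₂ G] [MeasurableSMul₂ G X]
variable {μ : Measure G} [IsProbabilityMeasure μ] {ν : Measure X} [IsProbabilityMeasure ν]
  {lam : Measure ℝ} [IsFiniteMeasure lam] {σ : G → X → ℝ}

theorem expBounded_alongOrbit (hν : IsStationary μ ν) {F : ℕ → (ℕ → G) × X → ℝ}
    (hF : ∀ k, Measurable (F k)) {a C : ℝ} (hC : 0 ≤ C) (k : ℕ)
    (h : ∫⁻ y, ENNReal.ofReal (Real.exp (a * |F k y|)) ∂((pathLaw μ).prod ν) ≤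
      ENNReal.ofReal C) :
    ExpBounded ((pathLaw μ).prod (ν.prod lam)) a (C * lam.real Set.univ) (alongOrbit F k) := by
  refine ⟨measurable_alongOrbit hF k, ?_⟩
  have hm : Measurable fun y => ENNReal.ofReal (Real.exp (a * |F k y|)) := by
    have := hF k
    fun_prop
  have hsh := (measurePreserving_shift μ hν).iterate k
  have h1 := lintegral_marginal (μ := μ) (ν := ν) (lam := lam)
    (H := fun y => ENNReal.ofReal (Real.exp (a * |F k (shift^[k] y)|))) (hm.comp hsh.measurable)
  have h2 := hsh.lintegral_comp hm
  simp only [alongOrbit]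
  rw [h1, h2, ENNReal.ofReal_mul hC, ofReal_measureReal]
  gcongr

theorem expBounded_step (hσ : Measurable (Function.uncurry σ)) {a M : ℝ} (hM : 0 ≤ M)
    (h : ∀ x, ∫⁻ g, ENNReal.ofReal (Real.exp (a * |σ g x|)) ∂μ ≤ ENNReal.ofReal M) (i : ℕ) :
    ExpBounded ((pathLaw μ).prod (ν.prod lam)) a (M * lam.real Set.univ) (step σ i) := by
  have hs := measurable_step hσ i
  have hm : Measurable fun z : (ℕ → G) × (X × ℝ) =>
      ENNReal.ofReal (Real.exp (a * |step σ i z|)) := by fun_prop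
  refine ⟨hs, ?_⟩
  have hr := measurePreserving_resample μ (ν.prod lam) i
  rw [← hr.lintegral_comp hm]
  refine (lintegral_prod _ (hm.comp hr.measurable).aemeasurable).le.trans ?_
  calc _ ≤ ∫⁻ _ : (ℕ → G) × (X × ℝ), ENNReal.ofReal M ∂((pathLaw μ).prod (ν.prod lam)) := by
        refine lintegral_mono fun z => ?_
        simp only [Function.comp_apply, step_concat]
        have he := measurePreserving_eval μ 0
        refine le_trans (le_of_eq ?_) (h (leftProd z.1 i • z.2.1))
        exact he.lintegral_comp (f := fun g =>
          ENNReal.ofReal (Real.exp (a * |σ g (leftProd z.1 i • z.2.1)|))) (by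
            have : Measurable fun g => σ g (leftProd z.1 i • z.2.1) :=
              hσ.comp (measurable_id.prodMk measurable_const)
            fun_prop)
    _ = _ := by
        rw [lintegral_const, ENNReal.ofReal_mul hM, ofReal_measureReal, ← Set.univ_prod_univ,
          Measure.prod_prod, measure_univ, one_mul, ← Set.univ_prod_univ, Measure.prod_prod,
          measure_univ, one_mul]

theorem expBounded_start {K : ℝ} (hK : ∀ᵐ t ∂lam, |t| ≤ K) {a : ℝ} (ha : 0 ≤ a) :
    ExpBounded ((pathLaw μ).prod (ν.prod lam)) a (Real.exp (a * K) * lam.real Set.univ)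
      (fun z => z.2.2) := by
  refine ⟨by fun_prop, ?_⟩
  have h1 : MeasurePreserving (fun z : (ℕ → G) × (X × ℝ) => z.2.2)
      ((pathLaw μ).prod (ν.prod lam)) lam :=
    measurePreserving_snd.comp measurePreserving_snd
  rw [h1.lintegral_comp (f := fun t => ENNReal.ofReal (Real.exp (a * |t|))) (by fun_prop)]
  calc _ ≤ ∫⁻ _, ENNReal.ofReal (Real.exp (a * K)) ∂lam := by
        refine lintegral_mono_ae ?_
        filter_upwards [hK] with t ht
        gcongr
    _ = _ := by
        rw [lintegral_const, ENNReal.ofReal_mul (Real.exp_pos _).le, ofReal_measureReal]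

theorem ExpBounded.mono {Z : Type*} [MeasurableSpace Z] {Q : Measure Z} {a C C' : ℝ} {h : Z → ℝ}
    (hh : ExpBounded Q a C h) (hC : C ≤ C') : ExpBounded Q a C' h :=
  ⟨hh.measurable, hh.bound.trans (ENNReal.ofReal_le_ofReal hC)⟩

section PastMean

variable {α β b : ℝ} {f : ℕ → (ℕ → G) × X → ℝ}

theorem IsAdmissiblePerturbation.lintegral_exp_le (hf : IsAdmissiblePerturbation μ ν α β b f)
    (k : ℕ) : ∫⁻ y, ENNReal.ofReal (Real.exp (α * |f k y|)) ∂((pathLaw μ).prod ν) ≤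
      ENNReal.ofReal b := by
  have hm : Measurable fun y => ENNReal.ofReal (Real.exp (α * |f k y|)) := by
    have := hf.measurable k
    fun_prop
  rw [lintegral_prod_symm _ hm.aemeasurable]
  exact (le_iSup (fun n => ∫⁻ x, ∫⁻ ω, ENNReal.ofReal (Real.exp (α * |f n (ω, x)|))
    ∂(pathLaw μ) ∂ν) k).trans hf.moment

theorem IsAdmissiblePerturbation.integrable (hf : IsAdmissiblePerturbation μ ν α β b f)
    (hα : 0 < α) (k : ℕ) : Integrable (f k) ((pathLaw μ).prod ν) :=
  ((⟨hf.measurable k, hf.lintegral_exp_le k⟩ : ExpBounded _ α b (f k)).memLp_two hα).integrable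
    one_le_two

/-- The joint version of the approximation hypothesis: `pastMean` is a version of the conditional
expectation for almost every starting point. -/
theorem IsAdmissiblePerturbation.lintegral_exp_sub_pastMean_le
    (hf : IsAdmissiblePerturbation μ ν α β b f) (hα : 0 < α) (k p : ℕ) :
    ∫⁻ y, ENNReal.ofReal (Real.exp (α * |f k y - pastMean μ p (f k) y|)) ∂((pathLaw μ).prod ν) ≤
      ENNReal.ofReal (b * Real.exp (-(β * p))) + 1 := by
  have hm : Measurable fun y =>
      ENNReal.ofReal (Real.exp (α * |f k y - pastMean μ p (f k) y|)) := by
    have := hf.measurable k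
    have := measurable_pastMean μ p (hf.measurable k)
    fun_prop
  rw [lintegral_prod_symm _ hm.aemeasurable]
  have heq : ∫⁻ x, ∫⁻ ω, ENNReal.ofReal (Real.exp (α * |f k (ω, x) - pastMean μ p (f k) (ω, x)|))
      ∂(pathLaw μ) ∂ν = ∫⁻ x, ∫⁻ ω, ENNReal.ofReal (Real.exp (α *
        |f k (ω, x) - (pathLaw μ)[fun ω' => f k (ω', x) | coordAlgebra G p] ω|))
      ∂(pathLaw μ) ∂ν := by
    refine lintegral_congr_ae ?_
    filter_upwards [(hf.integrable hα k).prod_left_ae] with x hx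
    refine lintegral_congr_ae ?_
    have hmx : Measurable fun ω => f k (ω, x) :=
      (hf.measurable k).comp (measurable_id.prodMk measurable_const)
    filter_upwards [condExp_coordAlgebra_eq p hmx hx] with ω hω
    rw [hω]
    rfl
  have h1 : ENNReal.ofReal (Real.exp (β * p)) * (∫⁻ x, ∫⁻ ω, ENNReal.ofReal (Real.exp (α *
        |f k (ω, x) - (pathLaw μ)[fun ω' => f k (ω', x) | coordAlgebra G p] ω|))
      ∂(pathLaw μ) ∂ν - 1) ≤ ENNReal.ofReal b :=
    (le_iSup₂ (f := fun n p : ℕ => ENNReal.ofReal (Real.exp (β * p)) * (∫⁻ x, ∫⁻ ω,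
      ENNReal.ofReal (Real.exp (α *
        |f n (ω, x) - (pathLaw μ)[fun ω' => f n (ω', x) | coordAlgebra G p] ω|))
      ∂(pathLaw μ) ∂ν - 1)) k p).trans hf.approx
  rw [heq]
  set I := ∫⁻ x, ∫⁻ ω, ENNReal.ofReal (Real.exp (α *
        |f k (ω, x) - (pathLaw μ)[fun ω' => f k (ω', x) | coordAlgebra G p] ω|))
      ∂(pathLaw μ) ∂ν with hI
  have h2 : I - 1 ≤ ENNReal.ofReal (b * Real.exp (-(β * p))) := by
    have h3 : ENNReal.ofReal (b * Real.exp (-(β * p))) =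
        ENNReal.ofReal b / ENNReal.ofReal (Real.exp (β * p)) := by
      rw [Real.exp_neg, ← div_eq_mul_inv, ENNReal.ofReal_div_of_pos (Real.exp_pos _)]
    rw [h3, ENNReal.le_div_iff_mul_le (Or.inl (by simp [Real.exp_pos]))
      (Or.inl ENNReal.ofReal_ne_top), mul_comm]
    exact h1
  exact tsub_le_iff_right.1 h2

theorem IsAdmissiblePerturbation.integral_abs_sub_pastMean_le
    (hf : IsAdmissiblePerturbation μ ν α β b f) (hα : 0 < α) (hb : 0 ≤ b) (k p : ℕ) :
    Integrable (fun y => |f k y - pastMean μ p (f k) y|) ((pathLaw μ).prod ν) ∧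
    ∫ y, |f k y - pastMean μ p (f k) y| ∂((pathLaw μ).prod ν) ≤
      b / α * Real.exp (-(β * p)) := by
  have hexp : ExpBounded ((pathLaw μ).prod ν) α (b * Real.exp (-(β * p)) + 1)
      (fun y => f k y - pastMean μ p (f k) y) := by
    refine ⟨(hf.measurable k).sub (measurable_pastMean μ p (hf.measurable k)), ?_⟩
    rw [ENNReal.ofReal_add (by positivity) zero_le_one, ENNReal.ofReal_one]
    exact hf.lintegral_exp_sub_pastMean_le hα k p
  have hi : Integrable (fun y => |f k y - pastMean μ p (f k) y|) ((pathLaw μ).prod ν) :=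
    ((hexp.memLp_two hα).integrable one_le_two).abs
  refine ⟨hi, ?_⟩
  have h1 : ∫ y, α * |f k y - pastMean μ p (f k) y| ∂((pathLaw μ).prod ν) ≤
      ∫ y, (Real.exp (α * |f k y - pastMean μ p (f k) y|) - 1) ∂((pathLaw μ).prod ν) :=
    integral_mono (hi.const_mul α) (hexp.integrable_exp.sub (integrable_const 1)) fun y => by
      have := Real.add_one_le_exp (α * |f k y - pastMean μ p (f k) y|)
      linarith
  rw [integral_const_mul, integral_sub hexp.integrable_exp (integrable_const 1), integral_const,
    probReal_univ, one_smul] at h1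
  have h2 := hexp.integral_exp_le (by positivity)
  rw [div_mul_eq_mul_div, le_div_iff₀ hα]
  linarith

theorem IsAdmissiblePerturbation.lintegral_exp_pastMean_le
    (hf : IsAdmissiblePerturbation μ ν α β b f) (hα : 0 < α) (hβ : 0 < β) (hb : 0 ≤ b) (k p : ℕ) :
    ∫⁻ y, ENNReal.ofReal (Real.exp (α / 2 * |pastMean μ p (f k) y|)) ∂((pathLaw μ).prod ν) ≤
      ENNReal.ofReal (2 * b + 1) := by
  have hm1 : Measurable fun y => ENNReal.ofReal (Real.exp (α * |f k y|)) := by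
    have := hf.measurable k
    fun_prop
  have hpt : ∀ y, ENNReal.ofReal (Real.exp (α / 2 * |pastMean μ p (f k) y|)) ≤
      ENNReal.ofReal (Real.exp (α * |f k y|)) +
        ENNReal.ofReal (Real.exp (α * |f k y - pastMean μ p (f k) y|)) := by
    intro y
    rw [← ENNReal.ofReal_add (Real.exp_pos _).le (Real.exp_pos _).le]
    refine ENNReal.ofReal_le_ofReal ?_
    have h1 : |pastMean μ p (f k) y| ≤ |f k y| + |f k y - pastMean μ p (f k) y| := by
      have := abs_sub_abs_le_abs_sub (pastMean μ p (f k) y) (f k y)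
      rw [abs_sub_comm] at this
      linarith
    set u := |f k y|
    set w := |f k y - pastMean μ p (f k) y|
    have h2 : α / 2 * |pastMean μ p (f k) y| ≤ α / 2 * u + α / 2 * w := by
      have := mul_le_mul_of_nonneg_left h1 (by positivity : 0 ≤ α / 2)
      linarith
    have h3 : Real.exp (α / 2 * u + α / 2 * w) =
        Real.exp (α / 2 * u) * Real.exp (α / 2 * w) := Real.exp_add _ _
    have h4 : Real.exp (α * u) = Real.exp (α / 2 * u) ^ 2 := by
      rw [← Real.exp_nat_mul]; congr 1; push_cast; ring
    have h5 : Real.exp (α * w) = Real.exp (α / 2 * w) ^ 2 := by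
      rw [← Real.exp_nat_mul]; congr 1; push_cast; ring
    calc _ ≤ Real.exp (α / 2 * u + α / 2 * w) := Real.exp_le_exp.2 h2
      _ ≤ _ := by
        rw [h3, h4, h5]
        nlinarith [sq_nonneg (Real.exp (α / 2 * u) - Real.exp (α / 2 * w)),
          Real.exp_pos (α / 2 * u), Real.exp_pos (α / 2 * w)]
  refine (lintegral_mono hpt).trans ?_
  rw [lintegral_add_left hm1]
  have h1 := hf.lintegral_exp_le k
  have h2 := hf.lintegral_exp_sub_pastMean_le hα k p
  have h3 : b * Real.exp (-(β * p)) ≤ b := mul_le_of_le_one_right hb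
    (Real.exp_le_one_iff.2 (neg_nonpos.2 (by positivity)))
  calc _ ≤ ENNReal.ofReal b + (ENNReal.ofReal b + 1) :=
        add_le_add h1 (h2.trans (add_le_add (ENNReal.ofReal_le_ofReal h3) le_rfl))
    _ = _ := by
        rw [← ENNReal.ofReal_one, ← ENNReal.ofReal_add hb zero_le_one, ← ENNReal.ofReal_add hb
          (by linarith)]
        congr 1
        ring

end PastMean

end Admissible

/-! ### Stability of mass and height under small changes of the perturbation -/

section Comparison

variable {G X : Type*} [Group G] [MulAction G X]

/-- The starting height at which the perturbed walk vanishes at time `k`. -/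
def zeroHeight (σ : G → X → ℝ) (F : ℕ → (ℕ → G) × X → ℝ) (k : ℕ) (y : (ℕ → G) × X) : ℝ :=
  F 0 y - F k (shift^[k] y) - walk σ y.2 k y.1

theorem height_eq_sub_zeroHeight (σ : G → X → ℝ) (F : ℕ → (ℕ → G) × X → ℝ) (k : ℕ)
    (z : (ℕ → G) × (X × ℝ)) : height σ F k z = z.2.2 - zeroHeight σ F k (z.1, z.2.1) := by
  simp only [height_eq, zeroHeight, alongOrbit, Function.iterate_zero, id]
  ring

/-- The weights of two perturbed walks differ only if the two twists differ, or if at some time the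
starting height lies between the two heights at which the perturbed walks vanish. -/
theorem abs_aliveWeight_sub_le (σ : G → X → ℝ) (F F' : ℕ → (ℕ → G) × X → ℝ)
    {θ θ' : (ℕ → G) → ℝ} {B : ℝ} (hθ : ∀ ω, 0 ≤ θ ω) (hθB : ∀ ω, θ ω ≤ B) (hθ' : ∀ ω, 0 ≤ θ' ω)
    (hθB' : ∀ ω, θ' ω ≤ B) (k : ℕ) (z : (ℕ → G) × (X × ℝ)) :
    |aliveWeight σ F θ k z - aliveWeight σ F' θ' k z| ≤ |θ z.1 - θ' z.1| +
      ∑ j ∈ Finset.range k, {z : (ℕ → G) × (X × ℝ) | z.2.2 ∈ Set.uIcc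
        (zeroHeight σ F (j + 1) (z.1, z.2.1)) (zeroHeight σ F' (j + 1) (z.1, z.2.1))}.indicator
          (fun _ => B) z := by
  have hB : 0 ≤ B := (hθ z.1).trans (hθB z.1)
  set S : ℕ → Set ((ℕ → G) × (X × ℝ)) := fun j => {z | z.2.2 ∈ Set.uIcc
    (zeroHeight σ F (j + 1) (z.1, z.2.1)) (zeroHeight σ F' (j + 1) (z.1, z.2.1))} with hS
  have hnn : ∀ j ∈ Finset.range k, 0 ≤ (S j).indicator (fun _ => B) z := fun j _ =>
    Set.indicator_nonneg (fun _ _ => hB) _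
  have hsum0 := Finset.sum_nonneg hnn
  have hmem : (z ∈ alive σ F k ∧ z ∉ alive σ F' k ∨ z ∉ alive σ F k ∧ z ∈ alive σ F' k) →
      B ≤ ∑ j ∈ Finset.range k, (S j).indicator (fun _ => B) z := by
    intro h
    obtain ⟨j, hj, hz⟩ : ∃ j < k, z ∈ S j := by
      rcases h with ⟨h1, h2⟩ | ⟨h1, h2⟩
      · simp only [alive, Set.mem_ofPred_eq, not_forall, not_le] at h2
        obtain ⟨j, hj1, hjk, hneg⟩ := h2
        have hpos := h1 j hj1 hjk
        rw [height_eq_sub_zeroHeight] at hneg hpos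
        refine ⟨j - 1, by omega, ?_⟩
        simp only [hS, Set.mem_ofPred_eq, Nat.sub_add_cancel hj1]
        exact Set.mem_uIcc.2 (Or.inl ⟨by linarith, by linarith⟩)
      · simp only [alive, Set.mem_ofPred_eq, not_forall, not_le] at h1
        obtain ⟨j, hj1, hjk, hneg⟩ := h1
        have hpos := h2 j hj1 hjk
        rw [height_eq_sub_zeroHeight] at hneg hpos
        refine ⟨j - 1, by omega, ?_⟩
        simp only [hS, Set.mem_ofPred_eq, Nat.sub_add_cancel hj1]
        exact Set.mem_uIcc.2 (Or.inr ⟨by linarith, by linarith⟩)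
    calc B = (S j).indicator (fun _ => B) z := (Set.indicator_of_mem hz fun _ => B).symm
      _ ≤ _ := Finset.single_le_sum hnn (Finset.mem_range.2 hj)
  have h0 := abs_nonneg (θ z.1 - θ' z.1)
  by_cases h1 : z ∈ alive σ F k <;> by_cases h2 : z ∈ alive σ F' k
  · rw [aliveWeight, aliveWeight, Set.indicator_of_mem h1, Set.indicator_of_mem h2]
    linarith
  · rw [aliveWeight, aliveWeight, Set.indicator_of_mem h1, Set.indicator_of_notMem h2, sub_zero,
      abs_of_nonneg (hθ _)]
    linarith [hmem (Or.inl ⟨h1, h2⟩), hθB z.1]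
  · rw [aliveWeight, aliveWeight, Set.indicator_of_notMem h1, Set.indicator_of_mem h2, zero_sub,
      abs_neg, abs_of_nonneg (hθ' _)]
    linarith [hmem (Or.inr ⟨h1, h2⟩), hθB' z.1]
  · rw [aliveWeight, aliveWeight, Set.indicator_of_notMem h1, Set.indicator_of_notMem h2, sub_zero,
      abs_zero]
    linarith

variable [MeasurableSpace G] [MeasurableSpace X] [MeasurableMul₂ G] [MeasurableSMul₂ G X]

theorem measurable_zeroHeight {σ : G → X → ℝ} (hσ : Measurable (Function.uncurry σ))
    {F : ℕ → (ℕ → G) × X → ℝ} (hF : ∀ k, Measurable (F k)) (k : ℕ) :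
    Measurable (zeroHeight σ F k) :=
  ((hF 0).sub ((hF k).comp (measurable_shift.iterate k))).sub (measurable_walk hσ k)

variable {μ : Measure G} [IsProbabilityMeasure μ] {ν : Measure X} [IsProbabilityMeasure ν]
  {lam : Measure ℝ} [IsFiniteMeasure lam] {σ : G → X → ℝ} {a C B M Φ δ : ℝ}
  {F F' : ℕ → (ℕ → G) × X → ℝ} {θ θ' : (ℕ → G) → ℝ}

theorem integral_abs_orbit_sub_le (hν : IsStationary μ ν)
    (hδ : ∀ k, Integrable (fun y => |F k y - F' k y|) ((pathLaw μ).prod ν) ∧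
      ∫ y, |F k y - F' k y| ∂((pathLaw μ).prod ν) ≤ δ) (k : ℕ) :
    Integrable (fun y => |F 0 y - F' 0 y| + |F k (shift^[k] y) - F' k (shift^[k] y)|)
      ((pathLaw μ).prod ν) ∧
    ∫ y, (|F 0 y - F' 0 y| + |F k (shift^[k] y) - F' k (shift^[k] y)|) ∂((pathLaw μ).prod ν) ≤
      2 * δ := by
  have hsh := (measurePreserving_shift μ hν).iterate k
  have i1 : Integrable (fun y => |F k (shift^[k] y) - F' k (shift^[k] y)|) ((pathLaw μ).prod ν) :=
    hsh.integrable_comp_of_integrable (g := fun y => |F k y - F' k y|) (hδ k).1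
  refine ⟨(hδ 0).1.add i1, ?_⟩
  rw [integral_add (hδ 0).1 i1]
  have h1 : ∫ y, |F k (shift^[k] y) - F' k (shift^[k] y)| ∂((pathLaw μ).prod ν) =
      ∫ y, |F k y - F' k y| ∂((pathLaw μ).prod ν) := by
    conv_rhs => rw [← hsh.map_eq]
    rw [integral_map hsh.aemeasurable]
    rw [hsh.map_eq]
    exact (hδ k).1.aestronglyMeasurable
  linarith [(hδ 0).2, (hδ k).2]

theorem integral_abs_zeroHeight_sub_le (hν : IsStationary μ ν)
    (hσ : Measurable (Function.uncurry σ)) (hF : ∀ k, Measurable (F k))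
    (hF' : ∀ k, Measurable (F' k))
    (hδ : ∀ k, Integrable (fun y => |F k y - F' k y|) ((pathLaw μ).prod ν) ∧
      ∫ y, |F k y - F' k y| ∂((pathLaw μ).prod ν) ≤ δ) (k : ℕ) :
    Integrable (fun y => |zeroHeight σ F k y - zeroHeight σ F' k y|) ((pathLaw μ).prod ν) ∧
    ∫ y, |zeroHeight σ F k y - zeroHeight σ F' k y| ∂((pathLaw μ).prod ν) ≤ 2 * δ := by
  obtain ⟨i1, h1⟩ := integral_abs_orbit_sub_le hν hδ k
  have hle : ∀ y, |zeroHeight σ F k y - zeroHeight σ F' k y| ≤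
      |F 0 y - F' 0 y| + |F k (shift^[k] y) - F' k (shift^[k] y)| := fun y => by
    have : zeroHeight σ F k y - zeroHeight σ F' k y =
        (F 0 y - F' 0 y) - (F k (shift^[k] y) - F' k (shift^[k] y)) := by
      simp only [zeroHeight]; ring
    rw [this]
    exact abs_sub _ _
  have i2 : Integrable (fun y => |zeroHeight σ F k y - zeroHeight σ F' k y|)
      ((pathLaw μ).prod ν) :=
    i1.mono' ((measurable_zeroHeight hσ hF k).sub
      (measurable_zeroHeight hσ hF' k)).abs.aestronglyMeasurable
      (ae_of_all _ fun y => by rw [Real.norm_of_nonneg (abs_nonneg _)]; exact hle y)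
  exact ⟨i2, (integral_mono i2 i1 hle).trans h1⟩

namespace PerturbedSystem

variable (h : PerturbedSystem μ (ν.prod lam) σ a C B F θ)
  (h' : PerturbedSystem μ (ν.prod lam) σ a C B F' θ') (hσ : CenteredCocycle μ σ M)
  (hν : IsStationary μ ν)

include h h' hσ hν

/-- The distance of the weights of two perturbed walks in mean. The density of the starting height
enters, since the event that the walk is nonnegative is not a continuous function of the
perturbation. -/
theorem integral_abs_weight_sub_le (hΦ : 0 ≤ Φ)
    (hlam : ∀ s, lam s ≤ ENNReal.ofReal Φ * volume s)
    (hδ : ∀ k, Integrable (fun y => |F k y - F' k y|) ((pathLaw μ).prod ν) ∧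
      ∫ y, |F k y - F' k y| ∂((pathLaw μ).prod ν) ≤ δ)
    (hθ : ∫ ω, |θ ω - θ' ω| ∂(pathLaw μ) ≤ δ) (k : ℕ) :
    ∫ z, |aliveWeight σ F θ k z - aliveWeight σ F' θ' k z| ∂((pathLaw μ).prod (ν.prod lam)) ≤
      (lam.real Set.univ + 2 * B * Φ * k) * δ := by
  have hθm : Measurable fun ω => |θ ω - θ' ω| := (h.measurable_θ.sub h'.measurable_θ).abs
  have hθi : Integrable (fun ω => |θ ω - θ' ω|) (pathLaw μ) :=
    Integrable.of_bound hθm.aestronglyMeasurable B (ae_of_all _ fun ω => by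
      rw [Real.norm_of_nonneg (abs_nonneg _), abs_le]
      constructor <;> linarith [h.θ_nonneg ω, h.θ_le ω, h'.θ_nonneg ω, h'.θ_le ω])
  have hθi' : Integrable (fun y : (ℕ → G) × X => |θ y.1 - θ' y.1|) ((pathLaw μ).prod ν) :=
    hθi.comp_fst ν
  have i0 := integrable_marginal (lam := lam) hθi'
  have h0 := integral_marginal (lam := lam) hθi'
  have h00 : ∫ y : (ℕ → G) × X, |θ y.1 - θ' y.1| ∂((pathLaw μ).prod ν) =
      ∫ ω, |θ ω - θ' ω| ∂(pathLaw μ) := by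
    rw [integral_prod _ hθi']
    simp
  rw [h00] at h0
  have hc := fun j => integral_abs_zeroHeight_sub_le hν hσ.measurable h.measurable_F
    h'.measurable_F hδ (j + 1)
  have hS := fun j => measureReal_mem_uIcc_le (μ := μ) (ν := ν) hΦ hlam
    (measurable_zeroHeight hσ.measurable h.measurable_F (j + 1))
    (measurable_zeroHeight hσ.measurable h'.measurable_F (j + 1)) (hc j).1
  have is : ∀ j ∈ Finset.range k, Integrable ({z : (ℕ → G) × (X × ℝ) | z.2.2 ∈ Set.uIcc
      (zeroHeight σ F (j + 1) (z.1, z.2.1)) (zeroHeight σ F' (j + 1) (z.1, z.2.1))}.indicator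
        (fun _ => B)) ((pathLaw μ).prod (ν.prod lam)) := fun j _ =>
    (integrable_const B).indicator (hS j).1
  calc _ ≤ ∫ z, (|θ z.1 - θ' z.1| +
        ∑ j ∈ Finset.range k, {z : (ℕ → G) × (X × ℝ) | z.2.2 ∈ Set.uIcc
        (zeroHeight σ F (j + 1) (z.1, z.2.1)) (zeroHeight σ F' (j + 1) (z.1, z.2.1))}.indicator
          (fun _ => B) z) ∂((pathLaw μ).prod (ν.prod lam)) :=
        integral_mono ((h.integrable_weight hσ k).sub (h'.integrable_weight hσ k)).abs
          (i0.add (integrable_finsetSum _ is)) fun z =>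
            abs_aliveWeight_sub_le σ F F' h.θ_nonneg h.θ_le h'.θ_nonneg h'.θ_le k z
    _ = lam.real Set.univ * ∫ ω, |θ ω - θ' ω| ∂(pathLaw μ) + ∑ j ∈ Finset.range k,
        ((pathLaw μ).prod (ν.prod lam)).real {z : (ℕ → G) × (X × ℝ) | z.2.2 ∈ Set.uIcc
        (zeroHeight σ F (j + 1) (z.1, z.2.1)) (zeroHeight σ F' (j + 1) (z.1, z.2.1))} * B := by
        rw [integral_add i0 (integrable_finsetSum _ is), integral_finsetSum _ is, h0, mul_comm]
        congr 1
        refine Finset.sum_congr rfl fun j _ => ?_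
        rw [integral_indicator (hS j).1, setIntegral_const, smul_eq_mul]
    _ ≤ lam.real Set.univ * δ + ∑ j ∈ Finset.range k, Φ * (2 * δ) * B := by
        refine add_le_add (mul_le_mul_of_nonneg_left hθ measureReal_nonneg)
          (Finset.sum_le_sum fun j _ => mul_le_mul_of_nonneg_right
            ((hS j).2.trans (mul_le_mul_of_nonneg_left (hc j).2 hΦ)) h.B_nonneg)
    _ = _ := by
        rw [Finset.sum_const, Finset.card_range, nsmul_eq_mul]
        ring

omit h' hν in
theorem integral_height_sq_le (ha : 0 < a) (hC : 0 ≤ C) (hB : 0 < B) (k : ℕ) :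
    ∫ z, height σ F k z ^ 2 ∂((pathLaw μ).prod (ν.prod lam)) ≤
      4 * (3 * (2 / a ^ 2 * C) + M * lam.real Set.univ * k) := by
  have hw := h.integral_walk_sq_le hσ ha k
  have hQ : ((pathLaw μ).prod (ν.prod lam)).real Set.univ = lam.real Set.univ := by
    simp [measureReal_def, ← Set.univ_prod_univ, Measure.prod_prod]
  rw [integral_const_mul, hQ] at hw
  have hw' : ∫ z : (ℕ → G) × (X × ℝ), walk σ z.2.1 k z.1 ^ 2 ∂((pathLaw μ).prod (ν.prod lam)) ≤
      M * lam.real Set.univ * k := by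
    refine le_of_mul_le_mul_left (hw.trans_eq ?_) hB
    ring
  have i1 := (h.exp_start.memLp_two ha).integrable_sq
  have i2 := (h.memLp_walk hσ ha k).integrable_sq
  have i3 := ((h.exp_orbit k).memLp_two ha).integrable_sq
  have i4 := ((h.exp_orbit 0).memLp_two ha).integrable_sq
  have i12 : Integrable (fun z : (ℕ → G) × (X × ℝ) => z.2.2 ^ 2 + walk σ z.2.1 k z.1 ^ 2)
    ((pathLaw μ).prod (ν.prod lam)) := i1.add i2
  have i123 : Integrable (fun z : (ℕ → G) × (X × ℝ) => z.2.2 ^ 2 + walk σ z.2.1 k z.1 ^ 2 +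
    alongOrbit F k z ^ 2) ((pathLaw μ).prod (ν.prod lam)) := i12.add i3
  have e1 := h.exp_start.integral_sq_le ha hC
  have e3 := (h.exp_orbit k).integral_sq_le ha hC
  have e4 := (h.exp_orbit 0).integral_sq_le ha hC
  calc _ ≤ ∫ z : (ℕ → G) × (X × ℝ), 4 * (z.2.2 ^ 2 + walk σ z.2.1 k z.1 ^ 2 +
        alongOrbit F k z ^ 2 + alongOrbit F 0 z ^ 2) ∂((pathLaw μ).prod (ν.prod lam)) := by
        refine integral_mono (h.memLp_height hσ ha k).integrable_sq
          ((i123.add i4).const_mul 4) fun z => ?_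
        simp only [height_eq]
        nlinarith [sq_nonneg (z.2.2 - walk σ z.2.1 k z.1), sq_nonneg (z.2.2 - alongOrbit F k z),
          sq_nonneg (z.2.2 + alongOrbit F 0 z), sq_nonneg (walk σ z.2.1 k z.1 - alongOrbit F k z),
          sq_nonneg (walk σ z.2.1 k z.1 + alongOrbit F 0 z),
          sq_nonneg (alongOrbit F k z + alongOrbit F 0 z)]
    _ ≤ _ := by
        rw [integral_const_mul, integral_add i123 i4, integral_add i12 i3, integral_add i1 i2]
        linarith

/-- The distance of the mean heights of two perturbed walks. The change of the weight, which is
small in mean, is separated from the height, which is bounded in mean square, by a parameter `η`. -/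
theorem abs_aliveHeight_sub_aliveHeight_le (ha : 0 < a) (hC : 0 ≤ C) (hB : 0 < B) (hΦ : 0 ≤ Φ)
    (hlam : ∀ s, lam s ≤ ENNReal.ofReal Φ * volume s)
    (hδ : ∀ k, Integrable (fun y => |F k y - F' k y|) ((pathLaw μ).prod ν) ∧
      ∫ y, |F k y - F' k y| ∂((pathLaw μ).prod ν) ≤ δ)
    (hθ : ∫ ω, |θ ω - θ' ω| ∂(pathLaw μ) ≤ δ) {η : ℝ} (hη : 0 < η) (k : ℕ) :
    |aliveHeight μ (ν.prod lam) σ F θ k - aliveHeight μ (ν.prod lam) σ F' θ' k| ≤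
      η * (4 * (3 * (2 / a ^ 2 * C) + M * lam.real Set.univ * k)) +
        B / η * ((lam.real Set.univ + 2 * B * Φ * k) * δ) + 2 * B * lam.real Set.univ * δ := by
  have hY := h.memLp_height hσ ha k
  have hY' := h'.memLp_height hσ ha k
  have iw := h.integrable_weight_mul hσ k (hY.integrable one_le_two)
  have iw' := h'.integrable_weight_mul hσ k (hY'.integrable one_le_two)
  have id : Integrable (fun z => |aliveWeight σ F θ k z - aliveWeight σ F' θ' k z|)
      ((pathLaw μ).prod (ν.prod lam)) :=
    ((h.integrable_weight hσ k).sub (h'.integrable_weight hσ k)).abs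
  obtain ⟨io, ho⟩ := integral_abs_orbit_sub_le hν hδ k
  have io' := integrable_marginal (lam := lam) io
  have ho' := integral_marginal (lam := lam) io
  have hw := h.integral_abs_weight_sub_le h' hσ hν hΦ hlam hδ hθ k
  have hsq := h'.integral_height_sq_le hσ ha hC hB k
  have i1 := hY'.integrable_sq.const_mul η
  have i2 := id.const_mul (B / η)
  have i12 : Integrable (fun z => η * height σ F' k z ^ 2 +
    B / η * |aliveWeight σ F θ k z - aliveWeight σ F' θ' k z|)
    ((pathLaw μ).prod (ν.prod lam)) := i1.add i2
  have i3 := io'.const_mul B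
  rw [aliveHeight, aliveHeight, ← integral_sub iw iw']
  refine abs_integral_le_integral_abs.trans ?_
  calc _ ≤ ∫ z : (ℕ → G) × (X × ℝ), (η * height σ F' k z ^ 2 +
        B / η * |aliveWeight σ F θ k z - aliveWeight σ F' θ' k z| +
        B * (|F 0 (z.1, z.2.1) - F' 0 (z.1, z.2.1)| + |F k (shift^[k] (z.1, z.2.1)) -
          F' k (shift^[k] (z.1, z.2.1))|)) ∂((pathLaw μ).prod (ν.prod lam)) := by
        refine integral_mono (iw.sub iw').abs (i12.add i3) fun z => ?_
        set w := aliveWeight σ F θ k z with hwd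
        set w' := aliveWeight σ F' θ' k z with hwd'
        have e1 : w * height σ F k z - w' * height σ F' k z =
            (w - w') * height σ F' k z + w * (height σ F k z - height σ F' k z) := by ring
        have e2 : height σ F k z - height σ F' k z =
            (F k (shift^[k] (z.1, z.2.1)) - F' k (shift^[k] (z.1, z.2.1))) -
              (F 0 (z.1, z.2.1) - F' 0 (z.1, z.2.1)) := by
          simp only [height_eq, alongOrbit, Function.iterate_zero, _root_.id]; ring
        have e3 : |(w - w') * height σ F' k z| ≤ η * height σ F' k z ^ 2 + B / η * |w - w'| := by
          have hb : |w - w'| ≤ B := by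
            rw [abs_le]
            constructor <;> linarith [h.weight_nonneg k z, h.weight_le k z, h'.weight_nonneg k z,
              h'.weight_le k z]
          have h3 : |w - w'| ^ 2 ≤ B * |w - w'| := by
            rw [sq]; exact mul_le_mul_of_nonneg_right hb (abs_nonneg _)
          have h4 : |w - w'| * |height σ F' k z| ≤
              η * height σ F' k z ^ 2 + |w - w'| ^ 2 / η := by
            have h5 : η * (|w - w'| * |height σ F' k z|) ≤
                η * (η * height σ F' k z ^ 2 + |w - w'| ^ 2 / η) := by
              rw [mul_add, mul_div_cancel₀ _ hη.ne', ← sq_abs (height σ F' k z)]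
              nlinarith [sq_nonneg (η * |height σ F' k z| - |w - w'|),
                sq_nonneg (η * |height σ F' k z|), sq_nonneg (|w - w'|)]
            exact le_of_mul_le_mul_left h5 hη
          have h6 : |w - w'| ^ 2 / η ≤ B / η * |w - w'| := by
            rw [div_mul_eq_mul_div]; gcongr
          rw [abs_mul]
          linarith
        have e4 : |w * (height σ F k z - height σ F' k z)| ≤
            B * (|F 0 (z.1, z.2.1) - F' 0 (z.1, z.2.1)| + |F k (shift^[k] (z.1, z.2.1)) -
              F' k (shift^[k] (z.1, z.2.1))|) := by
          rw [abs_mul, abs_of_nonneg (h.weight_nonneg k z), e2, add_comm |F 0 _ - _|]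
          exact mul_le_mul (h.weight_le k z) (abs_sub _ _) (abs_nonneg _) h.B_nonneg
        rw [e1]
        exact (abs_add_le _ _).trans (add_le_add e3 e4)
    _ ≤ _ := by
        rw [integral_add i12 i3, integral_add i1 i2, integral_const_mul, integral_const_mul,
          integral_const_mul, ho']
        have := mul_le_mul_of_nonneg_left hsq hη.le
        have h2 := mul_le_mul_of_nonneg_left hw (div_nonneg hB.le hη.le)
        have h3 := mul_le_mul_of_nonneg_left (mul_le_mul_of_nonneg_right ho
          (measureReal_nonneg (μ := lam) (s := Set.univ))) hB.le
        linarith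

end PerturbedSystem

end Comparison

/-! ### The recursion for the perturbed walk -/

section WindowApprox

/-- An exponential in `window n`, hence in `n ^ (1 / 16)`, beats any power of `n`. -/
theorem exists_exp_window_le {c : ℝ} (hc : 0 < c) : ∃ K : ℝ, 0 ≤ K ∧ ∀ n : ℕ, 1 ≤ n →
    (n : ℝ) ^ 3 * Real.exp (-(c * window n)) ≤ K / n := by
  obtain ⟨j, hj⟩ : ∃ j : ℕ, j = 16 * 4 := ⟨_, rfl⟩
  obtain ⟨L, hL, hexp⟩ : ∃ L : ℝ, 0 < L ∧ ∀ x : ℝ, 0 ≤ x → x ^ j / L ≤ Real.exp x :=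
    ⟨(Nat.factorial j : ℝ), by positivity, fun x hx => Real.pow_div_factorial_le_exp x hx j⟩
  refine ⟨L / c ^ j, by positivity, fun n hn => ?_⟩
  have hn0 : (0 : ℝ) < n := by exact_mod_cast hn
  have h1 := hexp (c * window n) (by positivity)
  have h2 := le_window_pow n
  have h3 : (n : ℝ) ^ 4 ≤ (window n : ℝ) ^ j := by
    calc (n : ℝ) ^ 4 ≤ ((window n : ℝ) ^ 16) ^ 4 := by gcongr
      _ = _ := by rw [hj, pow_mul]
  rw [le_div_iff₀ hn0, Real.exp_neg, le_div_iff₀ (by positivity)]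
  rw [div_le_iff₀ hL] at h1
  have h4 : (n : ℝ) ^ 3 * (Real.exp (c * window n))⁻¹ * n * c ^ j =
      ((n : ℝ) ^ 4 * c ^ j) * (Real.exp (c * window n))⁻¹ := by ring
  rw [h4, ← div_eq_mul_inv, div_le_iff₀ (Real.exp_pos _)]
  calc (n : ℝ) ^ 4 * c ^ j ≤ (window n : ℝ) ^ j * c ^ j :=
        mul_le_mul_of_nonneg_right h3 (by positivity)
    _ = (c * window n) ^ j := by rw [mul_pow, mul_comm]
    _ ≤ _ := by rw [mul_comm L]; exact h1

variable {G X : Type*} [Group G] [MulAction G X] [MeasurableSpace G] [MeasurableSpace X]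

/-- A perturbed system which, up to time `n`, is approximated by systems with look-ahead `window n`:
masses and mean heights change by an amount which is smaller than any power of `1 / n`. -/
structure WindowApprox (μ : Measure G) (ρ : Measure (X × ℝ)) (σ : G → X → ℝ) (a C B c A : ℝ)
    (F : ℕ → (ℕ → G) × X → ℝ) (θ : (ℕ → G) → ℝ) : Prop
    extends PerturbedSystem μ ρ σ a C B F θ where
  exists_approx : ∀ n : ℕ, 1 ≤ n → ∃ (F' : ℕ → (ℕ → G) × X → ℝ) (θ' : (ℕ → G) → ℝ),
    LookAheadSystem μ ρ σ a C B (window n) F' θ' ∧ ∀ k ≤ n,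
      |aliveMass μ ρ σ F θ k - aliveMass μ ρ σ F' θ' k| ≤
        A * n * Real.exp (-(c * window n)) ∧
      |aliveHeight μ ρ σ F θ k - aliveHeight μ ρ σ F' θ' k| ≤
        A * n * Real.exp (-(c * window n))

variable [MeasurableMul₂ G] [MeasurableSMul₂ G X]
variable {μ : Measure G} [IsProbabilityMeasure μ] {ρ : Measure (X × ℝ)} [IsFiniteMeasure ρ]
  {σ : G → X → ℝ} {a C B M c A : ℝ} {F : ℕ → (ℕ → G) × X → ℝ} {θ : (ℕ → G) → ℝ}

namespace PerturbedSystem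

theorem aliveHeight_nonneg (h : PerturbedSystem μ ρ σ a C B F θ) {n : ℕ} (hn : 1 ≤ n) :
    0 ≤ aliveHeight μ ρ σ F θ n := by
  refine integral_nonneg fun z => ?_
  by_cases hz : z ∈ alive σ F n
  · exact mul_nonneg (h.weight_nonneg n z) (hz n hn le_rfl)
  · simp [aliveWeight, hz]

theorem aliveMass_le (h : PerturbedSystem μ ρ σ a C B F θ) (hσ : CenteredCocycle μ σ M) (n : ℕ) :
    aliveMass μ ρ σ F θ n ≤ B * ((pathLaw μ).prod ρ).real Set.univ := by
  calc aliveMass μ ρ σ F θ n ≤ ∫ _, B ∂((pathLaw μ).prod ρ) :=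
        integral_mono (h.integrable_weight hσ n) (integrable_const B) fun z => h.weight_le n z
    _ = _ := by rw [integral_const, smul_eq_mul, mul_comm]

theorem aliveHeight_one_le (h : PerturbedSystem μ ρ σ a C B F θ) (hσ : CenteredCocycle μ σ M)
    (ha : 0 < a) (hC : 0 ≤ C) :
    aliveHeight μ ρ σ F θ 1 ≤ 4 * truncErr a C B 0 := by
  have hw := h.integrable_weight hσ 1
  have hle : ∀ {g : (ℕ → G) × (X × ℝ) → ℝ}, ExpBounded ((pathLaw μ).prod ρ) a C g →
      Integrable (fun z => aliveWeight σ F θ 1 z * |g z|) ((pathLaw μ).prod ρ) ∧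
      ∫ z, aliveWeight σ F θ 1 z * |g z| ∂((pathLaw μ).prod ρ) ≤ truncErr a C B 0 := fun hg =>
    ⟨h.integrable_weight_mul hσ 1 ((hg.memLp_two ha).integrable one_le_two).abs, by
      have := hg.integral_mul_abs_le ha hC h.B_nonneg hw (h.weight_nonneg 1) (h.weight_le 1) 0
      rwa [zero_mul, zero_add] at this⟩
  obtain ⟨i1, h1⟩ := hle h.exp_start
  obtain ⟨i2, h2⟩ := hle (h.exp_step 0)
  obtain ⟨i3, h3⟩ := hle (h.exp_orbit 1)
  obtain ⟨i4, h4⟩ := hle (h.exp_orbit 0)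
  have i12 : Integrable (fun z => aliveWeight σ F θ 1 z * |z.2.2| +
    aliveWeight σ F θ 1 z * |step σ 0 z|) ((pathLaw μ).prod ρ) := i1.add i2
  have i123 : Integrable (fun z => aliveWeight σ F θ 1 z * |z.2.2| +
    aliveWeight σ F θ 1 z * |step σ 0 z| + aliveWeight σ F θ 1 z * |alongOrbit F 1 z|)
    ((pathLaw μ).prod ρ) := i12.add i3
  calc aliveHeight μ ρ σ F θ 1
      ≤ ∫ z, aliveWeight σ F θ 1 z * |z.2.2| + aliveWeight σ F θ 1 z * |step σ 0 z| +
          aliveWeight σ F θ 1 z * |alongOrbit F 1 z| +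
          aliveWeight σ F θ 1 z * |alongOrbit F 0 z| ∂((pathLaw μ).prod ρ) := by
        refine integral_mono (h.integrable_weight_mul hσ 1
          ((h.memLp_height hσ ha 1).integrable one_le_two)) (i123.add i4) fun z => ?_
        simp only [← mul_add]
        refine mul_le_mul_of_nonneg_left ?_ (h.weight_nonneg 1 z)
        have e : walk σ z.2.1 1 z.1 = step σ 0 z := by
          have := walk_succ_eq hσ.cocycle 0 z
          rwa [hσ.cocycle.walk_zero, zero_add, zero_add] at this
        rw [height_eq, e]
        linarith [le_abs_self z.2.2, le_abs_self (step σ 0 z), le_abs_self (alongOrbit F 1 z),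
          neg_abs_le (alongOrbit F 0 z)]
    _ ≤ _ := by
        rw [integral_add i123 i4, integral_add i12 i3, integral_add i1 i2]
        linarith

end PerturbedSystem

/-- The truncation errors of a system with look-ahead `window n`, truncated at height `window n`,
are bounded by one and the same exponential. -/
theorem LookAheadSystem.window_bounds {n : ℕ} {F' : ℕ → (ℕ → G) × X → ℝ}
    {θ' : (ℕ → G) → ℝ} (h' : LookAheadSystem μ ρ σ a C B (window n) F' θ')
    (ha : 0 < a) (hC : 0 ≤ C) (hca : c ≤ a / 2) :
    0 ≤ truncErr a C B (window n) ∧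
    truncErr a C B (window n) ≤ B * (2 / a) * C * Real.exp (-(c * window n)) ∧
    B * (C * Real.exp (-(a * window n))) ≤ B * C * Real.exp (-(c * window n)) := by
  have hB := h'.B_nonneg
  have hp : (0 : ℝ) ≤ window n := Nat.cast_nonneg _
  have h1 : c * window n ≤ a * window n / 2 := by nlinarith
  have h2 : a * window n / 2 ≤ a * window n := by nlinarith
  have e1 : Real.exp (-(a * window n / 2)) ≤ Real.exp (-(c * window n)) :=
    Real.exp_le_exp.2 (by linarith)
  have e2 : Real.exp (-(a * window n)) ≤ Real.exp (-(c * window n)) :=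
    Real.exp_le_exp.2 (by linarith)
  refine ⟨by unfold truncErr; positivity, ?_, ?_⟩
  · unfold truncErr
    calc _ ≤ B * (2 / a * Real.exp (-(c * window n))) * C := by gcongr
      _ = _ := by ring
  · calc _ ≤ B * (C * Real.exp (-(c * window n))) := by gcongr
      _ = _ := by ring

/-- The comparisons between `1`, `window n`, the powers of `root8 n` and `n` which absorb all lower
order terms. -/
theorem one_le_and_le_root8 {n : ℕ} (hn : 1 ≤ n) : 1 ≤ root8 n ∧ (1 : ℝ) ≤ window n ∧
    (window n : ℝ) ^ 2 ≤ 4 * root8 n ∧ root8 n ^ 3 ≤ n ∧ root8 n ≤ root8 n ^ 3 ∧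
    root8 n ^ 2 ≤ root8 n ^ 3 ∧ (1 : ℝ) ≤ n := by
  have hr := one_le_root8 hn
  refine ⟨hr, by exact_mod_cast one_le_window hn, window_sq_le hn, ?_, ?_, ?_,
    by exact_mod_cast hn⟩
  · rw [← root8_pow n]; exact pow_le_pow_right₀ hr (by norm_num)
  · exact le_self_pow₀ hr (by norm_num)
  · exact pow_le_pow_right₀ hr (by norm_num)

namespace WindowApprox

variable {K κ D : ℝ}

/-- The mean height is almost constant: the bound of `LookAheadSystem.abs_aliveHeight_sub_le`,
carried over from the approximation at scale `n`. -/
theorem abs_aliveHeight_sub_le (h : WindowApprox μ ρ σ a C B c A F θ)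
    (hσ : CenteredCocycle μ σ M) (ha : 0 < a) (hC : 0 ≤ C)
    (hca : c ≤ a / 2) (hA : 0 ≤ A)
    (hexp : ∀ n : ℕ, 1 ≤ n → (n : ℝ) ^ 3 * Real.exp (-(c * window n)) ≤ K / n)
    {m n : ℕ} (hn : 1 ≤ n) (hmn : m ≤ n) :
    |aliveHeight μ ρ σ F θ n - aliveHeight μ ρ σ F θ m| ≤
      120 * root8 n * aliveMass μ ρ σ F θ m +
        (122 * A + 120 * (B * (2 / a) * C)) * K / n := by
  have hB := h.B_nonneg
  set T : ℝ := B * (2 / a) * C with hT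
  have hT0 : 0 ≤ T := by positivity
  obtain ⟨hr, hp, hp2, hr3, -, -, hn1⟩ := one_le_and_le_root8 hn
  obtain ⟨F', θ', h', happ⟩ := h.exists_approx n hn
  obtain ⟨htr0, htr, -⟩ := h'.window_bounds ha hC hca
  have hd := h'.abs_aliveHeight_sub_le hσ ha hC hmn (L := window n) (by positivity)
  have hX := hexp n hn
  have ham := (happ m hmn).2
  have han := (happ n le_rfl).2
  have hqm := (happ m hmn).1
  have hq'0 := h'.mass_nonneg m
  have hq0 := h.mass_nonneg m
  set q := aliveMass μ ρ σ F θ m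
  set q' := aliveMass μ ρ σ F' θ' m
  set e := Real.exp (-(c * window n)) with he
  have he0 : 0 < e := Real.exp_pos _
  set p := (window n : ℝ)
  set r := root8 n
  set x := (n : ℝ)
  have hqle : q' ≤ q + A * x * e := by linarith [(abs_le.1 hqm).1]
  have hx2 : x ^ 2 * e ≤ x ^ 3 * e :=
    mul_le_mul_of_nonneg_right (pow_le_pow_right₀ hn1 (by norm_num)) he0.le
  have hx1 : x * e ≤ x ^ 3 * e := by gcongr; exact le_self_pow₀ hn1 (by norm_num)
  have hrx : r ≤ x := (le_self_pow₀ hr (by norm_num)).trans hr3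
  have hpp : p ≤ p ^ 2 := le_self_pow₀ hp (by norm_num)
  have hcoef : (p + 9) * (3 * p) ≤ 120 * r := by linarith
  have s1 : (p + 9) * (3 * p) * q' ≤ 120 * r * q + 120 * A * (x ^ 3 * e) := by
    calc (p + 9) * (3 * p) * q' ≤ 120 * r * (q + A * x * e) :=
          mul_le_mul hcoef hqle hq'0 (by positivity)
      _ = 120 * r * q + 120 * A * (r * x * e) := by ring
      _ ≤ 120 * r * q + 120 * A * (x * x * e) := by gcongr
      _ = 120 * r * q + 120 * A * (x ^ 2 * e) := by ring
      _ ≤ _ := by gcongr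
  have s2 : (p + 9) * ((x + 2) * truncErr a C B p) ≤ 120 * T * (x ^ 3 * e) := by
    have e1 : p + 9 ≤ 10 * p := by linarith
    have e2 : x + 2 ≤ 3 * x := by linarith
    calc (p + 9) * ((x + 2) * truncErr a C B p) ≤ (10 * p) * ((3 * x) * (T * e)) := by gcongr
      _ = 30 * T * (p * x * e) := by ring
      _ ≤ 30 * T * ((4 * x) * x * e) := by gcongr; linarith
      _ = 120 * T * (x ^ 2 * e) := by ring
      _ ≤ _ := by gcongr
  have s3 : A * x * e ≤ A * (x ^ 3 * e) := by
    rw [mul_assoc]; gcongr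
  have s4 : (122 * A + 120 * T) * (x ^ 3 * e) ≤ (122 * A + 120 * T) * K / x := by
    rw [mul_div_assoc]; gcongr
  have e5 : (p + 9) * (3 * p * q' + (x + 2) * truncErr a C B p) =
      (p + 9) * (3 * p) * q' + (p + 9) * ((x + 2) * truncErr a C B p) := by ring
  rw [e5] at hd
  have hd2 : (p + 9) * (3 * p) * q' + (p + 9) * ((x + 2) * truncErr a C B p) ≤
      120 * r * q + (120 * A + 120 * T) * (x ^ 3 * e) := by linarith
  rw [abs_le] at ham han hd ⊢
  constructor <;> linarith

/-- The mass is at most the height at an earlier time, suitably scaled: `LookAheadSystem.mass_upper`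
for the approximation at scale `n`. -/
theorem mul_aliveMass_le (h : WindowApprox μ ρ σ a C B c A F θ)
    (hσ : CenteredCocycle μ σ M) (ha : 0 < a) (hC : 0 ≤ C)
    (hca : c ≤ a / 2) (hA : 0 ≤ A) (hκ : 0 ≤ κ) (hD : 0 ≤ D)
    (hexp : ∀ n : ℕ, 1 ≤ n → (n : ℝ) ^ 3 * Real.exp (-(c * window n)) ≤ K / n)
    {m n N : ℕ} (hm : 1 ≤ m) (hnN : N + m + window n = n)
    (hstay : ∀ (x : X) (y : ℝ),
      κ * √N * stayProb μ σ N x y ≤ max y 0 + D * root8 N ^ 3) :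
    κ * √N * aliveMass μ ρ σ F θ n ≤ aliveHeight μ ρ σ F θ m +
      (52 + D) * root8 n ^ 3 * aliveMass μ ρ σ F θ m +
      ((52 + D) * A + A + 40 * (B * (2 / a) * C) + 4 * κ * B * C + κ * A) * K / n := by
  have hB := h.B_nonneg
  set T : ℝ := B * (2 / a) * C with hT
  have hT0 : 0 ≤ T := by positivity
  have hn : 1 ≤ n := by omega
  obtain ⟨hr, hp, hp2, hr3, hr1, -, hn1⟩ := one_le_and_le_root8 hn
  obtain ⟨F', θ', h', happ⟩ := h.exists_approx n hn
  obtain ⟨htr0, htr, hbad⟩ := h'.window_bounds ha hC hca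
  have hNr : root8 N ^ 3 ≤ root8 n ^ 3 :=
    pow_le_pow_left₀ (root8_nonneg N) (root8_mono (by omega)) 3
  have hsN : κ * √N ≤ κ * n := by
    refine mul_le_mul_of_nonneg_left (Real.sqrt_le_iff.2 ⟨Nat.cast_nonneg n, ?_⟩) hκ
    have h1 : (N : ℝ) ≤ n := by exact_mod_cast (by omega : N ≤ n)
    exact h1.trans (le_self_pow₀ hn1 (by norm_num))
  have hu := h'.mass_upper hσ ha hC hm hnN (L := window n) (by positivity) (s := κ * √N)
    (by positivity) (D := D * root8 n ^ 3) fun x y =>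
      (hstay x y).trans (by gcongr)
  have hX := hexp n hn
  have ham := (happ m (by omega)).2
  have hqn := (happ n le_rfl).1
  have hqm := (happ m (by omega)).1
  have hq'0 := h'.mass_nonneg m
  have hq0 := h.mass_nonneg m
  set q := aliveMass μ ρ σ F θ m
  set q' := aliveMass μ ρ σ F' θ' m
  set e := Real.exp (-(c * window n)) with he
  have he0 : 0 < e := Real.exp_pos _
  set p := (window n : ℝ)
  set r := root8 n
  set x := (n : ℝ)
  set s := κ * √N
  have hs0 : 0 ≤ s := by positivity
  have hqle : q' ≤ q + A * x * e := by linarith [(abs_le.1 hqm).1]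
  have hx2 : x ^ 2 * e ≤ x ^ 3 * e :=
    mul_le_mul_of_nonneg_right (pow_le_pow_right₀ hn1 (by norm_num)) he0.le
  have hx1 : x * e ≤ x ^ 3 * e := by gcongr; exact le_self_pow₀ hn1 (by norm_num)
  have hrx : r ≤ x := hr1.trans hr3
  have hpp : p ≤ p ^ 2 := le_self_pow₀ hp (by norm_num)
  have hcoef : (p + 9) * p + (3 * p + D * r ^ 3) ≤ (52 + D) * r ^ 3 := by linarith
  have s1 : ((p + 9) * p + (3 * p + D * r ^ 3)) * q' ≤
      (52 + D) * r ^ 3 * q + (52 + D) * A * (x ^ 3 * e) := by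
    calc _ ≤ (52 + D) * r ^ 3 * (q + A * x * e) :=
          mul_le_mul hcoef hqle hq'0 (by positivity)
      _ = (52 + D) * r ^ 3 * q + (52 + D) * A * (r ^ 3 * x * e) := by ring
      _ ≤ (52 + D) * r ^ 3 * q + (52 + D) * A * (x * x * e) := by gcongr
      _ = (52 + D) * r ^ 3 * q + (52 + D) * A * (x ^ 2 * e) := by ring
      _ ≤ _ := by gcongr
  have s2 : (p + 9) * truncErr a C B p ≤ 40 * T * (x ^ 3 * e) := by
    have e1 : p + 9 ≤ 10 * p := by linarith
    calc (p + 9) * truncErr a C B p ≤ (10 * p) * (T * e) := by gcongr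
      _ = 10 * T * (p * e) := by ring
      _ ≤ 10 * T * ((4 * x) * e) := by gcongr; linarith
      _ = 40 * T * (x * e) := by ring
      _ ≤ _ := by gcongr
  have s3 : A * x * e ≤ A * (x ^ 3 * e) := by
    rw [mul_assoc]; gcongr
  have s3' : s * (A * x * e) ≤ κ * A * (x ^ 3 * e) := by
    calc s * (A * x * e) ≤ κ * x * (A * x * e) := by gcongr
      _ = κ * A * (x ^ 2 * e) := by ring
      _ ≤ _ := by gcongr
  have s3'' : s * B * ((2 * x + 2) * (C * Real.exp (-(a * p)))) ≤
      4 * κ * B * C * (x ^ 3 * e) := by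
    have e2 : 2 * x + 2 ≤ 4 * x := by linarith
    calc _ = s * (2 * x + 2) * (B * (C * Real.exp (-(a * p)))) := by ring
      _ ≤ κ * x * (4 * x) * (B * C * e) := by gcongr
      _ = 4 * κ * B * C * (x ^ 2 * e) := by ring
      _ ≤ _ := by gcongr
  have s4 : ((52 + D) * A + A + 40 * T + 4 * κ * B * C + κ * A) * (x ^ 3 * e) ≤
      ((52 + D) * A + A + 40 * T + 4 * κ * B * C + κ * A) * K / x := by
    rw [mul_div_assoc]; gcongr
  have s7 : s * aliveMass μ ρ σ F θ n ≤ s * aliveMass μ ρ σ F' θ' n + s * (A * x * e) := by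
    rw [← mul_add]
    gcongr
    linarith [(abs_le.1 hqn).2]
  have s8 := (abs_le.1 ham).1
  linarith

set_option maxHeartbeats 1000000 in
/-- The converse of `mul_aliveMass_le`: `LookAheadSystem.mass_lower` for the approximation at scale
`n`. -/
theorem aliveHeight_le (h : WindowApprox μ ρ σ a C B c A F θ)
    (hσ : CenteredCocycle μ σ M) (hM : 0 ≤ M) (ha : 0 < a) (hC : 0 ≤ C)
    (hca : c ≤ a / 2) (hA : 0 ≤ A) (hκ : 0 ≤ κ) (hD : 0 ≤ D)
    (hexp : ∀ n : ℕ, 1 ≤ n → (n : ℝ) ^ 3 * Real.exp (-(c * window n)) ≤ K / n)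
    {m n N : ℕ} (hm : 1 ≤ m) (hN : 1 ≤ N) (hnN : N + m + window n = n)
    (hstay : ∀ (x : X) (y : ℝ),
      y - D * root8 N ^ 3 - D * y ^ 2 / √N ≤ κ * √N * stayProb μ σ N x y) :
    aliveHeight μ ρ σ F θ m ≤ κ * √N * aliveMass μ ρ σ F θ n +
      (56 + 513 * D) * root8 n ^ 3 * aliveMass μ ρ σ F θ m +
      2 * D * M * (4 * (B * ((pathLaw μ).prod ρ).real Set.univ) + 1) *
        (root8 n + ∑ k ∈ Finset.range m, aliveMass μ ρ σ F θ k) / √N +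
      ((56 + 513 * D) * A + A + 40 * (B * (2 / a) * C) + 4 * κ * B * C + κ * A +
        2 * D * M * A) * K / n := by
  have hB := h.B_nonneg
  set T : ℝ := B * (2 / a) * C with hT
  have hT0 : 0 ≤ T := by positivity
  set Λ := B * ((pathLaw μ).prod ρ).real Set.univ with hΛ
  have hΛ0 : 0 ≤ Λ := by positivity
  have hn : 1 ≤ n := by omega
  obtain ⟨hr, hp, hp2, hr3, hr1, hr2, hn1⟩ := one_le_and_le_root8 hn
  obtain ⟨F', θ', h', happ⟩ := h.exists_approx n hn
  obtain ⟨htr0, htr, hbad⟩ := h'.window_bounds ha hC hca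
  have hNr : root8 N ^ 3 ≤ root8 n ^ 3 :=
    pow_le_pow_left₀ (root8_nonneg N) (root8_mono (by omega)) 3
  have hN1 : 1 ≤ √(N : ℝ) := Real.one_le_sqrt.2 (by exact_mod_cast hN)
  have hsN : κ * √N ≤ κ * n := by
    refine mul_le_mul_of_nonneg_left (Real.sqrt_le_iff.2 ⟨Nat.cast_nonneg n, ?_⟩) hκ
    have h1 : (N : ℝ) ≤ n := by exact_mod_cast (by omega : N ≤ n)
    exact h1.trans (le_self_pow₀ hn1 (by norm_num))
  have hu := h'.mass_lower hσ ha hC hnN (L := window n) (by positivity) (s := κ * √N)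
    (by positivity) (D := D * root8 n ^ 3) (K := D / √N) (by positivity) fun x y =>
      le_trans (by
        have := mul_le_mul_of_nonneg_left hNr hD
        rw [div_mul_eq_mul_div]
        linarith) (hstay x y)
  have hI := h'.integral_weight_mul_walk_sq_le hσ ha m
  rw [← hΛ] at hI
  have hX := hexp n hn
  have ham := (happ m (by omega)).2
  have hqn := (happ n le_rfl).1
  have hqm := (happ m (by omega)).1
  have hq'0 := h'.mass_nonneg m
  have hq0 := h.mass_nonneg m
  have hS0 : 0 ≤ ∑ k ∈ Finset.range m, aliveMass μ ρ σ F θ k :=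
    Finset.sum_nonneg fun k _ => h.mass_nonneg k
  have hS : ∑ k ∈ Finset.range m, aliveMass μ ρ σ F' θ' k ≤
      ∑ k ∈ Finset.range m, aliveMass μ ρ σ F θ k +
        n * (A * n * Real.exp (-(c * window n))) := by
    calc _ ≤ ∑ k ∈ Finset.range m, (aliveMass μ ρ σ F θ k +
          A * n * Real.exp (-(c * window n))) := Finset.sum_le_sum fun k hk => by
          linarith [(abs_le.1 (happ k (by have := Finset.mem_range.1 hk; omega)).1).1]
      _ = ∑ k ∈ Finset.range m, aliveMass μ ρ σ F θ k +
          m * (A * n * Real.exp (-(c * window n))) := by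
        rw [Finset.sum_add_distrib, Finset.sum_const, Finset.card_range, nsmul_eq_mul]
      _ ≤ _ := by gcongr; omega
  set S := ∑ k ∈ Finset.range m, aliveMass μ ρ σ F θ k
  set S' := ∑ k ∈ Finset.range m, aliveMass μ ρ σ F' θ' k
  set I := ∫ z, aliveWeight σ F' θ' m z * walk σ z.2.1 (m + window n) z.1 ^ 2
    ∂((pathLaw μ).prod ρ)
  set q := aliveMass μ ρ σ F θ m
  set q' := aliveMass μ ρ σ F' θ' m
  set e := Real.exp (-(c * window n)) with he
  have he0 : 0 < e := Real.exp_pos _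
  set p := (window n : ℝ)
  set r := root8 n
  set x := (n : ℝ)
  set y := √(N : ℝ)
  set s := κ * y
  have hs0 : 0 ≤ s := by positivity
  have hqle : q' ≤ q + A * x * e := by linarith [(abs_le.1 hqm).1]
  have hx2 : x ^ 2 * e ≤ x ^ 3 * e :=
    mul_le_mul_of_nonneg_right (pow_le_pow_right₀ hn1 (by norm_num)) he0.le
  have hx1 : x * e ≤ x ^ 3 * e := by gcongr; exact le_self_pow₀ hn1 (by norm_num)
  have hrx : r ≤ x := hr1.trans hr3
  have hpp : p ≤ p ^ 2 := le_self_pow₀ hp (by norm_num)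
  have hDy : D / y ≤ D := div_le_self hD hN1
  have hDy0 : 0 ≤ D / y := by positivity
  have hp4 : ((p + 3) * p) ^ 2 ≤ 256 * r ^ 2 := by
    have e1 : (p + 3) * p ≤ 16 * r := by linarith
    calc ((p + 3) * p) ^ 2 ≤ (16 * r) ^ 2 := by gcongr
      _ = _ := by ring
  have hcoef : (p + 9) * p + ((p + 3) * p + D * r ^ 3 + 2 * (D / y) * ((p + 3) * p) ^ 2) ≤
      (56 + 513 * D) * r ^ 3 := by
    have e2 : 2 * (D / y) * ((p + 3) * p) ^ 2 ≤ 2 * D * (256 * r ^ 2) := by gcongr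
    have e3 : D * r ^ 2 ≤ D * r ^ 3 := by gcongr
    have e4 : (p + 9) * p + (p + 3) * p ≤ 56 * r := by linarith
    linarith
  have s1 : ((p + 9) * p + ((p + 3) * p + D * r ^ 3 + 2 * (D / y) * ((p + 3) * p) ^ 2)) * q' ≤
      (56 + 513 * D) * r ^ 3 * q + (56 + 513 * D) * A * (x ^ 3 * e) := by
    calc _ ≤ (56 + 513 * D) * r ^ 3 * (q + A * x * e) :=
          mul_le_mul hcoef hqle hq'0 (by positivity)
      _ = (56 + 513 * D) * r ^ 3 * q + (56 + 513 * D) * A * (r ^ 3 * x * e) := by ring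
      _ ≤ (56 + 513 * D) * r ^ 3 * q + (56 + 513 * D) * A * (x * x * e) := by gcongr
      _ = (56 + 513 * D) * r ^ 3 * q + (56 + 513 * D) * A * (x ^ 2 * e) := by ring
      _ ≤ _ := by gcongr
  have s2 : (p + 9) * truncErr a C B p ≤ 40 * T * (x ^ 3 * e) := by
    have e1 : p + 9 ≤ 10 * p := by linarith
    calc (p + 9) * truncErr a C B p ≤ (10 * p) * (T * e) := by gcongr
      _ = 10 * T * (p * e) := by ring
      _ ≤ 10 * T * ((4 * x) * e) := by gcongr; linarith
      _ = 40 * T * (x * e) := by ring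
      _ ≤ _ := by gcongr
  have s3 : A * x * e ≤ A * (x ^ 3 * e) := by
    rw [mul_assoc]; gcongr
  have s3' : s * (A * x * e) ≤ κ * A * (x ^ 3 * e) := by
    calc s * (A * x * e) ≤ κ * x * (A * x * e) := by gcongr
      _ = κ * A * (x ^ 2 * e) := by ring
      _ ≤ _ := by gcongr
  have s3'' : s * B * ((2 * x + 2) * (C * Real.exp (-(a * p)))) ≤
      4 * κ * B * C * (x ^ 3 * e) := by
    have e2 : 2 * x + 2 ≤ 4 * x := by linarith
    calc _ = s * (2 * x + 2) * (B * (C * Real.exp (-(a * p)))) := by ring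
      _ ≤ κ * x * (4 * x) * (B * C * e) := by gcongr
      _ = 4 * κ * B * C * (x ^ 2 * e) := by ring
      _ ≤ _ := by gcongr
  have s9 : 2 * (D / y) * I ≤ 2 * D * M * (4 * Λ + 1) * (r + S) / y +
      2 * D * M * A * (x ^ 3 * e) := by
    have e1 : Λ * p + S' ≤ (4 * Λ + 1) * (r + S) + x * (A * x * e) := by
      have : Λ * p ≤ Λ * (4 * r) := by gcongr; linarith
      have : 0 ≤ Λ * S := by positivity
      linarith
    calc 2 * (D / y) * I ≤ 2 * (D / y) * (M * ((4 * Λ + 1) * (r + S) + x * (A * x * e))) := by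
          exact mul_le_mul_of_nonneg_left
            (hI.trans (mul_le_mul_of_nonneg_left e1 hM)) (by positivity)
      _ = 2 * D * M * (4 * Λ + 1) * (r + S) / y + 2 * (D / y) * M * A * (x ^ 2 * e) := by ring
      _ ≤ _ := by gcongr
  have s4 : ((56 + 513 * D) * A + A + 40 * T + 4 * κ * B * C + κ * A + 2 * D * M * A) *
      (x ^ 3 * e) ≤ ((56 + 513 * D) * A + A + 40 * T + 4 * κ * B * C + κ * A +
        2 * D * M * A) * K / x := by
    rw [mul_div_assoc]; gcongr
  have s7 : s * aliveMass μ ρ σ F' θ' n ≤ s * aliveMass μ ρ σ F θ n + s * (A * x * e) := by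
    rw [← mul_add]
    gcongr
    linarith [(abs_le.1 hqn).1]
  have s8 := (abs_le.1 ham).2
  linarith

end WindowApprox

/-- Masses and mean heights satisfy the recursion, with a constant which depends only on the
parameters of the system. -/
theorem exists_recursionBounds (hσ : CenteredCocycle μ σ M) (hM : 0 ≤ M) (ha : 0 < a) (hC : 0 ≤ C)
    (hB : 0 ≤ B) (hc : 0 < c) (hca : c ≤ a / 2) (hA : 0 ≤ A) {κ : ℝ} (hκ : 0 ≤ κ) {D : ℝ}
    (hD : 0 ≤ D)
    (hstay : ∀ (x : X) (y : ℝ) (N : ℕ), 1 ≤ N →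
      κ * √N * stayProb μ σ N x y ≤ max y 0 + D * root8 N ^ 3 ∧
      y - D * root8 N ^ 3 - D * y ^ 2 / √N ≤ κ * √N * stayProb μ σ N x y) :
    ∃ C' : ℝ, 0 ≤ C' ∧ ∀ F θ, WindowApprox μ ρ σ a C B c A F θ →
      RecursionBounds C' κ (aliveMass μ ρ σ F θ) (aliveHeight μ ρ σ F θ) := by
  obtain ⟨K, hK, hexp⟩ := exists_exp_window_le hc
  set Λ : ℝ := ((pathLaw μ).prod ρ).real Set.univ with hΛ
  have hE0 : 0 ≤ truncErr a C B 0 := by unfold truncErr; positivity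
  have t1 : 0 ≤ B * Λ := by positivity
  have t3 : 0 ≤ (122 * A + 120 * (B * (2 / a) * C)) * K := by positivity
  have t4 : 0 ≤ ((52 + D) * A + A + 40 * (B * (2 / a) * C) + 4 * κ * B * C + κ * A) * K := by
    positivity
  have t5 : 0 ≤ ((56 + 513 * D) * A + A + 40 * (B * (2 / a) * C) + 4 * κ * B * C + κ * A +
      2 * D * M * A) * K := by positivity
  have t6 : 0 ≤ 2 * D * M * (4 * (B * Λ) + 1) := by positivity
  set K₁ := (122 * A + 120 * (B * (2 / a) * C)) * K
  set K₂ := ((52 + D) * A + A + 40 * (B * (2 / a) * C) + 4 * κ * B * C + κ * A) * K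
  set K₃ := ((56 + 513 * D) * A + A + 40 * (B * (2 / a) * C) + 4 * κ * B * C + κ * A +
      2 * D * M * A) * K
  set K₄ := 2 * D * M * (4 * (B * Λ) + 1)
  set C' : ℝ := B * Λ + 4 * truncErr a C B 0 + (176 + 513 * D) + K₁ + K₂ + K₃ + K₄ with hC'
  refine ⟨C', by positivity, fun F θ h => ⟨h.mass_nonneg, h.mass_anti hσ, ?_,
    ?_, ?_, ?_, ?_⟩⟩
  · have := h.aliveMass_le hσ 0
    linarith
  · have := h.aliveHeight_one_le hσ ha hC
    linarith
  · intro m n hm hmn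
    refine (h.abs_aliveHeight_sub_le hσ ha hC hca hA hexp (hm.trans hmn) hmn).trans ?_
    have := h.mass_nonneg m
    have := root8_nonneg n
    gcongr <;> linarith
  · intro m n N hm hN hnN
    refine (h.mul_aliveMass_le hσ ha hC hca hA hκ hD hexp hm hnN
      fun x y => (hstay x y N hN).1).trans ?_
    have := h.mass_nonneg m
    have := root8_nonneg n
    gcongr <;> linarith
  · intro m n N hm hN hnN
    have h1 := h.aliveHeight_le hσ hM ha hC hca hA hκ hD hexp hm hN hnN
      fun x y => (hstay x y N hN).2
    have h2 := h.mass_nonneg m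
    have h3 := root8_nonneg n
    have h4 : 0 ≤ ∑ k ∈ Finset.range m, aliveMass μ ρ σ F θ k :=
      Finset.sum_nonneg fun k _ => h.mass_nonneg k
    have e1 : (56 + 513 * D) * root8 n ^ 3 * aliveMass μ ρ σ F θ m ≤
        C' * root8 n ^ 3 * aliveMass μ ρ σ F θ m := by
      gcongr
      linarith
    have e2 : K₄ * (root8 n + ∑ k ∈ Finset.range m, aliveMass μ ρ σ F θ k) / √N ≤
        C' * (root8 n + ∑ k ∈ Finset.range m, aliveMass μ ρ σ F θ k) / √N := by
      gcongr
      linarith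
    have e3 : K₃ / n ≤ C' / n := by
      gcongr
      linarith
    linarith

end WindowApprox

/-! ### Admissible perturbations and twists -/

section AdmissibleSystems

theorem ExpBounded.mono_exponent {Z : Type*} [MeasurableSpace Z] {Q : Measure Z} {a a' C : ℝ}
    {h : Z → ℝ} (hh : ExpBounded Q a' C h) (ha : a ≤ a') : ExpBounded Q a C h :=
  ⟨hh.measurable, (lintegral_mono fun _ => ENNReal.ofReal_le_ofReal (Real.exp_le_exp.2
    (mul_le_mul_of_nonneg_right ha (abs_nonneg _)))).trans hh.bound⟩

variable {G X : Type*} [Group G] [MeasurableSpace G]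

/-- A twist which is measurable and takes values in `[0, b]` everywhere, and which is approximated
at rate `β` by its averages over the steps after time `p`. -/
structure IsBoundedTwist (μ : Measure G) (β b : ℝ) (θ : (ℕ → G) → ℝ) : Prop where
  measurable : Measurable θ
  nonneg : ∀ ω, 0 ≤ θ ω
  le : ∀ ω, θ ω ≤ b
  approx : ∀ p : ℕ, ∫ ω, |θ ω - ∫ ω', θ (concat p ω ω') ∂(pathLaw μ)| ∂(pathLaw μ) ≤
    b * Real.exp (-(β * p))

variable {μ : Measure G} [IsProbabilityMeasure μ] {α β b : ℝ}

/-- Every admissible twist agrees almost everywhere with a bounded twist. -/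
theorem IsAdmissibleTwist.exists_isBoundedTwist {θ : (ℕ → G) → ℝ} (hθ : IsAdmissibleTwist μ β b θ)
    (hb : 0 ≤ b) : ∃ θ', IsBoundedTwist μ β b θ' ∧ θ =ᵐ[pathLaw μ] θ' := by
  obtain ⟨g, hg, hgθ⟩ := hθ.memLp.aestronglyMeasurable
  set θ' : (ℕ → G) → ℝ := fun ω => max 0 (min (g ω) b) with hθ'
  have hm : Measurable θ' := measurable_const.max (hg.measurable.min measurable_const)
  have hn : ∀ ω, 0 ≤ θ' ω := fun ω => le_max_left _ _
  have hl : ∀ ω, θ' ω ≤ b := fun ω => max_le hb (min_le_right _ _)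
  have hae : θ =ᵐ[pathLaw μ] θ' := by
    have hle : ∀ᵐ ω ∂(pathLaw μ), ‖θ ω‖ₑ ≤ eLpNorm θ ∞ (pathLaw μ) := by
      rw [eLpNorm_exponent_top]
      exact enorm_ae_le_eLpNormEssSup θ _
    filter_upwards [hgθ, hθ.nonneg, hle] with ω h1 h2 h3
    have h2 : 0 ≤ θ ω := h2
    have h4 : θ ω ≤ b := by
      have h5 := h3.trans hθ.norm_le
      rw [Real.enorm_eq_ofReal h2] at h5
      exact (ENNReal.ofReal_le_ofReal_iff hb).1 h5
    simp only [hθ', ← h1]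
    rw [min_eq_left h4, max_eq_right h2]
  refine ⟨θ', ⟨hm, hn, hl, fun p => ?_⟩, hae⟩
  have hi : Integrable θ' (pathLaw μ) :=
    Integrable.of_bound hm.aestronglyMeasurable b (ae_of_all _ fun ω => by
      rw [Real.norm_of_nonneg (hn ω)]; exact hl ω)
  have hrate : ENNReal.ofReal (Real.exp (β * p)) *
      ∫⁻ ω, ENNReal.ofReal |θ ω - (pathLaw μ)[θ | coordAlgebra G p] ω| ∂(pathLaw μ) ≤
        ENNReal.ofReal b :=
    (le_iSup (fun p : ℕ => ENNReal.ofReal (Real.exp (β * p)) *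
      ∫⁻ ω, ENNReal.ofReal |θ ω - (pathLaw μ)[θ | coordAlgebra G p] ω| ∂(pathLaw μ)) p).trans
      hθ.rate_le
  have heq : ∫⁻ ω, ENNReal.ofReal |θ ω - (pathLaw μ)[θ | coordAlgebra G p] ω| ∂(pathLaw μ) =
      ∫⁻ ω, ENNReal.ofReal |θ' ω - ∫ ω', θ' (concat p ω ω') ∂(pathLaw μ)| ∂(pathLaw μ) := by
    refine lintegral_congr_ae ?_
    filter_upwards [hae, condExp_congr_ae (m := coordAlgebra G p) hae,
      condExp_coordAlgebra_eq p hm hi] with ω h1 h2 h3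
    rw [h1, h2, h3]
  rw [heq] at hrate
  have hgm : Measurable fun ω => ∫ ω', θ' (concat p ω ω') ∂(pathLaw μ) :=
    ((hm.comp (measurable_concat p)).stronglyMeasurable.integral_prod_right'
      (ν := pathLaw μ)).measurable
  rw [integral_eq_lintegral_of_nonneg_ae (ae_of_all _ fun ω => abs_nonneg _)
    (show Measurable fun ω => |θ' ω - ∫ ω', θ' (concat p ω ω') ∂(pathLaw μ)| from
      (hm.sub hgm).abs).aestronglyMeasurable]
  refine ENNReal.toReal_le_of_le_ofReal (by positivity) ?_
  have h3 : ENNReal.ofReal (b * Real.exp (-(β * p))) =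
      ENNReal.ofReal b / ENNReal.ofReal (Real.exp (β * p)) := by
    rw [Real.exp_neg, ← div_eq_mul_inv, ENNReal.ofReal_div_of_pos (Real.exp_pos _)]
  rw [h3, ENNReal.le_div_iff_mul_le (Or.inl (by simp [Real.exp_pos]))
    (Or.inl ENNReal.ofReal_ne_top), mul_comm]
  exact hrate

variable [MulAction G X] [MeasurableSpace X] [MeasurableMul₂ G] [MeasurableSMul₂ G X]
  {ν : Measure X} [IsProbabilityMeasure ν] {lam : Measure ℝ} [IsFiniteMeasure lam] {σ : G → X → ℝ}

/-- Exponential moments of the step and of the starting height are uniform, so that only those of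
the perturbation have to be checked. -/
theorem exists_perturbedSystem {M : ℝ} (hσ : CenteredCocycle μ σ M)
    {α₀ M₀ : ℝ} (hα₀ : 0 < α₀) (hM₀ : 0 ≤ M₀)
    (hσexp : ∀ x, ∫⁻ g, ENNReal.ofReal (Real.exp (α₀ * |σ g x|)) ∂μ ≤ ENNReal.ofReal M₀)
    {K : ℝ} (hK : ∀ᵐ t ∂lam, |t| ≤ K) (hα : 0 < α) (hb : 1 ≤ b) :
    ∃ a C : ℝ, 0 < a ∧ a ≤ α / 2 ∧ 0 ≤ C ∧ (2 * b + 1) * lam.real Set.univ ≤ C ∧ ∀ F θ,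
      (∀ k, Measurable (F k)) → Measurable θ → (∀ ω, 0 ≤ θ ω) → (∀ ω, θ ω ≤ b) →
      (∀ k, ExpBounded ((pathLaw μ).prod (ν.prod lam)) a C (alongOrbit F k)) →
      PerturbedSystem μ (ν.prod lam) σ a C b F θ := by
  have hb0 : 0 ≤ b := by linarith
  set a := min α₀ (α / 2) with ha_def
  have ha : 0 < a := lt_min hα₀ (by linarith)
  have ha1 : a ≤ α₀ := min_le_left _ _
  have ha2 : a ≤ α / 2 := min_le_right _ _
  set Λ := lam.real Set.univ with hΛ
  have hΛ0 : 0 ≤ Λ := measureReal_nonneg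
  set C := (M₀ + Real.exp (a * K) + (2 * b + 1)) * Λ with hC_def
  have hC : 0 ≤ C := by positivity
  have hexpK := Real.exp_pos (a * K)
  have hC1 : M₀ * Λ ≤ C := mul_le_mul_of_nonneg_right (by linarith) hΛ0
  have hC2 : Real.exp (a * K) * Λ ≤ C := mul_le_mul_of_nonneg_right (by linarith) hΛ0
  have hC3 : (2 * b + 1) * Λ ≤ C := mul_le_mul_of_nonneg_right (by linarith) hΛ0
  exact ⟨a, C, ha, ha2, hC, hC3, fun F θ h1 h2 h3 h4 h5 =>
    ⟨h1, h2, h3, h4, h5, (expBounded_start hK ha.le).mono hC2, fun i =>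
      ((expBounded_step hσ.measurable hM₀ hσexp i).mono_exponent ha1).mono hC1⟩⟩

/-- The bound which `exists_perturbedSystem` asks for. -/
theorem IsAdmissiblePerturbation.expBounded_alongOrbit {f : ℕ → (ℕ → G) × X → ℝ}
    (hf : IsAdmissiblePerturbation μ ν α β b f) (hν : IsStationary μ ν) (hα : 0 < α) (hb : 1 ≤ b)
    {a C : ℝ} (ha : a ≤ α / 2) (hC : (2 * b + 1) * lam.real Set.univ ≤ C) (k : ℕ) :
    ExpBounded ((pathLaw μ).prod (ν.prod lam)) a C (alongOrbit f k) :=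
  ((PerturbedWalk.expBounded_alongOrbit hν hf.measurable (by linarith) k
    (hf.lintegral_exp_le k)).mono_exponent (by linarith)).mono
      (le_trans (mul_le_mul_of_nonneg_right (by linarith) measureReal_nonneg) hC)

set_option maxHeartbeats 1000000 in
/-- Admissible perturbations and twists are approximated by their averages over the steps after
time `window n`. -/
theorem exists_windowApprox (hν : IsStationary μ ν) {M : ℝ} (hσ : CenteredCocycle μ σ M)
    (hM : 0 ≤ M) {α₀ M₀ : ℝ} (hα₀ : 0 < α₀) (hM₀ : 0 ≤ M₀)
    (hσexp : ∀ x, ∫⁻ g, ENNReal.ofReal (Real.exp (α₀ * |σ g x|)) ∂μ ≤ ENNReal.ofReal M₀)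
    {Φ K : ℝ} (hΦ : 0 ≤ Φ) (hlam : ∀ s, lam s ≤ ENNReal.ofReal Φ * volume s)
    (hK : ∀ᵐ t ∂lam, |t| ≤ K) (hα : 0 < α) (hβ : 0 < β) (hb : 1 ≤ b) :
    ∃ a C c A : ℝ, 0 < a ∧ 0 ≤ C ∧ 0 < c ∧ c ≤ a / 2 ∧ 0 ≤ A ∧ ∀ f θ,
      IsAdmissiblePerturbation μ ν α β b f → IsBoundedTwist μ β b θ →
        WindowApprox μ (ν.prod lam) σ a C b c A f θ := by
  have hb0 : 0 ≤ b := by linarith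
  have hb1 : 0 < b := by linarith
  obtain ⟨a, C, ha, ha2, hC, hC3, hsys⟩ :=
    exists_perturbedSystem (ν := ν) hσ hα₀ hM₀ hσexp hK hα hb
  set Λ := lam.real Set.univ with hΛ
  have hΛ0 : 0 ≤ Λ := measureReal_nonneg
  set c := min (β / 2) (a / 2) with hc_def
  have hc : 0 < c := lt_min (by linarith) (by linarith)
  have hc1 : c ≤ β / 2 := min_le_left _ _
  set A₁ := (Λ + 2 * b * Φ) * (b / α + b) with hA₁
  have hA₁0 : 0 ≤ A₁ := by positivity
  set A₂ := 4 * (3 * (2 / a ^ 2 * C) + M * Λ) with hA₂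
  have hA₂0 : 0 ≤ A₂ := by positivity
  set A := A₁ + A₂ + b * A₁ + 2 * b * Λ * (b / α + b) with hA_def
  refine ⟨a, C, c, A, ha, hC, hc, min_le_right _ _, by positivity, fun f θ hf hθ => ?_⟩
  have hfs : PerturbedSystem μ (ν.prod lam) σ a C b f θ :=
    hsys f θ hf.measurable hθ.measurable hθ.nonneg hθ.le fun k =>
      hf.expBounded_alongOrbit hν hα hb ha2 hC3 k
  refine ⟨hfs, fun n hn => ?_⟩
  set p := window n with hp
  set F : ℕ → (ℕ → G) × X → ℝ := fun k => pastMean μ p (f k) with hF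
  set θ' : (ℕ → G) → ℝ := fun ω => ∫ ω', θ (concat p ω ω') ∂(pathLaw μ) with hθ'
  have hFm : ∀ k, Measurable (F k) := fun k => measurable_pastMean μ p (hf.measurable k)
  have hθm : Measurable θ' :=
    ((hθ.measurable.comp (measurable_concat p)).stronglyMeasurable.integral_prod_right'
      (ν := pathLaw μ)).measurable
  have hFs : LookAheadSystem μ (ν.prod lam) σ a C b p F θ' := by
    refine ⟨hsys F θ' hFm hθm (fun ω => integral_nonneg fun ω' => hθ.nonneg _) (fun ω => ?_)
      fun k => ?_, fun k => isPast_pastMean μ p (f k), fun ω ω' => ?_⟩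
    · calc θ' ω ≤ ∫ _, b ∂(pathLaw μ) :=
            integral_mono_of_nonneg (ae_of_all _ fun ω' => hθ.nonneg _) (integrable_const b)
              (ae_of_all _ fun ω' => hθ.le _)
        _ = b := by simp
    · exact ((expBounded_alongOrbit hν hFm (by linarith) k
        (hf.lintegral_exp_pastMean_le hα hβ hb0 k p)).mono_exponent ha2).mono hC3
    · simp only [hθ', concat_concat_left le_rfl]
  refine ⟨F, θ', hFs, fun k hk => ?_⟩
  set δ := (b / α + b) * Real.exp (-(β * p)) with hδ
  have hδ0 : 0 ≤ δ := by positivity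
  have hfd : ∀ k, Integrable (fun y => |f k y - F k y|) ((pathLaw μ).prod ν) ∧
      ∫ y, |f k y - F k y| ∂((pathLaw μ).prod ν) ≤ δ := fun k => by
    obtain ⟨h1, h2⟩ := hf.integral_abs_sub_pastMean_le hα hb0 k p
    refine ⟨h1, h2.trans ?_⟩
    rw [hδ]
    gcongr
    linarith
  have hθd : ∫ ω, |θ ω - θ' ω| ∂(pathLaw μ) ≤ δ := by
    refine (hθ.approx p).trans ?_
    rw [hδ]
    gcongr
    have : 0 ≤ b / α := by positivity
    linarith
  have hn1 : (1 : ℝ) ≤ n := by exact_mod_cast hn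
  have hkn : (k : ℝ) ≤ n := by exact_mod_cast hk
  have hp0 : (0 : ℝ) ≤ p := Nat.cast_nonneg p
  set e := Real.exp (-(c * p)) with he
  have he0 : 0 < e := Real.exp_pos _
  have hcp : c * p ≤ β / 2 * p := mul_le_mul_of_nonneg_right hc1 hp0
  have hβp : 0 ≤ β / 2 * p := by positivity
  have hη : Real.exp (-(β / 2 * p)) ≤ e := Real.exp_le_exp.2 (by linarith)
  have hβe : Real.exp (-(β * p)) ≤ e := Real.exp_le_exp.2 (by linarith)
  have hk1 : Λ + 2 * b * Φ * k ≤ (Λ + 2 * b * Φ) * n := by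
    have h1 : Λ * 1 ≤ Λ * n := by gcongr
    have h2 : 2 * b * Φ * k ≤ 2 * b * Φ * n := by gcongr
    linarith
  have hA1A : A₁ ≤ A := by
    have : 0 ≤ b * A₁ + 2 * b * Λ * (b / α + b) := by positivity
    linarith
  constructor
  · have h1 : |aliveMass μ (ν.prod lam) σ f θ k - aliveMass μ (ν.prod lam) σ F θ' k| ≤
        (Λ + 2 * b * Φ * k) * δ := by
      rw [aliveMass, aliveMass, ← integral_sub (hfs.integrable_weight hσ k)
        (hFs.integrable_weight hσ k)]
      exact abs_integral_le_integral_abs.trans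
        (hfs.integral_abs_weight_sub_le hFs.toPerturbedSystem hσ hν hΦ hlam hfd hθd k)
    calc _ ≤ _ := h1
      _ ≤ (Λ + 2 * b * Φ) * n * ((b / α + b) * e) := by rw [hδ]; gcongr
      _ = A₁ * n * e := by ring
      _ ≤ _ := by gcongr
  · have h1 := hfs.abs_aliveHeight_sub_aliveHeight_le hFs.toPerturbedSystem hσ hν ha hC hb1 hΦ hlam
      hfd hθd (Real.exp_pos (-(β / 2 * p))) k
    have e1 : Real.exp (-(β / 2 * p)) * (4 * (3 * (2 / a ^ 2 * C) + M * Λ * k)) ≤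
        A₂ * n * e := by
      have h2 : 4 * (3 * (2 / a ^ 2 * C) + M * Λ * k) ≤ A₂ * n := by
        have h3 : 3 * (2 / a ^ 2 * C) * 1 ≤ 3 * (2 / a ^ 2 * C) * n := by gcongr
        have h4 : M * Λ * k ≤ M * Λ * n := by gcongr
        rw [hA₂]
        linarith
      rw [mul_comm]
      gcongr
    have e2 : b / Real.exp (-(β / 2 * p)) * ((Λ + 2 * b * Φ * k) * δ) ≤ b * A₁ * n * e := by
      have h2 : δ / Real.exp (-(β / 2 * p)) = (b / α + b) * Real.exp (-(β / 2 * p)) := by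
        rw [hδ, mul_div_assoc, ← Real.exp_sub]
        congr 2
        ring
      calc _ = b * (Λ + 2 * b * Φ * k) * (δ / Real.exp (-(β / 2 * p))) := by ring
        _ ≤ b * ((Λ + 2 * b * Φ) * n) * ((b / α + b) * e) := by rw [h2]; gcongr
        _ = _ := by ring
    have e3 : 2 * b * Λ * δ ≤ 2 * b * Λ * (b / α + b) * n * e := by
      calc 2 * b * Λ * δ ≤ 2 * b * Λ * ((b / α + b) * e) := by rw [hδ]; gcongr
        _ = 2 * b * Λ * (b / α + b) * 1 * e := by ring
        _ ≤ _ := by gcongr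
    have e4 : 0 ≤ A₁ * n * e := by positivity
    clear_value A₁ A₂ e
    calc _ ≤ _ := h1
      _ ≤ A₂ * n * e + b * A₁ * n * e + 2 * b * Λ * (b / α + b) * n * e :=
          add_le_add (add_le_add e1 e2) e3
      _ ≤ A₁ * n * e + (A₂ * n * e + b * A₁ * n * e + 2 * b * Λ * (b / α + b) * n * e) := by
          linarith
      _ = _ := by rw [hA_def]; ring

end AdmissibleSystems

/-! ### Vague limits of increasing functions -/

section VagueLimit

/-- Every interval carries a nonnegative test function. -/
theorem exists_tent {s t : ℝ} (h : s < t) : ∃ ψ : ℝ → ℝ, Continuous ψ ∧ HasCompactSupport ψ ∧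
    (∀ x, 0 ≤ ψ x) ∧ (∀ x, ψ x ≠ 0 → s ≤ x ∧ x ≤ t) ∧ 0 < ∫ x, ψ x := by
  set ψ : ℝ → ℝ := fun x => max 0 (min (x - s) (t - x)) with hψ
  have hc : Continuous ψ := by fun_prop
  have hn : ∀ x, 0 ≤ ψ x := fun x => le_max_left _ _
  have hs : ∀ x, ψ x ≠ 0 → s ≤ x ∧ x ≤ t := by
    intro x hx
    by_contra hcon
    refine hx (max_eq_left ?_)
    rw [not_and_or, not_le, not_le] at hcon
    rcases hcon with h1 | h1
    · exact (min_le_left _ _).trans (by linarith)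
    · exact (min_le_right _ _).trans (by linarith)
  have hk : HasCompactSupport ψ :=
    HasCompactSupport.intro (isCompact_Icc (a := s) (b := t)) fun x hx => by
      by_contra hne
      exact hx (hs x hne)
  refine ⟨ψ, hc, hk, hn, hs, ?_⟩
  refine hc.integral_pos_of_hasCompactSupport_nonneg_nonzero hk hn (x := (s + t) / 2) ?_
  have : 0 < min ((s + t) / 2 - s) (t - (s + t) / 2) := lt_min (by linarith) (by linarith)
  exact (lt_max_of_lt_right this).ne'

theorem integrable_monotone_mul {V : ℝ → ℝ} (hV : Monotone V) {ψ : ℝ → ℝ} (hψ : Continuous ψ)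
    (hk : HasCompactSupport ψ) : Integrable fun t => V t * ψ t := by
  have := hV.locallyIntegrable (μ := volume)
  simpa only [smul_eq_mul, mul_comm] using
    this.integrable_smul_left_of_hasCompactSupport hψ hk

theorem mul_integral_le_and_le {V : ℝ → ℝ} (hV : Monotone V) {s t : ℝ} {ψ : ℝ → ℝ}
    (hψ : Continuous ψ) (hk : HasCompactSupport ψ) (hn : ∀ x, 0 ≤ ψ x)
    (hs : ∀ x, ψ x ≠ 0 → s ≤ x ∧ x ≤ t) :
    V s * ∫ x, ψ x ≤ ∫ x, V x * ψ x ∧ ∫ x, V x * ψ x ≤ V t * ∫ x, ψ x := by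
  have hi := integrable_monotone_mul hV hψ hk
  have hi' := hψ.integrable_of_hasCompactSupport hk (μ := volume)
  rw [← integral_const_mul, ← integral_const_mul]
  constructor
  · refine integral_mono (hi'.const_mul _) hi fun x => ?_
    by_cases hx : ψ x = 0
    · simp [hx]
    · exact mul_le_mul_of_nonneg_right (hV (hs x hx).1) (hn x)
  · refine integral_mono hi (hi'.const_mul _) fun x => ?_
    by_cases hx : ψ x = 0
    · simp [hx]
    · exact mul_le_mul_of_nonneg_right (hV (hs x hx).2) (hn x)

/-- A sequence of nonnegative increasing functions whose integrals against nonnegative test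
functions converge has an increasing vague limit, namely its pointwise upper limit: at two points
`s < t`, the upper limit at `s` is at most the lower limit at `t`, so that the sequence converges at
all points of continuity of the upper limit. -/
theorem exists_monotone_vague_limit {V : ℕ → ℝ → ℝ} (hV : ∀ n, Monotone (V n))
    (hV0 : ∀ n t, 0 ≤ V n t)
    (hconv : ∀ ψ : ℝ → ℝ, Continuous ψ → HasCompactSupport ψ → (∀ x, 0 ≤ ψ x) →
      ∃ l, Tendsto (fun n => ∫ t, V n t * ψ t) atTop (𝓝 l)) :
    ∃ U : ℝ → ℝ, Monotone U ∧ (∀ t, 0 ≤ U t) ∧ ∀ ψ : ℝ → ℝ, Continuous ψ → HasCompactSupport ψ →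
      Tendsto (fun n => ∫ t, V n t * ψ t) atTop (𝓝 (∫ t, U t * ψ t)) := by
  have hbd : ∀ t, ∃ K, ∀ n, V n t ≤ K := by
    intro t
    obtain ⟨ψ, hψ, hk, hn, hs, hI⟩ := exists_tent (lt_add_one t)
    obtain ⟨l, hl⟩ := hconv ψ hψ hk hn
    obtain ⟨K, hK⟩ := hl.bddAbove_range
    refine ⟨K / ∫ x, ψ x, fun n => ?_⟩
    rw [le_div_iff₀ hI]
    exact (mul_integral_le_and_le (hV n) hψ hk hn hs).1.trans (hK ⟨n, rfl⟩)
  have hba : ∀ t, IsBoundedUnder (· ≤ ·) atTop fun n => V n t := fun t => by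
    obtain ⟨K, hK⟩ := hbd t
    exact ⟨K, eventually_map.2 (Eventually.of_forall hK)⟩
  have hbb : ∀ t, IsBoundedUnder (· ≥ ·) atTop fun n => V n t := fun t =>
    ⟨0, eventually_map.2 (Eventually.of_forall fun n => hV0 n t)⟩
  set U : ℝ → ℝ := fun t => limsup (fun n => V n t) atTop with hU
  have hst : ∀ s t, s < t → U s ≤ liminf (fun n => V n t) atTop := by
    intro s t h
    obtain ⟨ψ, hψ, hk, hn, hs, hI⟩ := exists_tent h
    obtain ⟨l, hl⟩ := hconv ψ hψ hk hn
    have hl' := hl.div_const (∫ x, ψ x)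
    have h1 : U s ≤ l / ∫ x, ψ x := by
      rw [← hl'.limsup_eq]
      refine limsup_le_limsup (Eventually.of_forall fun n => ?_) (hbb s).isCoboundedUnder_le
        hl'.isBoundedUnder_le
      exact (le_div_iff₀ hI).2 (mul_integral_le_and_le (hV n) hψ hk hn hs).1
    refine h1.trans ?_
    rw [← hl'.liminf_eq]
    refine liminf_le_liminf (Eventually.of_forall fun n => ?_) hl'.isBoundedUnder_ge
      (hba t).isCoboundedUnder_ge
    exact (div_le_iff₀ hI).2 (mul_integral_le_and_le (hV n) hψ hk hn hs).2
  have hle : ∀ t, liminf (fun n => V n t) atTop ≤ U t := fun t =>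
    liminf_le_limsup (hba t) (hbb t)
  have hUm : Monotone U := by
    intro s t h
    rcases h.eq_or_lt with rfl | h
    · exact le_rfl
    · exact (hst s t h).trans (hle t)
  have hU0 : ∀ t, 0 ≤ U t := fun t =>
    le_limsup_of_frequently_le (Frequently.of_forall fun n => hV0 n t) (hba t)
  refine ⟨U, hUm, hU0, fun ψ hψ hk => ?_⟩
  have hlim : ∀ t, ContinuousAt U t → Tendsto (fun n => V n t) atTop (𝓝 (U t)) := by
    intro t ht
    refine tendsto_of_le_liminf_of_limsup_le ?_ le_rfl (hba t) (hbb t)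
    have h1 : Tendsto U (𝓝[<] t) (𝓝 (U t)) := ht.tendsto.mono_left nhdsWithin_le_nhds
    exact le_of_tendsto h1 (eventually_nhdsWithin_of_forall fun s hs => hst s t hs)
  have hae : ∀ᵐ t : ℝ, ContinuousAt U t := by
    have := hUm.countable_not_continuousAt.ae_notMem volume
    filter_upwards [this] with t ht
    exact not_not.1 ht
  obtain ⟨R, hR⟩ := hk.isCompact.isBounded.subset_closedBall 0
  obtain ⟨K, hK⟩ := hbd R
  refine tendsto_integral_of_dominated_convergence (fun t => K * |ψ t|)
    (fun n => (integrable_monotone_mul (hV n) hψ hk).aestronglyMeasurable)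
    ((hψ.integrable_of_hasCompactSupport hk).abs.const_mul K) (fun n => ae_of_all _ fun t => ?_) ?_
  · rw [norm_mul, Real.norm_of_nonneg (hV0 n t), Real.norm_eq_abs]
    by_cases ht : ψ t = 0
    · simp [ht]
    · refine mul_le_mul_of_nonneg_right ?_ (abs_nonneg _)
      have h1 := hR (subset_tsupport _ ht)
      rw [Metric.mem_closedBall, Real.dist_eq, sub_zero] at h1
      exact (hV n (le_of_abs_le h1)).trans (hK n)
  · filter_upwards [hae] with t ht
    exact (hlim t ht).mul_const _

end VagueLimit

/-! ### Test functions as laws of the starting height -/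

section TestFunctions

/-- The measure with density `φ` with respect to the Lebesgue measure. -/
noncomputable def weighted (φ : ℝ → ℝ) : Measure ℝ :=
  volume.withDensity fun t => ENNReal.ofReal (φ t)

theorem exists_weighted_bounds {φ : ℝ → ℝ} (hφ : Continuous φ) (hk : HasCompactSupport φ) :
    IsFiniteMeasure (weighted φ) ∧ (∃ Φ, 0 ≤ Φ ∧ ∀ s, weighted φ s ≤ ENNReal.ofReal Φ * volume s) ∧
      ∃ K, ∀ᵐ t ∂(weighted φ), |t| ≤ K := by
  obtain ⟨R, hR⟩ := hk.isCompact.isBounded.subset_closedBall 0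
  obtain ⟨Φ, hΦ⟩ := hφ.bounded_above_of_compact_support hk
  have hi := hφ.integrable_of_hasCompactSupport hk (μ := volume)
  refine ⟨isFiniteMeasure_withDensity_ofReal hi.2, ⟨Φ, (norm_nonneg _).trans (hΦ 0), fun s => ?_⟩,
    R, ?_⟩
  · have h1 : weighted φ ≤ volume.withDensity fun _ => ENNReal.ofReal Φ :=
      withDensity_mono (ae_of_all _ fun t => ENNReal.ofReal_le_ofReal
        ((Real.le_norm_self _).trans (hΦ t)))
    rw [withDensity_const] at h1
    exact h1 s
  · rw [weighted, ae_withDensity_iff (by fun_prop)]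
    refine ae_of_all _ fun t ht => ?_
    have h1 : t ∈ Function.support φ := fun h => ht (by simp [h])
    have h2 := hR (subset_tsupport _ h1)
    rwa [Metric.mem_closedBall, Real.dist_eq, sub_zero] at h2

theorem integral_weighted {φ : ℝ → ℝ} (hφ : Continuous φ) (hn : ∀ t, 0 ≤ φ t) (g : ℝ → ℝ) :
    ∫ t, g t ∂(weighted φ) = ∫ t, φ t * g t := by
  rw [weighted, integral_withDensity_eq_integral_toReal_smul (by fun_prop)
    (ae_of_all _ fun t => ENNReal.ofReal_lt_top)]
  simp only [ENNReal.toReal_ofReal (hn _), smul_eq_mul]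

variable {G X : Type*} [Group G] [MulAction G X] [MeasurableSpace G] [MeasurableSpace X]
  [MeasurableMul₂ G] [MeasurableSMul₂ G X]
variable {μ : Measure G} [IsProbabilityMeasure μ] {ν : Measure X} [IsProbabilityMeasure ν]
  {lam : Measure ℝ} [IsFiniteMeasure lam] {σ : G → X → ℝ} {a C B M : ℝ}
  {f : ℕ → (ℕ → G) × X → ℝ} {θ θ' : (ℕ → G) → ℝ}

omit [MeasurableSpace G] [MeasurableSpace X] [MeasurableMul₂ G] [MeasurableSMul₂ G X] in
theorem mem_survival_iff_mem_alive (x : X) (t : ℝ) (n : ℕ) (ω : ℕ → G) :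
    ω ∈ survival σ f x t n ↔ (ω, (x, t)) ∈ alive σ f n := mem_survival_iff σ f x t n ω

theorem measurableSet_survival (hσ : Measurable (Function.uncurry σ)) (hf : ∀ k, Measurable (f k))
    (x : X) (t : ℝ) (n : ℕ) : MeasurableSet (survival σ f x t n) := by
  have : survival σ f x t n = (fun ω => (ω, (x, t))) ⁻¹' alive σ f n := by
    ext ω
    exact mem_survival_iff_mem_alive x t n ω
  rw [this]
  exact (measurable_id.prodMk measurable_const) (measurableSet_alive hσ hf n)

theorem setIntegral_survival (hσ : Measurable (Function.uncurry σ)) (hf : ∀ k, Measurable (f k))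
    (hθ : θ =ᵐ[pathLaw μ] θ') (x : X) (t : ℝ) (n : ℕ) :
    ∫ ω in survival σ f x t n, θ ω ∂(pathLaw μ) =
      ∫ ω, aliveWeight σ f θ' n (ω, (x, t)) ∂(pathLaw μ) := by
  rw [← integral_indicator (measurableSet_survival hσ hf x t n)]
  refine integral_congr_ae ?_
  filter_upwards [hθ] with ω hω
  by_cases hs : ω ∈ survival σ f x t n
  · rw [aliveWeight, Set.indicator_of_mem hs,
      Set.indicator_of_mem ((mem_survival_iff_mem_alive x t n ω).1 hs), hω]
  · rw [aliveWeight, Set.indicator_of_notMem hs,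
      Set.indicator_of_notMem (mt (mem_survival_iff_mem_alive x t n ω).2 hs)]

theorem setIntegral_survival_mul (hσ : Measurable (Function.uncurry σ))
    (hf : ∀ k, Measurable (f k)) (hθ : θ =ᵐ[pathLaw μ] θ') (x : X) (t : ℝ) (n : ℕ) :
    ∫ ω in survival σ f x t n, perturbedWalk σ f x t n ω * θ ω ∂(pathLaw μ) =
      ∫ ω, aliveWeight σ f θ' n (ω, (x, t)) * height σ f n (ω, (x, t)) ∂(pathLaw μ) := by
  rw [← integral_indicator (measurableSet_survival hσ hf x t n)]
  refine integral_congr_ae ?_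
  filter_upwards [hθ] with ω hω
  by_cases hs : ω ∈ survival σ f x t n
  · rw [aliveWeight, Set.indicator_of_mem hs,
      Set.indicator_of_mem ((mem_survival_iff_mem_alive x t n ω).1 hs), hω, mul_comm]
    rfl
  · rw [aliveWeight, Set.indicator_of_notMem hs,
      Set.indicator_of_notMem (mt (mem_survival_iff_mem_alive x t n ω).2 hs), zero_mul]

theorem preharmonic_eq (hσ : Measurable (Function.uncurry σ)) (hf : ∀ k, Measurable (f k))
    (hθ : θ =ᵐ[pathLaw μ] θ') (n : ℕ) (t : ℝ) :
    preharmonic μ ν σ f θ n t =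
      ∫ x, ∫ ω, aliveWeight σ f θ' n (ω, (x, t)) * height σ f n (ω, (x, t)) ∂(pathLaw μ) ∂ν := by
  simp only [preharmonic, setIntegral_survival_mul hσ hf hθ]

namespace PerturbedSystem

theorem integrable_weight_mul_height (h : PerturbedSystem μ (ν.prod lam) σ a C B f θ')
    (hσ : CenteredCocycle μ σ M) (ha : 0 < a) (n : ℕ) :
    Integrable (fun z => aliveWeight σ f θ' n z * height σ f n z)
      ((pathLaw μ).prod (ν.prod lam)) :=
  h.integrable_weight_mul hσ n ((h.memLp_height hσ ha n).integrable one_le_two)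

/-- The mean height is the integral of the preharmonic function against the law of the starting
height. -/
theorem integral_preharmonic (h : PerturbedSystem μ (ν.prod lam) σ a C B f θ')
    (hσ : CenteredCocycle μ σ M) (ha : 0 < a) (hθ : θ =ᵐ[pathLaw μ] θ') (n : ℕ) :
    ∫ t, preharmonic μ ν σ f θ n t ∂lam = aliveHeight μ (ν.prod lam) σ f θ' n := by
  have hi := h.integrable_weight_mul_height hσ ha n
  have hi2 := hi.integral_prod_right
  have heq : preharmonic μ ν σ f θ n = fun t =>
      ∫ x, ∫ ω, aliveWeight σ f θ' n (ω, (x, t)) * height σ f n (ω, (x, t)) ∂(pathLaw μ) ∂ν :=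
    funext fun t => preharmonic_eq hσ.measurable h.measurable_F hθ n t
  rw [heq, aliveHeight, integral_prod_symm _ hi, integral_prod_symm _ hi2]

/-- A single value of the preharmonic function is the mean height for a Dirac starting height. -/
theorem preharmonic_eq_aliveHeight {t : ℝ}
    (h : PerturbedSystem μ (ν.prod (Measure.dirac t)) σ a C B f θ') (hσ : CenteredCocycle μ σ M)
    (ha : 0 < a) (hθ : θ =ᵐ[pathLaw μ] θ') (n : ℕ) :
    preharmonic μ ν σ f θ n t = aliveHeight μ (ν.prod (Measure.dirac t)) σ f θ' n := by
  rw [← h.integral_preharmonic hσ ha hθ n, integral_dirac]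

theorem preharmonic_eq_integral {t : ℝ}
    (h : PerturbedSystem μ (ν.prod (Measure.dirac t)) σ a C B f θ') (hσ : CenteredCocycle μ σ M)
    (ha : 0 < a) (hθ : θ =ᵐ[pathLaw μ] θ') (n : ℕ) :
    Integrable (fun y : (ℕ → G) × X => aliveWeight σ f θ' n (y.1, (y.2, t)) *
      height σ f n (y.1, (y.2, t))) ((pathLaw μ).prod ν) ∧
    preharmonic μ ν σ f θ n t = ∫ y : (ℕ → G) × X, aliveWeight σ f θ' n (y.1, (y.2, t)) *
      height σ f n (y.1, (y.2, t)) ∂((pathLaw μ).prod ν) := by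
  have hi := h.integrable_weight_mul_height hσ ha n
  have has := (measurePreserving_prodAssoc (pathLaw μ) ν (Measure.dirac t))
  have hi' : Integrable (fun y : ((ℕ → G) × X) × ℝ =>
      aliveWeight σ f θ' n (y.1.1, (y.1.2, y.2)) * height σ f n (y.1.1, (y.1.2, y.2)))
      (((pathLaw μ).prod ν).prod (Measure.dirac t)) := has.integrable_comp_of_integrable hi
  have h1 : Integrable (fun y : (ℕ → G) × X => aliveWeight σ f θ' n (y.1, (y.2, t)) *
      height σ f n (y.1, (y.2, t))) ((pathLaw μ).prod ν) := by
    have := hi'.prod_left_ae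
    rw [ae_dirac_eq] at this
    exact this
  refine ⟨h1, ?_⟩
  rw [preharmonic_eq hσ.measurable h.measurable_F hθ, integral_prod_symm _ h1]

/-- The preharmonic functions are increasing: raising the starting height raises the perturbed walk
and delays its exit time. -/
theorem preharmonic_le_preharmonic {s t a' C' : ℝ} (hst : s ≤ t)
    (hs : PerturbedSystem μ (ν.prod (Measure.dirac s)) σ a C B f θ')
    (ht : PerturbedSystem μ (ν.prod (Measure.dirac t)) σ a' C' B f θ')
    (hσ : CenteredCocycle μ σ M) (ha : 0 < a) (ha' : 0 < a') (hθ : θ =ᵐ[pathLaw μ] θ') {n : ℕ}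
    (hn : 1 ≤ n) : preharmonic μ ν σ f θ n s ≤ preharmonic μ ν σ f θ n t := by
  have h0 := ht.θ_nonneg
  obtain ⟨is, hs⟩ := hs.preharmonic_eq_integral hσ ha hθ n
  obtain ⟨it, ht⟩ := ht.preharmonic_eq_integral hσ ha' hθ n
  rw [hs, ht]
  refine integral_mono is it fun y => ?_
  have hh : ∀ k, height σ f k (y.1, (y.2, s)) ≤ height σ f k (y.1, (y.2, t)) := fun k => by
    simp only [height_eq, alongOrbit]
    linarith
  have h0 := h0 y.1
  simp only [aliveWeight]
  by_cases h1 : (y.1, (y.2, s)) ∈ alive σ f n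
  · have h2 : (y.1, (y.2, t)) ∈ alive σ f n := fun j hj hjn => (h1 j hj hjn).trans (hh j)
    rw [Set.indicator_of_mem h1, Set.indicator_of_mem h2]
    exact mul_le_mul_of_nonneg_left (hh n) h0
  · rw [Set.indicator_of_notMem h1, zero_mul]
    by_cases h2 : (y.1, (y.2, t)) ∈ alive σ f n
    · rw [Set.indicator_of_mem h2]
      exact mul_nonneg h0 (h2 n hn le_rfl)
    · rw [Set.indicator_of_notMem h2, zero_mul]

end PerturbedSystem

/-- The mass, as an iterated integral. -/
theorem integral_survival_eq (hσ : Measurable (Function.uncurry σ))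
    (hf : ∀ k, Measurable (f k)) (hθ : θ =ᵐ[pathLaw μ] θ') (hθm : Measurable θ')
    (hθ0 : ∀ ω, 0 ≤ θ' ω) (hθB : ∀ ω, θ' ω ≤ B) {φ : ℝ → ℝ} (hφ : Integrable φ) (n : ℕ) :
    Integrable (fun y : X × ℝ => φ y.2 * ∫ ω in survival σ f y.1 y.2 n, θ ω ∂(pathLaw μ))
      (ν.prod volume) ∧
    ∫ x, (∫ t, φ t * (∫ ω in survival σ f x t n, θ ω ∂(pathLaw μ))) ∂ν =
      ∫ y : X × ℝ, φ y.2 * (∫ ω in survival σ f y.1 y.2 n, θ ω ∂(pathLaw μ)) ∂(ν.prod volume) := by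
  have hB : 0 ≤ B := (hθ0 fun _ => 1).trans (hθB _)
  have hm : Measurable fun y : X × ℝ => ∫ ω, aliveWeight σ f θ' n (ω, y) ∂(pathLaw μ) :=
    (((measurable_aliveWeight hσ hf hθm n).comp measurable_swap).stronglyMeasurable
      |>.integral_prod_right' (ν := pathLaw μ)).measurable
  have hi : Integrable (fun y : X × ℝ =>
      φ y.2 * ∫ ω in survival σ f y.1 y.2 n, θ ω ∂(pathLaw μ)) (ν.prod volume) := by
    simp only [setIntegral_survival hσ hf hθ]
    refine (hφ.comp_snd ν).mul_bdd (c := B) hm.aestronglyMeasurable (ae_of_all _ fun y => ?_)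
    have h0 : ∀ ω, 0 ≤ aliveWeight σ f θ' n (ω, y) := fun ω =>
      Set.indicator_nonneg (fun _ _ => hθ0 _) _
    rw [Real.norm_of_nonneg (integral_nonneg h0)]
    calc _ ≤ ∫ _, B ∂(pathLaw μ) := integral_mono_of_nonneg (ae_of_all _ h0) (integrable_const B)
          (ae_of_all _ fun ω => Set.indicator_apply_le' (fun _ => hθB _) fun _ => hB)
      _ = B := by simp
  exact ⟨hi, (integral_prod _ hi).symm⟩

theorem integral_survival_eq_aliveMass {φ : ℝ → ℝ} [IsFiniteMeasure (weighted φ)]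
    (h : PerturbedSystem μ (ν.prod (weighted φ)) σ a C B f θ') (hσ : CenteredCocycle μ σ M)
    (hθ : θ =ᵐ[pathLaw μ] θ') (hφ : Continuous φ) (hn : ∀ t, 0 ≤ φ t) (n : ℕ) :
    ∫ x, (∫ t, φ t * (∫ ω in survival σ f x t n, θ ω ∂(pathLaw μ))) ∂ν =
      aliveMass μ (ν.prod (weighted φ)) σ f θ' n := by
  have hi := h.integrable_weight hσ n
  have hi2 := hi.integral_prod_right
  rw [aliveMass, integral_prod_symm _ hi, integral_prod _ hi2]
  simp only [integral_weighted hφ hn, setIntegral_survival hσ.measurable h.measurable_F hθ]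

theorem integral_preharmonic_mul {φ : ℝ → ℝ} [IsFiniteMeasure (weighted φ)]
    (h : PerturbedSystem μ (ν.prod (weighted φ)) σ a C B f θ') (hσ : CenteredCocycle μ σ M)
    (ha : 0 < a) (hθ : θ =ᵐ[pathLaw μ] θ') (hφ : Continuous φ) (hn : ∀ t, 0 ≤ φ t) (n : ℕ) :
    ∫ t, preharmonic μ ν σ f θ n t * φ t = aliveHeight μ (ν.prod (weighted φ)) σ f θ' n := by
  rw [← h.integral_preharmonic hσ ha hθ n, integral_weighted hφ hn]
  simp only [mul_comm]

end TestFunctions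

/-! ### The limit for nonnegative test functions -/

section Limit

variable {G X Ω' : Type*} [Group G] [MulAction G X] [MeasurableSpace G] [MeasurableSpace X]
  [MeasurableMul₂ G] [MeasurableSMul₂ G X] [MeasurableSpace Ω']
variable {μ : Measure G} [IsProbabilityMeasure μ] {ν : Measure X} [IsProbabilityMeasure ν]
  {σ : G → X → ℝ} {M v α₀ M₀ α β b : ℝ} {P' : Measure Ω'} {π : Ω' → ℕ → G} {W : ℝ≥0 → Ω' → ℝ}

omit [MulAction G X] [MeasurableSpace X] [MeasurableMul₂ G] [MeasurableSMul₂ G X]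
  [IsProbabilityMeasure μ] in
theorem HasExpMoment.exists_bound (h : HasExpMoment μ σ) : ∃ α₀ M₀ : ℝ, 0 < α₀ ∧ 0 ≤ M₀ ∧
    ∀ x, ∫⁻ g, ENNReal.ofReal (Real.exp (α₀ * |σ g x|)) ∂μ ≤ ENNReal.ofReal M₀ := by
  obtain ⟨α₀, hα₀, hfin⟩ := h
  refine ⟨α₀, (∫⁻ g, ⨆ x : X, ENNReal.ofReal (Real.exp (α₀ * |σ g x|)) ∂μ).toReal, hα₀,
    ENNReal.toReal_nonneg, fun x => ?_⟩
  rw [ENNReal.ofReal_toReal hfin.ne]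
  exact lintegral_mono fun g => le_iSup (fun x => ENNReal.ofReal (Real.exp (α₀ * |σ g x|))) x

omit [MeasurableMul₂ G] [MeasurableSMul₂ G X] [IsProbabilityMeasure μ] in
theorem CenteredCocycle.of_expMoment (hm : Measurable (Function.uncurry σ)) (hc : IsCocycle σ)
    (h0 : IsCentered μ σ) (hα₀ : 0 < α₀) (hM₀ : 0 ≤ M₀)
    (h : ∀ x, ∫⁻ g, ENNReal.ofReal (Real.exp (α₀ * |σ g x|)) ∂μ ≤ ENNReal.ofReal M₀) :
    CenteredCocycle μ σ (2 / α₀ ^ 2 * M₀) :=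
  ⟨hm, hc, h0, fun x => (⟨hm.comp (measurable_id.prodMk measurable_const), h x⟩ :
    ExpBounded μ α₀ M₀ fun g => σ g x).integral_sq_le hα₀ hM₀⟩

/-- For a nonnegative test function, the integrals of the preharmonic functions converge, and the
normalized survival probabilities are uniformly close to the limit. -/
theorem exists_uniform_survival_limit (hν : IsStationary μ ν) (hσ : CenteredCocycle μ σ M)
    (hM : 0 ≤ M) (hα₀ : 0 < α₀) (hM₀ : 0 ≤ M₀)
    (hσexp : ∀ x, ∫⁻ g, ENNReal.ofReal (Real.exp (α₀ * |σ g x|)) ∂μ ≤ ENNReal.ofReal M₀)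
    (hv : 0 < v) (hW : IsStrongApproximation μ σ v P' π W) (hα : 0 < α) (hβ : 0 < β) (hb : 1 ≤ b)
    {φ : ℝ → ℝ} (hφ : Continuous φ) (hk : HasCompactSupport φ) (hn : ∀ t, 0 ≤ φ t)
    {ε : ℝ} (hε : 0 < ε) :
    ∃ N : ℕ, ∀ f θ, IsAdmissiblePerturbation μ ν α β b f → IsAdmissibleTwist μ β b θ →
      ∃ l, Tendsto (fun n => ∫ t, preharmonic μ ν σ f θ n t * φ t) atTop (𝓝 l) ∧ ∀ n, N ≤ n →
        |v * √(2 * Real.pi * n) / 2 *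
          (∫ x, (∫ t, φ t * (∫ ω in survival σ f x t n, θ ω ∂(pathLaw μ))) ∂ν) - l| ≤ ε := by
  obtain ⟨hfin, ⟨Φ, hΦ, hlam⟩, K, hK⟩ := exists_weighted_bounds hφ hk
  obtain ⟨a, C, c, A, ha, hC, hc, hca, hA, happ⟩ :=
    exists_windowApprox hν hσ hM hα₀ hM₀ hσexp hΦ hlam hK hα hβ hb
  obtain ⟨D, hD, hstay⟩ := exists_stayProb_bounds hσ.measurable hv hW
  set κ := v * √(2 * Real.pi) / 2 with hκ
  have hκ0 : 0 < κ := by positivity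
  have hκn : ∀ n : ℕ, v * √(2 * Real.pi * n) / 2 = κ * √n := fun n => by
    rw [Real.sqrt_mul (by positivity), hκ]
    ring
  obtain ⟨C', hC', hrec⟩ := exists_recursionBounds (ρ := ν.prod (weighted φ)) hσ hM ha hC
    (by linarith : 0 ≤ b) hc hca hA hκ0.le hD.le fun x y N hN => by
      have h1 := hstay x y N hN
      have h2 : (N : ℝ) ^ (3 / 8 : ℝ) = root8 N ^ 3 := by
        rw [root8, ← Real.rpow_natCast, ← Real.rpow_mul (Nat.cast_nonneg N)]
        norm_num
      rwa [hκn, h2] at h1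
  obtain ⟨N, hN⟩ := RecursionBounds.uniform_limit C' κ hκ0 hC' hε
  refine ⟨N, fun f θ hf hθ => ?_⟩
  obtain ⟨θ', hθ', hae⟩ := hθ.exists_isBoundedTwist (by linarith)
  have hw := happ f θ' hf hθ'
  obtain ⟨l, hl, hlN⟩ := hN _ _ (hrec f θ' hw)
  refine ⟨l, ?_, fun n hnN => ?_⟩
  · simpa only [integral_preharmonic_mul hw.toPerturbedSystem hσ ha hae hφ hn] using hl
  · rw [integral_survival_eq_aliveMass hw.toPerturbedSystem hσ hae hφ hn, hκn]
    exact hlN n hnN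

/-- The preharmonic functions have an increasing vague limit. -/
theorem exists_isHarmonicLimit (hν : IsStationary μ ν) (hσ : CenteredCocycle μ σ M)
    (hα₀ : 0 < α₀) (hM₀ : 0 ≤ M₀)
    (hσexp : ∀ x, ∫⁻ g, ENNReal.ofReal (Real.exp (α₀ * |σ g x|)) ∂μ ≤ ENNReal.ofReal M₀)
    (hα : 0 < α) (hb : 1 ≤ b) {f : ℕ → (ℕ → G) × X → ℝ} {θ : (ℕ → G) → ℝ}
    (hf : IsAdmissiblePerturbation μ ν α β b f) (hθ : IsAdmissibleTwist μ β b θ)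
    (hconv : ∀ ψ : ℝ → ℝ, Continuous ψ → HasCompactSupport ψ → (∀ x, 0 ≤ ψ x) →
      ∃ l, Tendsto (fun n => ∫ t, preharmonic μ ν σ f θ n t * ψ t) atTop (𝓝 l)) :
    ∃ U : ℝ → ℝ, IsHarmonicLimit μ ν σ f θ U := by
  obtain ⟨θ', hθ', hae⟩ := hθ.exists_isBoundedTwist (by linarith)
  have hV : ∀ n, 1 ≤ n → Monotone (preharmonic μ ν σ f θ n) ∧
      ∀ t, 0 ≤ preharmonic μ ν σ f θ n t := by
    have hsys : ∀ t : ℝ, ∃ a C : ℝ, 0 < a ∧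
        PerturbedSystem μ (ν.prod (Measure.dirac t)) σ a C b f θ' := fun t => by
      have hK : ∀ᵐ s ∂(Measure.dirac t), |s| ≤ |t| := by
        rw [ae_dirac_eq]
        exact le_refl |t|
      obtain ⟨a, C, ha, ha2, -, hC3, hsys⟩ :=
        exists_perturbedSystem (ν := ν) hσ hα₀ hM₀ hσexp hK hα hb
      exact ⟨a, C, ha, hsys f θ' hf.measurable hθ'.measurable hθ'.nonneg hθ'.le fun k =>
        hf.expBounded_alongOrbit hν hα hb ha2 hC3 k⟩
    refine fun n hn => ⟨fun s t hst => ?_, fun t => ?_⟩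
    · obtain ⟨a, C, ha, hs⟩ := hsys s
      obtain ⟨a', C', ha', ht⟩ := hsys t
      exact hs.preharmonic_le_preharmonic hst ht hσ ha ha' hae hn
    · obtain ⟨a, C, ha, h⟩ := hsys t
      rw [h.preharmonic_eq_aliveHeight hσ ha hae]
      exact h.aliveHeight_nonneg hn
  obtain ⟨U, hU, hU0, hlim⟩ := exists_monotone_vague_limit
    (V := fun n => preharmonic μ ν σ f θ (n + 1)) (fun n => (hV _ (Nat.le_add_left 1 n)).1)
    (fun n t => (hV _ (Nat.le_add_left 1 n)).2 t) fun ψ hψ hk hn => by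
      obtain ⟨l, hl⟩ := hconv ψ hψ hk hn
      exact ⟨l, hl.comp (tendsto_add_atTop_nat 1)⟩
  exact ⟨U, hU, hU0, fun ψ hψ hk => (tendsto_add_atTop_iff_nat 1).1 (hlim ψ hψ hk)⟩

/-- The limit for arbitrary test functions follows from the limits for their positive and negative
parts. -/
theorem abs_sub_le_of_posPart_negPart (hσ : Measurable (Function.uncurry σ)) {α β b : ℝ}
    (hb : 0 ≤ b) {f : ℕ → (ℕ → G) × X → ℝ} {θ : (ℕ → G) → ℝ}
    (hf : IsAdmissiblePerturbation μ ν α β b f) (hθ : IsAdmissibleTwist μ β b θ) {U : ℝ → ℝ}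
    (hU : Monotone U) {φ : ℝ → ℝ} (hφ : Continuous φ) (hk : HasCompactSupport φ) (n : ℕ)
    {s δ : ℝ}
    (hpos : |s * (∫ x, (∫ t, max (φ t) 0 *
      (∫ ω in survival σ f x t n, θ ω ∂(pathLaw μ))) ∂ν) - ∫ t, U t * max (φ t) 0| ≤ δ)
    (hneg : |s * (∫ x, (∫ t, max (-φ t) 0 *
      (∫ ω in survival σ f x t n, θ ω ∂(pathLaw μ))) ∂ν) - ∫ t, U t * max (-φ t) 0| ≤ δ) :
    |s * (∫ x, (∫ t, φ t * (∫ ω in survival σ f x t n, θ ω ∂(pathLaw μ))) ∂ν) -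
      ∫ t, φ t * U t| ≤ 2 * δ := by
  obtain ⟨θ', hθ', hae⟩ := hθ.exists_isBoundedTwist hb
  have c1 : Continuous fun t => max (φ t) 0 := by fun_prop
  have c2 : Continuous fun t => max (-φ t) 0 := by fun_prop
  have k1 : HasCompactSupport fun t => max (φ t) 0 :=
    hk.comp_left (g := fun u : ℝ => max u 0) (by simp)
  have k2 : HasCompactSupport fun t => max (-φ t) 0 :=
    hk.comp_left (g := fun u : ℝ => max (-u) 0) (by simp)
  have hsub : ∀ t, φ t = max (φ t) 0 - max (-φ t) 0 := fun t => by
    rcases le_total (φ t) 0 with h | h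
    · rw [max_eq_right h, max_eq_left (by linarith)]; ring
    · rw [max_eq_left h, max_eq_right (by linarith)]; ring
  have hJ := fun ψ (hψ : Integrable ψ) =>
    integral_survival_eq (ν := ν) hσ hf.measurable hae hθ'.measurable hθ'.nonneg hθ'.le (φ := ψ)
      hψ n
  have i0 := hφ.integrable_of_hasCompactSupport hk (μ := volume)
  obtain ⟨i1, h1⟩ := hJ _ (c1.integrable_of_hasCompactSupport k1)
  obtain ⟨i2, h2⟩ := hJ _ (c2.integrable_of_hasCompactSupport k2)
  have e1 : ∫ x, (∫ t, φ t * (∫ ω in survival σ f x t n, θ ω ∂(pathLaw μ))) ∂ν =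
      ∫ x, (∫ t, max (φ t) 0 * (∫ ω in survival σ f x t n, θ ω ∂(pathLaw μ))) ∂ν -
      ∫ x, (∫ t, max (-φ t) 0 * (∫ ω in survival σ f x t n, θ ω ∂(pathLaw μ))) ∂ν := by
    rw [(hJ φ i0).2, h1, h2, ← integral_sub i1 i2]
    refine integral_congr_ae (ae_of_all _ fun y => ?_)
    simp only
    rw [hsub y.2, sub_mul, ← hsub]
  have e2 : ∫ t, φ t * U t = (∫ t, U t * max (φ t) 0) - ∫ t, U t * max (-φ t) 0 := by
    rw [← integral_sub (integrable_monotone_mul hU c1 k1) (integrable_monotone_mul hU c2 k2)]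
    refine integral_congr_ae (ae_of_all _ fun t => ?_)
    simp only
    rw [← mul_sub, ← hsub, mul_comm]
  rw [e1, e2]
  rw [abs_le] at hpos hneg ⊢
  constructor <;> linarith

end Limit

end PerturbedWalk

theorem theoremA1
    {G X Ω' : Type*}
    [Group G] [TopologicalSpace G] [IsTopologicalGroup G] [LocallyCompactSpace G]
    [SecondCountableTopology G] [MeasurableSpace G] [BorelSpace G]
    [TopologicalSpace X] [LocallyCompactSpace X] [SecondCountableTopology X]
    [MeasurableSpace X] [BorelSpace X] [MulAction G X] [ContinuousSMul G X]
    [MeasurableSpace Ω']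
    (μ : Measure G) [IsProbabilityMeasure μ]
    (ν : Measure X) [IsProbabilityMeasure ν] (hν : IsStationary μ ν)
    (σ : G → X → ℝ) (hσ_cont : Continuous (Function.uncurry σ)) (hσ : IsCocycle σ)
    (hσ_exp : HasExpMoment μ σ) (hσ_cent : IsCentered μ σ)
    (v : ℝ) (hv : 0 < v)
    (P' : Measure Ω') (π : Ω' → ℕ → G) (W : ℝ≥0 → Ω' → ℝ)
    (hW : IsStrongApproximation μ σ v P' π W)
    (α β b : ℝ) (hα : 0 < α) (hβ : 0 < β) (hb : 1 ≤ b) :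
    (∀ (f : ℕ → (ℕ → G) × X → ℝ) (θ : (ℕ → G) → ℝ),
      IsAdmissiblePerturbation μ ν α β b f → IsAdmissibleTwist μ β b θ →
        ∃ U : ℝ → ℝ, IsHarmonicLimit μ ν σ f θ U) ∧
    ∀ φ : ℝ → ℝ, Continuous φ → HasCompactSupport φ →
      ∀ ε : ℝ, 0 < ε → ∃ N : ℕ, ∀ n : ℕ, N ≤ n →
        ∀ (f : ℕ → (ℕ → G) × X → ℝ) (θ : (ℕ → G) → ℝ),
          IsAdmissiblePerturbation μ ν α β b f → IsAdmissibleTwist μ β b θ →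
          ∀ U : ℝ → ℝ, IsHarmonicLimit μ ν σ f θ U →
            |v * Real.sqrt (2 * Real.pi * n) / 2 *
                (∫ x, (∫ t, φ t * (∫ ω in survival σ f x t n, θ ω ∂(pathLaw μ))) ∂ν)
              - ∫ t, φ t * U t| < ε := by
  obtain ⟨α₀, M₀, hα₀, hM₀, hσexp⟩ := hσ_exp.exists_bound
  have hcc := CenteredCocycle.of_expMoment hσ_cont.measurable hσ hσ_cent hα₀ hM₀ hσexp
  have hM : 0 ≤ 2 / α₀ ^ 2 * M₀ := by positivity
  refine ⟨fun f θ hf hθ => exists_isHarmonicLimit hν hcc hα₀ hM₀ hσexp hα hb hf hθ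
    fun ψ hψ hk hn => ?_, fun φ hφ hk ε hε => ?_⟩
  · obtain ⟨N, hN⟩ := exists_uniform_survival_limit hν hcc hM hα₀ hM₀ hσexp hv hW hα hβ hb hψ hk hn
      one_pos
    obtain ⟨l, hl, -⟩ := hN f θ hf hθ
    exact ⟨l, hl⟩
  · have hpart : ∀ ψ : ℝ → ℝ, Continuous ψ → HasCompactSupport ψ → (∀ t, 0 ≤ ψ t) →
        ∃ N : ℕ, ∀ n, N ≤ n → ∀ f θ, IsAdmissiblePerturbation μ ν α β b f →
          IsAdmissibleTwist μ β b θ → ∀ U : ℝ → ℝ, IsHarmonicLimit μ ν σ f θ U →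
            |v * Real.sqrt (2 * Real.pi * n) / 2 *
                (∫ x, (∫ t, ψ t * (∫ ω in survival σ f x t n, θ ω ∂(pathLaw μ))) ∂ν)
              - ∫ t, U t * ψ t| ≤ ε / 3 := by
      intro ψ hψ hk hn
      obtain ⟨N, hN⟩ := exists_uniform_survival_limit hν hcc hM hα₀ hM₀ hσexp hv hW hα hβ hb hψ
        hk hn (by linarith : 0 < ε / 3)
      refine ⟨N, fun n hnN f θ hf hθ U hU => ?_⟩
      obtain ⟨l, hl, hlN⟩ := hN f θ hf hθ
      rw [← tendsto_nhds_unique hl (hU.tendsto ψ hψ hk)]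
      exact hlN n hnN
    obtain ⟨N₁, h₁⟩ := hpart (fun t => max (φ t) 0) (by fun_prop)
      (hk.comp_left (g := fun u : ℝ => max u 0) (by simp)) fun t => le_max_right _ _
    obtain ⟨N₂, h₂⟩ := hpart (fun t => max (-φ t) 0) (by fun_prop)
      (hk.comp_left (g := fun u : ℝ => max (-u) 0) (by simp)) fun t => le_max_right _ _
    refine ⟨max N₁ N₂, fun n hn f θ hf hθ U hU => ?_⟩
    refine (abs_sub_le_of_posPart_negPart hσ_cont.measurable (by linarith) hf hθ hU.mono hφ hk n
      (h₁ n ((le_max_left _ _).trans hn) f θ hf hθ U hU)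
      (h₂ n ((le_max_right _ _).trans hn) f θ hf hθ U hU)).trans_lt ?_
    linarith
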